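/- **Theorem (The FRW PIU/FIU Result).** Let $k\in\{-1,0,1\}$, let $J\subseteq\mathbb{R}$ be a non-empty open interval, and let $a:J\to(0,\infty)$ be $C^2$. Consider the FRW model with metric $$ds^2=-dt^2+a(t)^2\Big[\frac{dr^2}{1-kr^2}+r^2(d\theta^2+\sin^2\theta\,d\phi^2)\Big]$$ on $\mathcal M=\{(t,x)\in J\times\mathbb{R}^3: 1-k r^2>0\}$, $r=|x|$, with the coordinate singularities of polar coordinates removed, time-oriented by the fluid flow $u=\partial_t$. (a) Suppose $t_0=\sup J\in\mathbb{R}$. The model admits a Future Isotropic Universe (FIU) with $1<\bar\lambda<+\infty$ at which $u$ is regular if and only if $\lim_{t\to t_0^-}\ddot a a/\dot a^2$ exists (as a finite real number) and is greater than zero, and $a(t)\to+\infty$ as $t\to t_0^-$. (b) Suppose $t_0=\inf J\in\mathbb{R}$. The model admits a Past Isotropic Universe (PIU) with $1<\bar\lambda<+\infty$ at which $u$ is regular if and only if $\lim_{t\to t_0^+}\ddot a a/\dot a^2$ exists (as a finite real number) and is greater than zero, and $a(t)\to+\infty$ as $t\to t_0^+$. Definitions. A space-time is a connected, Hausdorff,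 second countable smooth 4-manifold with a continuous Lorentzian metric and a time orientation. A cosmic time function is a function that strictly increases along every future-directed causal ($C^1$) curve. A time-oriented space-time $(\mathcal M,g)$ *admits an FIU with limit $\bar\lambda\in[-\infty,+\infty]$* if there are a space-time $(\bar{\mathcal M},\bar g)$, a smooth cosmic time function $\bar T$ on $\bar{\mathcal M}$ whose zero set is non-empty, and a function $\bar\Omega$ of $\bar T$, positive on $\mathcal M$, such that 1. $\mathcal M$ is the open submanifold $\bar T<0$ of $\bar{\mathcal M}$ (with the same time orientation); 2. $g=\bar\Omega(\bar T)^2\,\bar g$ on $\mathcal M$, and $\bar g$ is $C^2$ on an open neighbourhood of $\{\bar T=0\}$; 3. $\bar\Omega(\bar T)\to+\infty$ as $\bar T\to0^-$, and for some $c>0$ the function $\bar\Omega$ is $C^2$, strictly increasing and positive on $[-c,0)$; 4. $\bar L=\frac{\bar\Omega''}{\bar\Omega}\big(\frac{\bar\Omega}{\bar\Omega'}\big)^2$ is defined ($\bar\Omega'\ne0$) and continuous on $[-c,0)$, and $\bar L(\bar T)\to\bar\lambda\neq1,2$ as $\bar T\to0^-$. The unit timelike congruence $u$ is *regular* at the FIU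 if there is a unit timelike vector field $\bar u$ on $(\bar{\mathcal M},\bar g)$ with $\bar u=\bar\Omega u$ on $\mathcal M$ that is $C^2$ on an open neighbourhood of $\{\bar T=0\}$. A PIU, and regularity at it, are defined in the same way with $\mathcal M=\{\bar T>0\}$, the limits $\bar T\to0^+$, the interval $(0,c]$ in place of $[-c,0)$, and "strictly decreasing" in place of "strictly increasing". -/

import Mathlib

open Set Filter Topology
open scoped Manifold ContDiff

/-- The coordinate space `ℝ × ℝ³` on which space-times are modelled. -/
abbrev Coord : Type := ℝ × EuclideanSpace ℝ (Fin 3)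

/-- A symmetric bilinear form has Lorentzian signature `(-,+,…,+)`: some vector is timelike and the
form is positive definite on its orthogonal complement. In particular it is non-degenerate. -/
def IsLorentzian {V : Type} [AddCommGroup V] (B : V → V → ℝ) : Prop :=
  ∃ v, B v v < 0 ∧ ∀ w, B v w = 0 → w ≠ 0 → 0 < B w w

section Spacetime

variable (N : Type) [TopologicalSpace N] [ChartedSpace Coord N] [IsManifold 𝓘(ℝ, Coord) ∞ N]

/-- A space-time on the smooth four-manifold `N`: a (continuous) Lorentzian metric together with a
time orientation, given by a continuous timelike vector field which is declared to be
future-directed. Higher differentiability of the metric is imposed where it is needed. -/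
structure Spacetime where
  metric : ∀ p : N, TangentSpace 𝓘(ℝ, Coord) p →L[ℝ] TangentSpace 𝓘(ℝ, Coord) p →L[ℝ] ℝ
  metric_symm : ∀ p v w, metric p v w = metric p w v
  metric_lorentzian : ∀ p, IsLorentzian fun v w => metric p v w
  metric_continuous :
    ContMDiff 𝓘(ℝ, Coord) (𝓘(ℝ, Coord).prod 𝓘(ℝ, Coord →L[ℝ] Coord →L[ℝ] ℝ)) 0
      (fun p => Bundle.TotalSpace.mk' (Coord →L[ℝ] Coord →L[ℝ] ℝ)
        (E := fun p : N =>
          TangentSpace 𝓘(ℝ, Coord) p →L[ℝ] TangentSpace 𝓘(ℝ, Coord) p →L[ℝ] ℝ) p (metric p))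
  orientation : ∀ p : N, TangentSpace 𝓘(ℝ, Coord) p
  orientation_timelike : ∀ p, metric p (orientation p) (orientation p) < 0
  orientation_continuous :
    ContMDiff 𝓘(ℝ, Coord) (𝓘(ℝ, Coord).prod 𝓘(ℝ, Coord)) 0
      (fun p => Bundle.TotalSpace.mk' Coord (E := fun p : N => TangentSpace 𝓘(ℝ, Coord) p)
        p (orientation p))

end Spacetime

section Conformal

variable {N : Type} [TopologicalSpace N] [ChartedSpace Coord N] [IsManifold 𝓘(ℝ, Coord) ∞ N]

/-- The metric is of class `C²` on the set `U`. -/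
def Spacetime.MetricC2On (S : Spacetime N) (U : Set N) : Prop :=
  ContMDiffOn 𝓘(ℝ, Coord) (𝓘(ℝ, Coord).prod 𝓘(ℝ, Coord →L[ℝ] Coord →L[ℝ] ℝ)) 2
    (fun p => Bundle.TotalSpace.mk' (Coord →L[ℝ] Coord →L[ℝ] ℝ)
      (E := fun p : N =>
        TangentSpace 𝓘(ℝ, Coord) p →L[ℝ] TangentSpace 𝓘(ℝ, Coord) p →L[ℝ] ℝ) p (S.metric p)) U

/-- The vector field `X` is of class `C²` on the set `U`. -/
def VectorFieldC2On (X : ∀ p : N, TangentSpace 𝓘(ℝ, Coord) p) (U : Set N) : Prop :=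
  ContMDiffOn 𝓘(ℝ, Coord) (𝓘(ℝ, Coord).prod 𝓘(ℝ, Coord)) 2
    (fun p => Bundle.TotalSpace.mk' Coord (E := fun p : N => TangentSpace 𝓘(ℝ, Coord) p)
      p (X p)) U

/-- `v` is a future-directed causal (timelike or null, non-zero) vector. -/
def Spacetime.FutureCausal (S : Spacetime N) (p : N) (v : TangentSpace 𝓘(ℝ, Coord) p) : Prop :=
  v ≠ 0 ∧ S.metric p v v ≤ 0 ∧ S.metric p v (S.orientation p) < 0

/-- `γ` restricted to `[α, β]` is a `C¹` future-directed causal curve. -/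
def Spacetime.IsFutureCausalCurve (S : Spacetime N) (γ : ℝ → N) (α β : ℝ) : Prop :=
  ContMDiffOn 𝓘(ℝ, ℝ) 𝓘(ℝ, Coord) 1 γ (Icc α β) ∧
    ∀ s ∈ Icc α β,
      S.FutureCausal (γ s) (mfderivWithin 𝓘(ℝ, ℝ) 𝓘(ℝ, Coord) γ (Icc α β) s (1 : ℝ))

/-- A cosmic time function: it increases along every future-directed causal curve. -/
def Spacetime.IsCosmicTime (S : Spacetime N) (T : N → ℝ) : Prop :=
  ∀ (γ : ℝ → N) (α β : ℝ), α < β → S.IsFutureCausalCurve γ α β →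
    StrictMonoOn (T ∘ γ) (Icc α β)

/-- The conditions, common to past and future structures, relating a physical space-time to an
unphysical one. The physical space-time is given in a global coordinate system: it is the open set
`D` of `ℝ × ℝ³` with metric `g`, and is time-oriented by the timelike vector field `u`. The
unphysical space-time is `(N, S)`, with smooth cosmic time function `T` and conformal factor
`Ω(T)`, and the physical manifold is the open submanifold `M` of `N`; the chart `φ` of `N`
consists of the physical coordinates. -/
structure IsConformalExtension (D : Set Coord) (g : Coord → Coord → Coord → ℝ) (u : Coord → Coord)
    (S : Spacetime N) (T : N → ℝ) (Ω : ℝ → ℝ) (M : Set N)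
    (φ : OpenPartialHomeomorph N Coord) : Prop where
  time_smooth : ContMDiff 𝓘(ℝ, Coord) 𝓘(ℝ, ℝ) ∞ T
  cosmicTime : S.IsCosmicTime T
  chart_mem : φ ∈ IsManifold.maximalAtlas 𝓘(ℝ, Coord) ∞ N
  chart_source : φ.source = M
  chart_target : φ.target = D
  /-- On `M` the time orientation of the unphysical space-time is the physical one. -/
  orientation_compat : ∀ p ∈ M, ∀ v : TangentSpace 𝓘(ℝ, Coord) p,
    mfderiv 𝓘(ℝ, Coord) 𝓘(ℝ, Coord) φ p v = u (φ p) → S.metric p v (S.orientation p) < 0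
  factor_pos : ∀ p ∈ M, 0 < Ω (T p)
  /-- `g = Ω² ḡ` on `M`. -/
  conformal : ∀ p ∈ M, ∀ v w : TangentSpace 𝓘(ℝ, Coord) p,
    g (φ p) (mfderiv 𝓘(ℝ, Coord) 𝓘(ℝ, Coord) φ p v) (mfderiv 𝓘(ℝ, Coord) 𝓘(ℝ, Coord) φ p w)
      = Ω (T p) ^ 2 * S.metric p v w
  /-- The hypersurface `T = 0` (the event) is really there. -/
  event_nonempty : ∃ p, T p = 0
  metric_regular : ∃ U : Set N, IsOpen U ∧ {p | T p = 0} ⊆ U ∧ S.MetricC2On U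

/-- The unit timelike congruence `u` of the physical space-time is regular at the hypersurface
`T = 0`: there is a unit timelike vector field `ū` on `N` with `ū = Ω u` on `M` which is `C²` on
an open neighbourhood of `T = 0`. -/
def IsFlowRegular (u : Coord → Coord) (S : Spacetime N) (T : N → ℝ) (Ω : ℝ → ℝ) (M : Set N)
    (φ : OpenPartialHomeomorph N Coord) : Prop :=
  ∃ ubar : ∀ p : N, TangentSpace 𝓘(ℝ, Coord) p,
    (∀ p, S.metric p (ubar p) (ubar p) = -1) ∧
    (∀ p ∈ M, mfderiv 𝓘(ℝ, Coord) 𝓘(ℝ, Coord) φ p (ubar p) = Ω (T p) • u (φ p)) ∧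
    ∃ V : Set N, IsOpen V ∧ {p | T p = 0} ⊆ V ∧ VectorFieldC2On ubar V

end Conformal

/-- `L = (Ω'' / Ω) (Ω / Ω')²`, with derivatives (one-sided at an end point) on the interval `I`. -/
noncomputable def conformalL (Ω : ℝ → ℝ) (I : Set ℝ) (T : ℝ) : ℝ :=
  iteratedDerivWithin 2 Ω I T / Ω T * (Ω T / derivWithin Ω I T) ^ 2

/-- The conditions on the conformal factor of a Future Isotropic Universe with limit `lam`. -/
def IsFIUFactor (Ω : ℝ → ℝ) (lam : EReal) : Prop :=
  Tendsto Ω (𝓝[<] 0) atTop ∧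
  ∃ c > 0,
    ContDiffOn ℝ 2 Ω (Ico (-c) 0) ∧ StrictMonoOn Ω (Ico (-c) 0) ∧
    (∀ T ∈ Ico (-c) 0, 0 < Ω T) ∧
    (∀ T ∈ Ico (-c) 0, derivWithin Ω (Ico (-c) 0) T ≠ 0) ∧
    ContinuousOn (conformalL Ω (Ico (-c) 0)) (Ico (-c) 0) ∧
    Tendsto (fun T => (conformalL Ω (Ico (-c) 0) T : EReal)) (𝓝[<] 0) (𝓝 lam) ∧
    lam ≠ 1 ∧ lam ≠ 2

/-- The conditions on the conformal factor of a Past Isotropic Universe with limit `lam`. -/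
def IsPIUFactor (Ω : ℝ → ℝ) (lam : EReal) : Prop :=
  Tendsto Ω (𝓝[>] 0) atTop ∧
  ∃ c > 0,
    ContDiffOn ℝ 2 Ω (Ioc 0 c) ∧ StrictAntiOn Ω (Ioc 0 c) ∧
    (∀ T ∈ Ioc 0 c, 0 < Ω T) ∧
    (∀ T ∈ Ioc 0 c, derivWithin Ω (Ioc 0 c) T ≠ 0) ∧
    ContinuousOn (conformalL Ω (Ioc 0 c)) (Ioc 0 c) ∧
    Tendsto (fun T => (conformalL Ω (Ioc 0 c) T : EReal)) (𝓝[>] 0) (𝓝 lam) ∧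
    lam ≠ 1 ∧ lam ≠ 2

/-- The space-time `(D, g)` admits a Future Isotropic Universe with limit `lam` at which the unit
timelike congruence `u` is regular. -/
def AdmitsRegularFIU (D : Set Coord) (g : Coord → Coord → Coord → ℝ) (u : Coord → Coord)
    (lam : EReal) : Prop :=
  ∃ (N : Type) (_ : TopologicalSpace N) (_ : ChartedSpace Coord N)
    (_ : IsManifold 𝓘(ℝ, Coord) ∞ N) (_ : T2Space N) (_ : SecondCountableTopology N)
    (_ : ConnectedSpace N) (S : Spacetime N) (T : N → ℝ) (Ω : ℝ → ℝ)
    (φ : OpenPartialHomeomorph N Coord),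
    IsConformalExtension D g u S T Ω {p | T p < 0} φ ∧ IsFIUFactor Ω lam ∧
      IsFlowRegular u S T Ω {p | T p < 0} φ

/-- The space-time `(D, g)` admits a Past Isotropic Universe with limit `lam` at which the unit
timelike congruence `u` is regular. -/
def AdmitsRegularPIU (D : Set Coord) (g : Coord → Coord → Coord → ℝ) (u : Coord → Coord)
    (lam : EReal) : Prop :=
  ∃ (N : Type) (_ : TopologicalSpace N) (_ : ChartedSpace Coord N)
    (_ : IsManifold 𝓘(ℝ, Coord) ∞ N) (_ : T2Space N) (_ : SecondCountableTopology N)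
    (_ : ConnectedSpace N) (S : Spacetime N) (T : N → ℝ) (Ω : ℝ → ℝ)
    (φ : OpenPartialHomeomorph N Coord),
    IsConformalExtension D g u S T Ω {p | 0 < T p} φ ∧ IsPIUFactor Ω lam ∧
      IsFlowRegular u S T Ω {p | 0 < T p} φ

/-- A Friedmann-Robertson-Walker model: curvature index `k ∈ {-1, 0, 1}`, an open interval `dom` of
cosmic times `t`, and a positive `C²` scale factor on it. -/
structure FRWModel where
  k : ℤ
  k_mem : k = -1 ∨ k = 0 ∨ k = 1
  dom : Set ℝ
  dom_open : IsOpen dom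
  dom_interval : dom.OrdConnected
  dom_nonempty : dom.Nonempty
  scale : ℝ → ℝ
  scale_pos : ∀ t ∈ dom, 0 < scale t
  scale_contDiffOn : ContDiffOn ℝ 2 scale dom

namespace FRWModel

/-- The coordinate domain: `t` in the given interval and `1 - k r² > 0`, where `r = ‖x‖`. -/
def domain (F : FRWModel) : Set Coord :=
  {z | z.1 ∈ F.dom ∧ 0 < 1 - (F.k : ℝ) * ‖z.2‖ ^ 2}

/-- The metric `-dt² + a(t)² [dr² / (1 - k r²) + r² (dθ² + sin² θ dφ²)]`, written in the Cartesian
coordinates `x = r (sin θ cos φ, sin θ sin φ, cos θ)`, in which `|dx|² = dr² + r² dω²` and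
`x · dx = r dr`, so that the bracket becomes `|dx|² + k (x · dx)² / (1 - k |x|²)`. -/
noncomputable def metric (F : FRWModel) (z v w : Coord) : ℝ :=
  -(v.1 * w.1) + F.scale z.1 ^ 2 *
    (inner ℝ v.2 w.2 +
      (F.k : ℝ) * (inner ℝ z.2 v.2 * inner ℝ z.2 w.2) / (1 - (F.k : ℝ) * ‖z.2‖ ^ 2))

/-- The cosmological fluid flow `∂/∂t`. -/
def flow (_F : FRWModel) (_z : Coord) : Coord := (1, 0)

/-- The function `ä a / ȧ²`. -/
noncomputable def accelRatio (F : FRWModel) (t : ℝ) : ℝ :=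
  deriv (deriv F.scale) t * F.scale t / deriv F.scale t ^ 2

end FRWModel

/-! Necessity. Let `γ` be the integral curve of the unphysical unit flow through a point of the
event, with parameter `s`, and let `f = T ∘ γ`. In physical coordinates `γ` is a line `x = const`
with `dt/ds = Ω(f)`. A vector field Lie-transported along `γ` has constant spatial components in
these coordinates, so comparing its spatial length in the two metrics gives `a = β Ω(f)`, where `β`
is positive and `C²` across `s = 0` (`LocalEvent.exists_flow_line`, `LocalEvent.flow_line_eq`,
`LocalEvent.spatial_eq`).

It remains to see how `f` vanishes at `s = 0`. Although `T` is smooth, `γ` is not, so `f` has no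
Taylor expansion of high order; instead the leading terms of `T` and of its first two differentials
are evaluated along `γ` (`tendsto_along_curve`). If `T` is flat at the point, then `Ω(f) ≥ const /
|s|` because `λ` is finite, and `t` would diverge, contradicting `t < t₀` (`IsFIUFactor.not_flat`).
Otherwise `T` has a finite order `n`. As `T` increases along all directions near the flow, its
leading form cannot vanish in the direction of the flow (`HasLeadingTerm.ne_zero_of_monotone`), so
`f` behaves like `c sⁿ` together with two derivatives. A computation then gives `ä a / ȧ² → (λ - 1)
/ n` (`FRWModel.tendsto_of_flow_line`).

Sufficiency. The natural time `ds = dt / a` is not smooth when `a` is only `C²`, whereas the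
physical chart has to be. It is replaced by a smooth `s < 0` with `dt/ds = a β`, where `β` tends to
`1` so fast that it extends as a `C²` function by `1` (`exists_smooth_conformal_time`). The physical
metric is `a² (-β² ds² + σ)`, with `σ` the metric of the unit slice, and the bracket extends across
`s = 0`. With `T = sⁿ`, `n` odd, and `Ω = a`, the limit is `λ = 1 + n q`, where `q = lim ä a / ȧ²`.
The choice `n = 1` works unless `q = 1`, when the forbidden value `λ = 2` is avoided by `n = 3`.

The statement about the past follows by reversing time. -/

/-! ### Leading terms of smooth functions at a point -/

section Jets

open Asymptotics

/-- `q` is the leading term of order `m` of `G` at the origin in the direction `v`, locally uniformly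
in the direction. -/
def HasLeadingTerm {E F : Type} [NormedAddCommGroup E] [NormedSpace ℝ E] [NormedAddCommGroup F]
    [NormedSpace ℝ F] (m : ℕ) (G : E → F) (v : E) (q : F) : Prop :=
  (fun x : ℝ × E => G (x.1 • x.2) - x.1 ^ m • q) =o[𝓝 ((0 : ℝ), v)] fun x : ℝ × E => x.1 ^ m

variable {E F : Type} [NormedAddCommGroup E] [NormedSpace ℝ E] [NormedAddCommGroup F]
  [NormedSpace ℝ F]

theorem hasLeadingTerm_zero {G : E → F} (hG : ContinuousAt G 0) (v : E) :
    HasLeadingTerm 0 G v (G 0) := by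
  have hc : Tendsto (fun x : ℝ × E => G (x.1 • x.2)) (𝓝 ((0 : ℝ), v)) (𝓝 (G 0)) := by
    have h1 : Tendsto (fun x : ℝ × E => x.1 • x.2) (𝓝 ((0 : ℝ), v)) (𝓝 0) := by
      have : Continuous fun x : ℝ × E => x.1 • x.2 := by fun_prop
      simpa using this.tendsto ((0 : ℝ), v)
    exact hG.tendsto.comp h1
  have h2 : Tendsto (fun x : ℝ × E => G (x.1 • x.2) - G 0) (𝓝 ((0 : ℝ), v)) (𝓝 0) := by
    simpa using hc.sub_const (G 0)
  simpa [HasLeadingTerm, isLittleO_one_iff] using h2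

theorem HasLeadingTerm.eventually {m : ℕ} {G : E → F} {v : E} {q : F}
    (h : HasLeadingTerm m G v q) {ε : ℝ} (hε : 0 < ε) :
    ∃ δ > 0, ∃ η > 0, ∀ s : ℝ, |s| < δ → ∀ z ∈ Metric.ball v η,
      ‖G (s • z) - s ^ m • q‖ ≤ ε * |s| ^ m := by
  have := h.bound hε
  rw [nhds_prod_eq, eventually_prod_iff] at this
  obtain ⟨p1, hp1, p2, hp2, hp⟩ := this
  obtain ⟨δ, hδ, h1⟩ := Metric.eventually_nhds_iff_ball.1 hp1
  obtain ⟨η, hη, h2⟩ := Metric.eventually_nhds_iff_ball.1 hp2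
  refine ⟨δ, hδ, η, hη, fun s hs z hz => ?_⟩
  have := hp (h1 s (by simpa using hs)) (h2 z hz)
  simpa using this

theorem eventually_differentiableAt_smul {G : E → F} (hG : ContDiffAt ℝ ∞ G 0) (v : E) :
    ∃ δ > 0, ∃ η > 0, ∀ s : ℝ, |s| < δ → ∀ z ∈ Metric.ball v η, DifferentiableAt ℝ G (s • z) := by
  have h1 : ∀ᶠ x in 𝓝 (0 : E), DifferentiableAt ℝ G x := by
    have := (hG.of_le (m := 1) (by simp)).eventually (by simp)
    filter_upwards [this] with x hx using hx.differentiableAt (by simp)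
  have h2 : Tendsto (fun x : ℝ × E => x.1 • x.2) (𝓝 ((0 : ℝ), v)) (𝓝 0) := by
    have : Continuous fun x : ℝ × E => x.1 • x.2 := by fun_prop
    simpa using this.tendsto ((0 : ℝ), v)
  have := h2.eventually h1
  rw [nhds_prod_eq, eventually_prod_iff] at this
  obtain ⟨p1, hp1, p2, hp2, hp⟩ := this
  obtain ⟨δ, hδ, h1⟩ := Metric.eventually_nhds_iff_ball.1 hp1
  obtain ⟨η, hη, h2⟩ := Metric.eventually_nhds_iff_ball.1 hp2
  exact ⟨δ, hδ, η, hη, fun s hs z hz => hp (h1 s (by simpa using hs)) (h2 z hz)⟩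

/-- Mean value inequality along the ray through `z`: the derivative of `y ↦ G (y • z) - y ^ (m+1) /
(m+1) • q z` is the error in the leading term of `fderiv ℝ G`, applied to `z`. Working with
differentials in this way avoids symmetric multilinear forms: every statement on order `m` follows
by induction on `m`. -/
theorem HasLeadingTerm.integrate {m : ℕ} {G : E → F} (hG : ContDiffAt ℝ ∞ G 0) (h0 : G 0 = 0)
    {v : E} {q : E →L[ℝ] F} (hq : HasLeadingTerm m (fderiv ℝ G) v q) :
    HasLeadingTerm (m + 1) G v ((m + 1 : ℝ)⁻¹ • q v) := by
  have key : (fun x : ℝ × E => G (x.1 • x.2) - (x.1 ^ (m + 1) * (m + 1 : ℝ)⁻¹) • q x.2)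
      =o[𝓝 ((0 : ℝ), v)] fun x : ℝ × E => x.1 ^ (m + 1) := by
    rw [isLittleO_iff]
    intro c hc
    obtain ⟨δ, hδ, η, hη, hb⟩ := hq.eventually (ε := c / (‖v‖ + 1)) (by positivity)
    obtain ⟨δ', hδ', η', hη', hd⟩ := eventually_differentiableAt_smul hG v
    have e1 : ∀ᶠ s : ℝ in 𝓝 0, |s| < min δ δ' := by
      filter_upwards [Metric.ball_mem_nhds (0 : ℝ) (lt_min hδ hδ')] with s hs
      simpa using hs
    have e2 : ∀ᶠ z in 𝓝 v, z ∈ Metric.ball v (min 1 (min η η')) :=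
      Metric.ball_mem_nhds v (lt_min one_pos (lt_min hη hη'))
    rw [nhds_prod_eq]
    filter_upwards [e1.prod_mk e2] with ⟨s, z⟩ ⟨hs, hz⟩
    simp only [lt_min_iff, Metric.mem_ball] at hs hz
    have hzn : ‖z‖ ≤ ‖v‖ + 1 := by
      have : ‖z - v‖ < 1 := by simpa [dist_eq_norm] using hz.1
      calc ‖z‖ = ‖v + (z - v)‖ := by simp
        _ ≤ _ := (norm_add_le _ _).trans (by linarith)
    have hder : ∀ y ∈ segment ℝ (0 : ℝ) s, HasDerivWithinAt
        (fun y : ℝ => G (y • z) - (y ^ (m + 1) * (m + 1 : ℝ)⁻¹) • q z)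
        (fderiv ℝ G (y • z) z - y ^ m • q z) (segment ℝ (0 : ℝ) s) y := by
      intro y hy
      have hy' : |y| ≤ |s| := by
        rw [segment_eq_uIcc, mem_uIcc] at hy
        rcases hy with hy | hy
        · rw [abs_of_nonneg hy.1]; exact hy.2.trans (le_abs_self s)
        · rw [abs_of_nonpos hy.2, abs_of_nonpos (hy.1.trans hy.2)]; linarith [hy.1]
      have h1 : HasDerivAt (fun y : ℝ => G (y • z)) (fderiv ℝ G (y • z) z) y := by
        have := (hd y (hy'.trans_lt hs.2) z hz.2.2).hasFDerivAt
        have h2 : HasDerivAt (fun y : ℝ => y • z) z y := by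
          simpa using (hasDerivAt_id y).smul_const z
        exact this.comp_hasDerivAt y h2
      have h2 : HasDerivAt (fun y : ℝ => (y ^ (m + 1) * (m + 1 : ℝ)⁻¹) • q z) (y ^ m • q z) y := by
        have := ((hasDerivAt_pow (m + 1) y).mul_const (m + 1 : ℝ)⁻¹).smul_const (q z)
        convert this using 2
        push_cast
        have : (m + 1 : ℝ) ≠ 0 := by positivity
        field_simp
      exact (h1.sub h2).hasDerivWithinAt
    have hbd : ∀ y ∈ segment ℝ (0 : ℝ) s,
        ‖fderiv ℝ G (y • z) z - y ^ m • q z‖ ≤ c * |s| ^ m := by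
      intro y hy
      have hy' : |y| ≤ |s| := by
        rw [segment_eq_uIcc, mem_uIcc] at hy
        rcases hy with hy | hy
        · rw [abs_of_nonneg hy.1]; exact hy.2.trans (le_abs_self s)
        · rw [abs_of_nonpos hy.2, abs_of_nonpos (hy.1.trans hy.2)]; linarith [hy.1]
      have h1 := hb y (hy'.trans_lt hs.1) z hz.2.1
      have h2 : fderiv ℝ G (y • z) z - y ^ m • q z = (fderiv ℝ G (y • z) - y ^ m • q) z := by simp
      rw [h2]
      calc _ ≤ ‖fderiv ℝ G (y • z) - y ^ m • q‖ * ‖z‖ := ContinuousLinearMap.le_opNorm _ _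
        _ ≤ (c / (‖v‖ + 1) * |y| ^ m) * (‖v‖ + 1) := by gcongr
        _ = c * |y| ^ m := by field_simp
        _ ≤ _ := by gcongr
    have := (convex_segment (0 : ℝ) s).norm_image_sub_le_of_norm_hasDerivWithin_le hder hbd
      (left_mem_segment ℝ _ _) (right_mem_segment ℝ _ _)
    simp only [zero_smul, h0, ne_eq, Nat.add_eq_zero_iff, one_ne_zero, and_false,
      not_false_eq_true, zero_pow, zero_mul, sub_zero, Real.norm_eq_abs] at this
    simpa [pow_succ, mul_assoc] using this
  -- Local uniformity in the direction: `q z` may be replaced by `q v`, since `q z - q v` tends to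
  -- zero as `z → v`.
  have h2 : (fun x : ℝ × E => (x.1 ^ (m + 1) * (m + 1 : ℝ)⁻¹) • q x.2 -
      x.1 ^ (m + 1) • (m + 1 : ℝ)⁻¹ • q v) =o[𝓝 ((0 : ℝ), v)] fun x : ℝ × E => x.1 ^ (m + 1) := by
    have h3 : (fun x : ℝ × E => (m + 1 : ℝ)⁻¹ • (q x.2 - q v)) =o[𝓝 ((0 : ℝ), v)]
        fun _ => (1 : ℝ) := by
      rw [isLittleO_one_iff]
      have : Continuous fun x : ℝ × E => (m + 1 : ℝ)⁻¹ • (q x.2 - q v) := by fun_prop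
      simpa using this.tendsto ((0 : ℝ), v)
    have := (isBigO_refl (fun x : ℝ × E => x.1 ^ (m + 1)) (𝓝 ((0 : ℝ), v))).smul_isLittleO h3
    simp only [smul_eq_mul, mul_one] at this
    refine this.congr_left fun x => ?_
    rw [smul_sub, smul_sub, smul_smul]
  refine (key.add h2).congr_left fun x => ?_
  simp

theorem contDiffAt_fderiv_infty {G : E → F} {x : E} (hG : ContDiffAt ℝ ∞ G x) :
    ContDiffAt ℝ ∞ (fderiv ℝ G) x :=
  hG.fderiv_right (m := ∞) (by simp)

theorem iteratedFDeriv_fderiv_eq_zero {G : E → F} {j : ℕ}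
    (h : iteratedFDeriv ℝ (j + 1) G 0 = 0) : iteratedFDeriv ℝ j (fderiv ℝ G) 0 = 0 := by
  rw [← norm_eq_zero, norm_iteratedFDeriv_fderiv, h, norm_zero]

theorem apply_eq_zero_of_iteratedFDeriv_zero {G : E → F} {x : E}
    (h : iteratedFDeriv ℝ 0 G x = 0) : G x = 0 := by
  rw [← norm_eq_zero, ← norm_iteratedFDeriv_zero (𝕜 := ℝ), h, norm_zero]

/-- Induction on `m`, applied to the differential of `G` and integrated. The target space is
quantified inside the induction because it changes from `F` to `E →L[ℝ] F`. -/
theorem exists_hasLeadingTerm (m : ℕ) : ∀ {F : Type} [NormedAddCommGroup F] [NormedSpace ℝ F]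
    {G : E → F}, ContDiffAt ℝ ∞ G 0 → (∀ j < m, iteratedFDeriv ℝ j G 0 = 0) → ∀ v : E,
    ∃ q, HasLeadingTerm m G v q := by
  induction m with
  | zero => exact fun hG _ v => ⟨_, hasLeadingTerm_zero hG.continuousAt v⟩
  | succ m ih =>
    intro F _ _ G hG h v
    obtain ⟨q, hq⟩ := ih (contDiffAt_fderiv_infty hG)
      (fun j hj => iteratedFDeriv_fderiv_eq_zero (h (j + 1) (by omega))) v
    exact ⟨_, hq.integrate hG (apply_eq_zero_of_iteratedFDeriv_zero (h 0 (by omega)))⟩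

theorem HasLeadingTerm.congr_order_zero_le {m : ℕ} {G : E → F} {v : E} {q : F}
    (h : HasLeadingTerm m G v q) :
    Tendsto (fun s : ℝ => (s ^ m)⁻¹ • G (s • v)) (𝓝[≠] 0) (𝓝 q) := by
  have h1 : Tendsto (fun s : ℝ => (s, v)) (𝓝[≠] 0) (𝓝 ((0 : ℝ), v)) :=
    (Continuous.prodMk_left v).tendsto' _ _ rfl |>.mono_left nhdsWithin_le_nhds
  have h2 := (h.comp_tendsto h1)
  have h3 : Tendsto (fun s : ℝ => (s ^ m)⁻¹ • (G (s • v) - s ^ m • q)) (𝓝[≠] 0) (𝓝 0) := by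
    exact h2.tendsto_inv_smul_nhds_zero
  have h4 : Tendsto (fun s : ℝ => (s ^ m)⁻¹ • (G (s • v) - s ^ m • q) + q) (𝓝[≠] 0) (𝓝 q) := by
    simpa using h3.add_const q
  refine h4.congr' ?_
  filter_upwards [self_mem_nhdsWithin] with s hs
  have : s ^ m ≠ 0 := pow_ne_zero _ hs
  rw [smul_sub, inv_smul_smul₀ this, sub_add_cancel]

/-- The mean value inequality for `y ↦ G (s • y) - s ^ (m+1) • q y` between `z` and `z + h` bounds
the increment by `ε |s| ^ (m+1) ‖h‖`. After division by `s ^ (m+1)` both values of `G` disappear in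
the limit, which leaves `‖q h‖ ≤ ε ‖h‖`. -/
theorem HasLeadingTerm.fderiv_eq_zero {m : ℕ} {G : E → F} (hG : ContDiffAt ℝ ∞ G 0)
    {O : Set E} (hO : IsOpen O) (h0 : ∀ z ∈ O, HasLeadingTerm (m + 1) G z 0)
    {z : E} (hz : z ∈ O) {q : E →L[ℝ] F} (hq : HasLeadingTerm m (fderiv ℝ G) z q) : q = 0 := by
  obtain ⟨η₀, hη₀, hball⟩ := Metric.isOpen_iff.1 hO z hz
  have claim : ∀ ε > 0, ‖q‖ ≤ ε := by
    intro ε hε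
    obtain ⟨δ, hδ, η, hη, hb⟩ := hq.eventually hε
    obtain ⟨δ', hδ', η', hη', hd⟩ := eventually_differentiableAt_smul hG z
    set r := min η₀ (min η η') with hr
    have hr0 : 0 < r := lt_min hη₀ (lt_min hη hη')
    refine ContinuousLinearMap.opNorm_le_of_ball hr0 hε.le fun h hh => ?_
    have hzh : z + h ∈ O := hball (by
      simp only [Metric.mem_ball, dist_self_add_left] at hh ⊢
      have := hh.trans_le (min_le_left η₀ (min η η'))
      simpa using this)
    have hlim : Tendsto (fun s : ℝ => (s ^ (m + 1))⁻¹ • G (s • (z + h)) -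
        (s ^ (m + 1))⁻¹ • G (s • z) - q h) (𝓝[≠] 0) (𝓝 (0 - 0 - q h)) :=
      (((h0 _ hzh).congr_order_zero_le).sub ((h0 _ hz).congr_order_zero_le)).sub_const _
    have hle : ∀ᶠ s : ℝ in 𝓝[≠] 0, ‖(s ^ (m + 1))⁻¹ • G (s • (z + h)) -
        (s ^ (m + 1))⁻¹ • G (s • z) - q h‖ ≤ ε * ‖h‖ := by
      have e1 : ∀ᶠ s : ℝ in 𝓝[≠] 0, |s| < min δ δ' := by
        filter_upwards [nhdsWithin_le_nhds (Metric.ball_mem_nhds (0 : ℝ) (lt_min hδ hδ'))]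
          with s hs
        simpa using hs
      filter_upwards [e1, self_mem_nhdsWithin] with s hs hs0
      rw [lt_min_iff] at hs
      have hs1 : 0 < |s| := abs_pos.2 hs0
      have hder : ∀ y ∈ Metric.ball z r, HasFDerivWithinAt
          (fun y : E => G (s • y) - (s ^ (m + 1)) • q y)
          (s • fderiv ℝ G (s • y) - s ^ (m + 1) • q) (Metric.ball z r) y := by
        intro y hy
        have hy' : y ∈ Metric.ball z η' := Metric.ball_subset_ball
          ((min_le_right _ _).trans (min_le_right _ _)) hy
        have h1 := (hd s hs.2 y hy').hasFDerivAt
        have h2 : HasFDerivAt (fun y : E => s • y) (s • ContinuousLinearMap.id ℝ E) y :=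
          (hasFDerivAt_id y).const_smul s
        have h3 := (h1.comp y h2).sub (q.hasFDerivAt.const_smul (s ^ (m + 1)))
        have h4 : (fderiv ℝ G (s • y)).comp (s • ContinuousLinearMap.id ℝ E)
            = s • fderiv ℝ G (s • y) := by ext; simp
        rw [h4] at h3
        exact h3.hasFDerivWithinAt
      have hbd : ∀ y ∈ Metric.ball z r, ‖s • fderiv ℝ G (s • y) - s ^ (m + 1) • q‖
          ≤ |s| ^ (m + 1) * ε := by
        intro y hy
        have := hb s hs.1 y (Metric.ball_subset_ball
          ((min_le_right _ _).trans (min_le_left _ _)) hy)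
        have e : s • fderiv ℝ G (s • y) - s ^ (m + 1) • q
            = s • (fderiv ℝ G (s • y) - s ^ m • q) := by
          rw [smul_sub, smul_smul, pow_succ']
        rw [e, norm_smul, Real.norm_eq_abs]
        calc _ ≤ |s| * (ε * |s| ^ m) := by gcongr
          _ = _ := by ring
      have hm := (convex_ball z r).norm_image_sub_le_of_norm_hasFDerivWithin_le hder hbd
        (Metric.mem_ball_self hr0) (show z + h ∈ Metric.ball z r by simpa using hh)
      have hsm : s ^ (m + 1) ≠ 0 := pow_ne_zero _ hs0
      have e : (s ^ (m + 1))⁻¹ • G (s • (z + h)) - (s ^ (m + 1))⁻¹ • G (s • z) - q h =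
          (s ^ (m + 1))⁻¹ • (G (s • (z + h)) - s ^ (m + 1) • q (z + h) -
            (G (s • z) - s ^ (m + 1) • q z)) := by
        rw [smul_sub, smul_sub, smul_sub, inv_smul_smul₀ hsm, inv_smul_smul₀ hsm, map_add]
        abel
      rw [e, norm_smul, norm_inv, norm_pow, Real.norm_eq_abs, inv_mul_le_iff₀ (by positivity)]
      simpa [mul_assoc] using hm
    have := le_of_tendsto hlim.norm hle
    simpa using this
  exact norm_le_zero_iff.1 (le_of_forall_pos_le_add fun ε hε => by simpa using claim ε hε)

/-- This is the fact that a homogeneous polynomial vanishing on a non-empty open set is zero, in a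
form that passes to differentials by induction. -/
theorem iteratedFDeriv_eq_zero_of_hasLeadingTerm (m : ℕ) :
    ∀ {F : Type} [NormedAddCommGroup F] [NormedSpace ℝ F]
    {G : E → F}, ContDiffAt ℝ ∞ G 0 → (∀ j < m, iteratedFDeriv ℝ j G 0 = 0) → ∀ {O : Set E},
    IsOpen O → O.Nonempty → (∀ z ∈ O, HasLeadingTerm m G z 0) → iteratedFDeriv ℝ m G 0 = 0 := by
  induction m with
  | zero =>
    intro F _ _ G hG _ O _ ⟨z, hz⟩ h
    have h1 := (h z hz).congr_order_zero_le
    have h2 := (hasLeadingTerm_zero hG.continuousAt z).congr_order_zero_le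
    rw [← norm_eq_zero, norm_iteratedFDeriv_zero, tendsto_nhds_unique h2 h1, norm_zero]
  | succ m ih =>
    intro F _ _ G hG h O hO hne h0
    have h' : ∀ j < m, iteratedFDeriv ℝ j (fderiv ℝ G) 0 = 0 :=
      fun j hj => iteratedFDeriv_fderiv_eq_zero (h (j + 1) (by omega))
    have := ih (contDiffAt_fderiv_infty hG) h' hO hne fun z hz => by
      obtain ⟨q, hq⟩ := exists_hasLeadingTerm m (contDiffAt_fderiv_infty hG) h' z
      rwa [hq.fderiv_eq_zero hG hO h0 hz] at hq
    rw [← norm_eq_zero, ← norm_iteratedFDeriv_fderiv, this, norm_zero]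

theorem HasLeadingTerm.unique {m : ℕ} {G : E → F} {v : E} {q q' : F}
    (h : HasLeadingTerm m G v q) (h' : HasLeadingTerm m G v q') : q = q' :=
  tendsto_nhds_unique h.congr_order_zero_le h'.congr_order_zero_le

/-- The leading term along a curve `s • z s` with `z s → v`. -/
theorem HasLeadingTerm.tendsto_comp {m : ℕ} {G : E → F} {v : E} {q : F}
    (h : HasLeadingTerm m G v q) {z : ℝ → E} (hz : Tendsto z (𝓝[<] 0) (𝓝 v)) :
    Tendsto (fun s : ℝ => (s ^ m)⁻¹ • G (s • z s)) (𝓝[<] 0) (𝓝 q) := by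
  have h1 : Tendsto (fun s : ℝ => (s, z s)) (𝓝[<] 0) (𝓝 ((0 : ℝ), v)) :=
    (tendsto_id.mono_left nhdsWithin_le_nhds).prodMk_nhds hz
  have h2 := (h.comp_tendsto h1)
  have h3 : Tendsto (fun s : ℝ => (s ^ m)⁻¹ • (G (s • z s) - s ^ m • q)) (𝓝[<] 0) (𝓝 0) :=
    h2.tendsto_inv_smul_nhds_zero
  have h4 : Tendsto (fun s : ℝ => (s ^ m)⁻¹ • (G (s • z s) - s ^ m • q) + q) (𝓝[<] 0) (𝓝 q) := by
    simpa using h3.add_const q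
  refine h4.congr' ?_
  filter_upwards [self_mem_nhdsWithin] with s hs
  have : s ^ m ≠ 0 := pow_ne_zero _ (ne_of_lt hs)
  rw [smul_sub, inv_smul_smul₀ this, sub_add_cancel]

end Jets

theorem tendsto_clm_apply {α E F : Type} [NormedAddCommGroup E] [NormedSpace ℝ E]
    [NormedAddCommGroup F] [NormedSpace ℝ F] {l : Filter α} {A : α → E →L[ℝ] F} {A₀ : E →L[ℝ] F}
    {x : α → E} {x₀ : E} (hA : Tendsto A l (𝓝 A₀)) (hx : Tendsto x l (𝓝 x₀)) :
    Tendsto (fun i => A i (x i)) l (𝓝 (A₀ x₀)) :=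
  (isBoundedBilinearMap_apply.continuous.tendsto (A₀, x₀)).comp (hA.prodMk_nhds hx)

/-! ### Leading terms of a function increasing in a cone of directions, and their values along
curves -/

section MonotoneJets

variable {E : Type} [NormedAddCommGroup E] [NormedSpace ℝ E]

/-- A function which does not decrease in the directions close to `v` has non-zero leading term in
the direction `v`. -/
theorem HasLeadingTerm.ne_zero_of_monotone {n : ℕ} {G : E → ℝ} (hG : ContDiffAt ℝ ∞ G 0)
    (hlow : ∀ j < n, iteratedFDeriv ℝ j G 0 = 0) (hn : iteratedFDeriv ℝ n G 0 ≠ 0) (h0 : G 0 = 0)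
    {v : E} {δ η : ℝ} (hδ : 0 < δ) (hη : 0 < η)
    (hmono : ∀ x ∈ Metric.ball (0 : E) η, ∀ w ∈ Metric.ball v δ, ∀ r : ℝ, 0 ≤ r →
      x + r • w ∈ Metric.ball (0 : E) η → G x ≤ G (x + r • w))
    {c : ℝ} (hc : HasLeadingTerm n G v c) : c ≠ 0 := by
  rintro rfl
  -- Suppose `c = 0`. For `x` close to `v / 2` both `2 x` and `2 (v - x)` are admissible directions,
  -- so `0 ≤ G (s x) ≤ G (s v)` for small `s > 0`. The leading term at `x` is squeezed between `0`
  -- and `c = 0`; it vanishes on an open set, hence so does the `n`-th derivative.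
  refine hn (iteratedFDeriv_eq_zero_of_hasLeadingTerm n hG hlow
    (O := Metric.ball ((2 : ℝ)⁻¹ • v) (δ / 2)) Metric.isOpen_ball
    ⟨_, Metric.mem_ball_self (by positivity)⟩ fun x hx => ?_)
  obtain ⟨q, hq⟩ := exists_hasLeadingTerm n hG hlow x
  have hle : 𝓝[>] (0 : ℝ) ≤ 𝓝[≠] 0 := nhdsWithin_mono _ fun s (hs : 0 < s) => hs.ne'
  have hlx := hq.congr_order_zero_le.mono_left hle
  have hlv := hc.congr_order_zero_le.mono_left hle
  have hsmall : ∀ y : E, ∀ᶠ s : ℝ in 𝓝[>] 0, s • y ∈ Metric.ball (0 : E) η := fun y => by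
    have : Continuous fun s : ℝ => s • y := by fun_prop
    have := this.tendsto 0
    rw [zero_smul] at this
    exact (this.mono_left nhdsWithin_le_nhds) (Metric.ball_mem_nhds _ hη)
  have hx1 : (2 : ℝ) • x ∈ Metric.ball v δ := by
    rw [Metric.mem_ball, dist_eq_norm] at hx ⊢
    have e : (2 : ℝ) • x - v = (2 : ℝ) • (x - (2 : ℝ)⁻¹ • v) := by
      rw [smul_sub, smul_smul]; norm_num
    rw [e, norm_smul, Real.norm_eq_abs, abs_of_pos two_pos]; linarith
  have hx2 : (2 : ℝ) • (v - x) ∈ Metric.ball v δ := by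
    rw [Metric.mem_ball, dist_eq_norm] at hx1 ⊢
    have e : (2 : ℝ) • (v - x) - v = -((2 : ℝ) • x - v) := by
      rw [smul_sub, two_smul, two_smul]; abel
    rwa [e, norm_neg]
  have hge : ∀ᶠ s : ℝ in 𝓝[>] 0, 0 ≤ (s ^ n)⁻¹ • G (s • x) := by
    filter_upwards [hsmall x, self_mem_nhdsWithin] with s hs (hs0 : 0 < s)
    have := hmono 0 (Metric.mem_ball_self hη) _ hx1 (s / 2) (by positivity)
      (by rwa [zero_add, smul_smul, div_mul_cancel₀ s two_ne_zero])
    rw [h0, zero_add, smul_smul, div_mul_cancel₀ s two_ne_zero] at this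
    exact smul_nonneg (by positivity) this
  have hle' : ∀ᶠ s : ℝ in 𝓝[>] 0, (s ^ n)⁻¹ • G (s • x) ≤ (s ^ n)⁻¹ • G (s • v) := by
    filter_upwards [hsmall x, hsmall v, self_mem_nhdsWithin] with s hs hs' (hs0 : 0 < s)
    have e : s • x + (s / 2) • (2 : ℝ) • (v - x) = s • v := by
      rw [smul_smul, div_mul_cancel₀ s two_ne_zero, ← smul_add, add_sub_cancel]
    have := hmono (s • x) hs _ hx2 (s / 2) (by positivity) (by rwa [e])
    rw [e] at this
    exact smul_le_smul_of_nonneg_left this (by positivity)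
  have : q = 0 := le_antisymm (le_of_tendsto_of_tendsto hlx hlv hle') (ge_of_tendsto hlx hge)
  rwa [this] at hq

/-- The value and the first two derivatives of a smooth function of order `n` along a curve. -/
theorem tendsto_along_curve {n : ℕ} (hn : 0 < n) {G : E → ℝ} (hG : ContDiffAt ℝ ∞ G 0)
    (hlow : ∀ j < n, iteratedFDeriv ℝ j G 0 = 0) {v : E} {c : ℝ} (hc : HasLeadingTerm n G v c)
    {γ γ₁ γ₂ : ℝ → E} (h0 : γ 0 = 0) (hv : γ₁ 0 = v)
    (h1 : ∀ᶠ s in 𝓝 0, HasDerivAt γ (γ₁ s) s) (h2 : ∀ᶠ s in 𝓝 0, HasDerivAt γ₁ (γ₂ s) s)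
    (h3 : ContinuousAt γ₂ 0) :
    ∃ f₁ f₂ : ℝ → ℝ, (∀ᶠ s in 𝓝 0, HasDerivAt (fun s => G (γ s)) (f₁ s) s) ∧
      (∀ᶠ s in 𝓝 0, HasDerivAt f₁ (f₂ s) s) ∧ ContinuousAt f₂ 0 ∧
      Tendsto (fun s => G (γ s) / s ^ n) (𝓝[<] 0) (𝓝 c) ∧
      Tendsto (fun s => f₁ s / s ^ (n - 1)) (𝓝[<] 0) (𝓝 (n * c)) ∧
      Tendsto (fun s => s * f₂ s / s ^ (n - 1)) (𝓝[<] 0) (𝓝 (n * (n - 1) * c)) := by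
  have hγ : ContinuousAt γ 0 := h1.self_of_nhds.continuousAt
  have hγ0 : Tendsto γ (𝓝 0) (𝓝 0) := by simpa [h0] using hγ.tendsto
  have hγ1 : ContinuousAt γ₁ 0 := h2.self_of_nhds.continuousAt
  have hG1 := contDiffAt_fderiv_infty hG
  have hG2 := contDiffAt_fderiv_infty hG1
  have hdiff : ∀ {F : Type} [NormedAddCommGroup F] [NormedSpace ℝ F] {g : E → F},
      ContDiffAt ℝ ∞ g 0 → ∀ᶠ x in 𝓝 (0 : E), DifferentiableAt ℝ g x := fun {F} _ _ g hg => by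
    have := (hg.of_le (m := 1) (by simp)).eventually (by simp)
    filter_upwards [this] with x hx using hx.differentiableAt (by simp)
  -- Chain rule, twice. Only two derivatives of `γ` are available, so the rates below come from the
  -- leading terms of `G` and of its first two differentials at `γ s = s • z s`, with `z s → v`.
  refine ⟨fun s => fderiv ℝ G (γ s) (γ₁ s), fun s => fderiv ℝ (fderiv ℝ G) (γ s) (γ₁ s) (γ₁ s) +
    fderiv ℝ G (γ s) (γ₂ s), ?_, ?_, ?_, ?_⟩
  · filter_upwards [h1, hγ0.eventually (hdiff hG)] with s hs hs'
    exact hs'.hasFDerivAt.comp_hasDerivAt s hs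
  · filter_upwards [h1, h2, hγ0.eventually (hdiff hG1)] with s hs hs2 hs'
    exact (hs'.hasFDerivAt.comp_hasDerivAt s hs).clm_apply hs2
  · have c1 : ContinuousAt (fun s => fderiv ℝ G (γ s)) 0 :=
      ContinuousAt.comp (by rw [h0]; exact hG1.continuousAt) hγ
    have c2 : ContinuousAt (fun s => fderiv ℝ (fderiv ℝ G) (γ s)) 0 :=
      ContinuousAt.comp (by rw [h0]; exact hG2.continuousAt) hγ
    exact ((c2.clm_apply hγ1).clm_apply hγ1).add (c1.clm_apply h3)
  -- the curve has the form `s • z s`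
  have hz : Tendsto (fun s => s⁻¹ • γ s) (𝓝[<] 0) (𝓝 v) := by
    have := h1.self_of_nhds.tendsto_slope_zero
    rw [hv] at this
    simp only [zero_add, h0, sub_zero] at this
    exact this.mono_left (nhdsWithin_mono _ fun s (hs : s < 0) => hs.ne)
  have hγz : ∀ᶠ s : ℝ in 𝓝[<] 0, s • s⁻¹ • γ s = γ s := by
    filter_upwards [self_mem_nhdsWithin] with s (hs : s < 0)
    rw [smul_inv_smul₀ hs.ne]
  have hγ1' : Tendsto γ₁ (𝓝[<] 0) (𝓝 v) := hv ▸ hγ1.tendsto.mono_left nhdsWithin_le_nhds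
  have hγ2' : Tendsto γ₂ (𝓝[<] 0) (𝓝 (γ₂ 0)) := h3.tendsto.mono_left nhdsWithin_le_nhds
  have along : ∀ {F : Type} [NormedAddCommGroup F] [NormedSpace ℝ F] {g : E → F} {m : ℕ} {q : F},
      HasLeadingTerm m g v q → Tendsto (fun s : ℝ => (s ^ m)⁻¹ • g (γ s)) (𝓝[<] 0) (𝓝 q) :=
    fun {F} _ _ g m q hq => (hq.tendsto_comp hz).congr' (by
      filter_upwards [hγz] with s hs; rw [hs])
  obtain ⟨m, rfl⟩ : ∃ m, n = m + 1 := ⟨n - 1, by omega⟩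
  have hlow1 : ∀ j < m, iteratedFDeriv ℝ j (fderiv ℝ G) 0 = 0 :=
      fun j hj => iteratedFDeriv_fderiv_eq_zero (hlow (j + 1) (by omega))
  obtain ⟨q, hq⟩ := exists_hasLeadingTerm m hG1 hlow1 v
  have hG0 : G 0 = 0 := apply_eq_zero_of_iteratedFDeriv_zero (hlow 0 (by omega))
  -- Euler's relation for the homogeneous leading form, obtained from uniqueness of the leading
  -- term.
  have hqc : q v = (m + 1) * c := by
    rw [hc.unique (hq.integrate hG hG0), smul_eq_mul, mul_inv_cancel_left₀ (by positivity)]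
  have lim1 := along hq
  refine ⟨(along hc).congr fun s => by rw [smul_eq_mul, div_eq_inv_mul], ?_, ?_⟩
  · have := tendsto_clm_apply lim1 hγ1'
    rw [hqc] at this
    simp only [Nat.add_sub_cancel, Nat.cast_add, Nat.cast_one]
    refine this.congr fun s => ?_
    simp [div_eq_inv_mul]
  · have hs0 : Tendsto (fun s : ℝ => s) (𝓝[<] 0) (𝓝 0) := tendsto_id.mono_left nhdsWithin_le_nhds
    have second : Tendsto (fun s => (s * (s ^ m)⁻¹) • fderiv ℝ (fderiv ℝ G) (γ s) (γ₁ s) (γ₁ s))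
        (𝓝[<] 0) (𝓝 ((m + 1) * m * c)) := by
      rcases Nat.eq_zero_or_pos m with rfl | hm
      · have c2 : Tendsto (fun s => fderiv ℝ (fderiv ℝ G) (γ s)) (𝓝[<] 0)
            (𝓝 (fderiv ℝ (fderiv ℝ G) 0)) :=
          (hG2.continuousAt.tendsto.comp hγ0).mono_left nhdsWithin_le_nhds
        simpa using hs0.mul (tendsto_clm_apply (tendsto_clm_apply c2 hγ1') hγ1')
      · obtain ⟨l, rfl⟩ : ∃ l, m = l + 1 := ⟨m - 1, by omega⟩
        obtain ⟨q', hq'⟩ := exists_hasLeadingTerm l hG2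
          (fun j hj => iteratedFDeriv_fderiv_eq_zero (hlow1 (j + 1) (by omega))) v
        have e : q' v v = (l + 1) * q v := by
          rw [hq.unique (hq'.integrate hG1
            (apply_eq_zero_of_iteratedFDeriv_zero (hlow1 0 (by omega))))]
          simp only [smul_apply, smul_eq_mul]
          rw [mul_inv_cancel_left₀ (by positivity)]
        have := tendsto_clm_apply (tendsto_clm_apply (along hq') hγ1') hγ1'
        rw [e, hqc] at this
        have e2 : ((((l + 1 : ℕ) : ℝ) + 1) * ((l + 1 : ℕ) : ℝ) * c) =
            ((l : ℝ) + 1) * ((((l + 1 : ℕ) : ℝ) + 1) * c) := by push_cast; ring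
        rw [e2]
        refine this.congr' ?_
        filter_upwards [self_mem_nhdsWithin] with s (hs : s < 0)
        have : s ≠ 0 := hs.ne
        simp only [smul_apply, smul_eq_mul]
        field_simp
        ring
    -- The acceleration of the curve does not contribute: `fderiv ℝ G (γ s)` has order `m`, and
    -- there is an extra factor `s`.
    have third : Tendsto (fun s => s * (((s ^ m)⁻¹ • fderiv ℝ G (γ s)) (γ₂ s))) (𝓝[<] 0) (𝓝 0) := by
      simpa using hs0.mul (tendsto_clm_apply lim1 hγ2')
    have := second.add third
    simp only [Nat.add_sub_cancel, Nat.cast_add, Nat.cast_one, add_zero, add_sub_cancel_right]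
      at this ⊢
    refine this.congr fun s => ?_
    simp [div_eq_inv_mul]
    ring

/-- A smooth function whose derivatives all vanish at the origin decays faster than any power along
a differentiable curve. -/
theorem tendsto_along_curve_of_flat {G : E → ℝ} (hG : ContDiffAt ℝ ∞ G 0)
    (hflat : ∀ j, iteratedFDeriv ℝ j G 0 = 0) {γ : ℝ → E} {v : E} (h0 : γ 0 = 0)
    (h1 : HasDerivAt γ v 0) (n : ℕ) :
    Tendsto (fun s => G (γ s) / s ^ n) (𝓝[<] 0) (𝓝 0) := by
  have hq : HasLeadingTerm n G v 0 := by
    -- A leading term of order `n + 1` exists by flatness, so the one of order `n` is zero.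
    obtain ⟨q, hq⟩ := exists_hasLeadingTerm (n + 1) hG (fun j _ => hflat j) v
    have h2 : (fun x : ℝ × E => x.1 ^ (n + 1)) =o[𝓝 ((0 : ℝ), v)] fun x : ℝ × E => x.1 ^ n := by
      have h3 : (fun x : ℝ × E => x.1) =o[𝓝 ((0 : ℝ), v)] fun _ => (1 : ℝ) := by
        rw [Asymptotics.isLittleO_one_iff]
        exact continuous_fst.tendsto' _ _ rfl
      simpa [pow_succ] using
        (Asymptotics.isBigO_refl (fun x : ℝ × E => x.1 ^ n) (𝓝 ((0 : ℝ), v))).mul_isLittleO h3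
    have h4 : (fun x : ℝ × E => x.1 ^ (n + 1) • q) =o[𝓝 ((0 : ℝ), v)] fun x : ℝ × E => x.1 ^ n := by
      have := h2.const_mul_left q
      refine this.congr_left fun x => by simp [mul_comm]
    have := (hq.trans h2).add h4
    refine this.congr_left fun x => by simp
  have hz : Tendsto (fun s => s⁻¹ • γ s) (𝓝[<] 0) (𝓝 v) := by
    have := h1.tendsto_slope_zero
    simp only [zero_add, h0, sub_zero] at this
    exact this.mono_left (nhdsWithin_mono _ fun s (hs : s < 0) => hs.ne)
  refine (hq.tendsto_comp hz).congr' ?_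
  filter_upwards [self_mem_nhdsWithin] with s (hs : s < 0)
  rw [smul_inv_smul₀ hs.ne, smul_eq_mul, div_eq_inv_mul]

end MonotoneJets

/-! ### Growth of the conformal factor, and the acceleration ratio in a conformal time -/

section Asymptotics

/-- The differential data carried by the conformal factor of a Future Isotropic Universe. -/
theorem IsFIUFactor.exists_derivs {Ω : ℝ → ℝ} {l : ℝ} (h : IsFIUFactor Ω (l : EReal)) :
    ∃ c > 0, ∃ Ω₁ Ω₂ : ℝ → ℝ, (∀ T ∈ Ioo (-c) 0, 0 < Ω T ∧ 0 < Ω₁ T ∧ HasDerivAt Ω (Ω₁ T) T ∧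
      HasDerivAt Ω₁ (Ω₂ T) T) ∧
      Tendsto (fun T => Ω₂ T * Ω T / Ω₁ T ^ 2) (𝓝[<] 0) (𝓝 l) := by
  obtain ⟨-, c, hc, hC2, hmono, hpos, hne, -, hL, -⟩ := h
  have hC2' : ContDiffOn ℝ 2 Ω (Ioo (-c) 0) := hC2.mono Ioo_subset_Ico_self
  have hC1 : ContDiffOn ℝ 1 (deriv Ω) (Ioo (-c) 0) :=
    ((contDiffOn_succ_iff_deriv_of_isOpen (n := 1) isOpen_Ioo).1 hC2').2.2
  have hev : ∀ T ∈ Ioo (-c) 0, Ico (-c) 0 ∈ 𝓝 T := fun T hT =>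
    mem_of_superset (isOpen_Ioo.mem_nhds hT) Ioo_subset_Ico_self
  have hd1 : ∀ T ∈ Ioo (-c) 0, derivWithin Ω (Ico (-c) 0) T = deriv Ω T := fun T hT =>
    derivWithin_of_mem_nhds (hev T hT)
  have hd2 : ∀ T ∈ Ioo (-c) 0, iteratedDerivWithin 2 Ω (Ico (-c) 0) T = deriv (deriv Ω) T := by
    intro T hT
    rw [iteratedDerivWithin_succ, iteratedDerivWithin_one, derivWithin_of_mem_nhds (hev T hT)]
    refine Filter.EventuallyEq.deriv_eq ?_
    filter_upwards [isOpen_Ioo.mem_nhds hT] with S hS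
    exact hd1 S hS
  have hderiv : ∀ T ∈ Ioo (-c) 0, HasDerivAt Ω (deriv Ω T) T := fun T hT =>
    ((hC2'.differentiableOn (by simp)).differentiableAt (isOpen_Ioo.mem_nhds hT)).hasDerivAt
  refine ⟨c, hc, deriv Ω, deriv (deriv Ω), fun T hT => ⟨hpos T (Ioo_subset_Ico_self hT), ?_,
    hderiv T hT, ?_⟩, ?_⟩
  · refine lt_of_le_of_ne ?_ (Ne.symm (hd1 T hT ▸ hne T (Ioo_subset_Ico_self hT)))
    rw [← hd1 T hT]
    exact hmono.monotoneOn.derivWithin_nonneg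
  · exact ((hC1.differentiableOn (by simp)).differentiableAt (isOpen_Ioo.mem_nhds hT)).hasDerivAt
  · have hL' : Tendsto (fun T => conformalL Ω (Ico (-c) 0) T) (𝓝[<] 0) (𝓝 l) :=
      EReal.tendsto_coe.1 hL
    refine hL'.congr' ?_
    filter_upwards [Ioo_mem_nhdsLT (neg_lt_zero.2 hc)] with T hT
    have h0 := (hpos T (Ioo_subset_Ico_self hT)).ne'
    have h1 := hne T (Ioo_subset_Ico_self hT)
    rw [conformalL, hd2 T hT, hd1 T hT]
    rw [hd1 T hT] at h1
    field_simp

/-- If `Ω → ∞` and `(Ω / Ω')' → -μ < 0` at `0` from the left, then `Ω / Ω' ∼ μ |T|`. -/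
theorem tendsto_div_deriv_div {Ω Ω₁ Ω₂ : ℝ → ℝ} {c μ : ℝ} (hc : 0 < c) (hμ : 0 < μ)
    (h : ∀ T ∈ Ioo (-c) 0, 0 < Ω T ∧ 0 < Ω₁ T ∧ HasDerivAt Ω (Ω₁ T) T ∧ HasDerivAt Ω₁ (Ω₂ T) T)
    (hL : Tendsto (fun T => Ω₂ T * Ω T / Ω₁ T ^ 2) (𝓝[<] 0) (𝓝 (1 + μ)))
    (htop : Tendsto Ω (𝓝[<] 0) atTop) :
    Tendsto (fun T => Ω T / Ω₁ T / (-T)) (𝓝[<] 0) (𝓝 μ) := by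
  -- The quantity `L` enters through `(Ω / Ω')' = 1 - L`, which tends to `-μ`.
  have hR : ∀ T ∈ Ioo (-c) 0, HasDerivAt (fun T => Ω T / Ω₁ T)
      (1 - Ω₂ T * Ω T / Ω₁ T ^ 2) T := by
    intro T hT
    obtain ⟨-, h1, d0, d1⟩ := h T hT
    refine (d0.div d1 h1.ne').congr_deriv ?_
    have := h1.ne'
    field_simp
  have hR' : Tendsto (fun T => 1 - Ω₂ T * Ω T / Ω₁ T ^ 2) (𝓝[<] 0) (𝓝 (-μ)) := by
    have := hL.const_sub 1
    simpa using this
  have hlim : Tendsto (fun T => Ω T / Ω₁ T) (𝓝[<] 0) (𝓝 0) := by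
    have hneg : ∀ᶠ T in 𝓝[<] (0 : ℝ), 1 - Ω₂ T * Ω T / Ω₁ T ^ 2 < 0 :=
      hR'.eventually (gt_mem_nhds (neg_lt_zero.2 hμ))
    obtain ⟨d, hd, hd'⟩ := (mem_nhdsLT_iff_exists_Ioo_subset' (neg_lt_zero.2 hc)).1
      (hneg.and (Ioo_mem_nhdsLT (neg_lt_zero.2 hc)))
    have hanti : AntitoneOn (fun T => Ω T / Ω₁ T) (Ioo d 0) := by
      refine antitoneOn_of_deriv_nonpos (convex_Ioo d 0)
        (fun T hT => (hR T (hd' hT).2).continuousAt.continuousWithinAt)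
        (fun T hT => ?_) (fun T hT => ?_) <;> rw [interior_Ioo] at hT
      · exact (hR T (hd' hT).2).differentiableAt.differentiableWithinAt
      · rw [(hR T (hd' hT).2).deriv]
        exact (hd' hT).1.le
    have hpos : ∀ T ∈ Ioo d 0, 0 < Ω T / Ω₁ T := fun T hT =>
      div_pos (h T (hd' hT).2).1 (h T (hd' hT).2).2.1
    have hev : ∀ᶠ T in 𝓝[<] (0 : ℝ), T ∈ Ioo d 0 := Ioo_mem_nhdsLT hd
    rw [Metric.tendsto_nhds]
    intro ε hε
    -- some value is below `ε`
    have : ∃ T ∈ Ioo d 0, Ω T / Ω₁ T < ε := by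
      by_contra! hcon
      -- If `Ω / Ω' ≥ ε` throughout, then `(log Ω)' ≤ 1 / ε`, and `log Ω` would be bounded on a
      -- bounded interval, contradicting `Ω → ∞`.
      have hmono : AntitoneOn (fun T => Real.log (Ω T) - ε⁻¹ * T) (Ioo d 0) := by
        have hder : ∀ T ∈ Ioo d 0, HasDerivAt (fun T => Real.log (Ω T) - ε⁻¹ * T)
            (Ω₁ T / Ω T - ε⁻¹ * 1) T := fun T hT =>
          (((h T (hd' hT).2).2.2.1).log (h T (hd' hT).2).1.ne').sub
            ((hasDerivAt_id T).const_mul _)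
        refine antitoneOn_of_deriv_nonpos (convex_Ioo d 0)
          (fun T hT => (hder T hT).continuousAt.continuousWithinAt)
          (fun T hT => ?_) (fun T hT => ?_) <;> rw [interior_Ioo] at hT
        · exact (hder T hT).differentiableAt.differentiableWithinAt
        · rw [(hder T hT).deriv, mul_one, sub_nonpos, ← inv_div]
          exact inv_anti₀ hε (hcon T hT)
      have hmid : d / 2 ∈ Ioo d 0 := by
        have : d < 0 := hd
        constructor <;> linarith
      have hlog : Tendsto (fun T => Real.log (Ω T)) (𝓝[<] 0) atTop :=
        Real.tendsto_log_atTop.comp htop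
      have hbd : ∀ᶠ T in 𝓝[<] (0 : ℝ), Real.log (Ω T) ≤ Real.log (Ω (d / 2)) - ε⁻¹ * (d / 2) := by
        filter_upwards [Ioo_mem_nhdsLT hmid.2] with T hT
        have := hmono hmid ⟨hmid.1.trans hT.1, hT.2⟩ hT.1.le
        have h2 : ε⁻¹ * T ≤ 0 := mul_nonpos_of_nonneg_of_nonpos (by positivity) hT.2.le
        simp only at this
        linarith
      obtain ⟨T, h1, h2⟩ := (hbd.and (hlog.eventually_gt_atTop _)).exists
      exact absurd h2 (not_lt.2 h1)
    obtain ⟨T₁, hT₁, hlt⟩ := this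
    filter_upwards [Ioo_mem_nhdsLT hT₁.2] with T hT
    have hT' : T ∈ Ioo d 0 := ⟨hT₁.1.trans hT.1, hT.2⟩
    rw [Real.dist_0_eq_abs, abs_of_pos (hpos T hT')]
    exact (hanti hT₁ hT' hT.1.le).trans_lt hlt
  -- L'Hôpital's rule for `(Ω / Ω') / (-T)`, now that the numerator is known to tend to zero.
  refine HasDerivAt.lhopital_zero_nhdsLT (f' := fun T => 1 - Ω₂ T * Ω T / Ω₁ T ^ 2)
    (g' := fun _ => -1) ?_ ?_ ?_ hlim ?_ ?_
  · filter_upwards [Ioo_mem_nhdsLT (neg_lt_zero.2 hc)] with T hT using hR T hT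
  · exact Eventually.of_forall fun T => (hasDerivAt_id T).neg
  · exact Eventually.of_forall fun T => by norm_num
  · exact tendsto_nhdsWithin_of_tendsto_nhds (continuous_neg.tendsto' 0 0 neg_zero)
  · refine (hR'.neg).congr' ?_ |>.trans (by rw [neg_neg])
    exact Eventually.of_forall fun T => by simp [div_neg]

/-- A polynomial lower bound for a conformal factor with `Ω / Ω' ∼ μ |T|`. -/
theorem exists_pow_lower_bound {Ω Ω₁ : ℝ → ℝ} {c μ : ℝ} (hc : 0 < c)
    (h : ∀ T ∈ Ioo (-c) 0, 0 < Ω T ∧ 0 < Ω₁ T ∧ HasDerivAt Ω (Ω₁ T) T)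
    (hL : Tendsto (fun T => Ω T / Ω₁ T / (-T)) (𝓝[<] 0) (𝓝 μ)) :
    ∃ N : ℕ, 0 < N ∧ ∃ κ > 0, ∀ᶠ T in 𝓝[<] 0, κ ≤ Ω T ^ N * (-T) := by
  -- For `N > μ` one has `Ω / Ω' < N (-T)` near `0`, which says exactly that `Ω ^ N (-T)` has
  -- non-negative derivative. The lower bound is then its value at an intermediate point.
  obtain ⟨N, hN⟩ := exists_nat_gt (max μ 0)
  have hN0 : 0 < N := by exact_mod_cast (le_max_right μ 0).trans_lt hN
  obtain ⟨d, hd, hd'⟩ := (mem_nhdsLT_iff_exists_Ioo_subset' (neg_lt_zero.2 hc)).1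
      ((hL.eventually (gt_mem_nhds ((le_max_left μ 0).trans_lt hN))).and
        (Ioo_mem_nhdsLT (neg_lt_zero.2 hc)))
  have hder : ∀ T ∈ Ioo d 0, HasDerivAt (fun T => Ω T ^ N * (-T))
      (N * Ω T ^ (N - 1) * Ω₁ T * (-T) + Ω T ^ N * (-1)) T := fun T hT =>
    ((h T (hd' hT).2).2.2.pow N).mul (hasDerivAt_id T).neg
  have hmono : MonotoneOn (fun T => Ω T ^ N * (-T)) (Ioo d 0) := by
    refine monotoneOn_of_deriv_nonneg (convex_Ioo d 0)
      (fun T hT => (hder T hT).continuousAt.continuousWithinAt)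
      (fun T hT => ?_) (fun T hT => ?_) <;> rw [interior_Ioo] at hT
    · exact (hder T hT).differentiableAt.differentiableWithinAt
    · rw [(hder T hT).deriv]
      obtain ⟨h0, h1, -⟩ := h T (hd' hT).2
      have h2 : Ω T / Ω₁ T / (-T) < N := (hd' hT).1
      rw [div_lt_iff₀ (neg_pos.2 hT.2), div_lt_iff₀ h1] at h2
      obtain ⟨m, rfl⟩ : ∃ m, N = m + 1 := ⟨N - 1, by omega⟩
      have h3 : 0 ≤ Ω T ^ m := by positivity
      rw [Nat.add_sub_cancel, pow_succ]
      nlinarith [mul_le_mul_of_nonneg_left h2.le h3]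
  have hmid : d / 2 ∈ Ioo d 0 := by
    have : d < 0 := hd
    constructor <;> linarith
  refine ⟨N, hN0, Ω (d / 2) ^ N * (-(d / 2)), mul_pos (pow_pos (h _ (hd' hmid).2).1 _)
    (neg_pos.2 hmid.2), ?_⟩
  filter_upwards [Ioo_mem_nhdsLT hmid.2] with T hT
  exact hmono hmid ⟨hmid.1.trans hT.1, hT.2⟩ hT.1.le

/-- A limit along a curve which approaches `t₀` from the left is a limit at `t₀`. -/
theorem tendsto_of_tendsto_comp_left {t g : ℝ → ℝ} {t₀ ε : ℝ} (hε : 0 < ε) {l : Filter ℝ}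
    (hcont : ContinuousOn t (Ioo (-ε) 0)) (ht : Tendsto t (𝓝[<] 0) (𝓝 t₀))
    (hlt : ∀ s ∈ Ioo (-ε) 0, t s < t₀)
    (hg : Tendsto (fun s => g (t s)) (𝓝[<] 0) l) : Tendsto g (𝓝[<] t₀) l := by
  intro V hV
  obtain ⟨d, hd, hd'⟩ := (mem_nhdsLT_iff_exists_Ioo_subset' (neg_lt_zero.2 hε)).1
    (inter_mem (hg hV) (Ioo_mem_nhdsLT (neg_lt_zero.2 hε)))
  have hmid : d / 2 ∈ Ioo d 0 := by
    have : d < 0 := hd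
    constructor <;> linarith
  -- By the intermediate value theorem, every `y` between `t (d / 2)` and `t₀` is a value of `t` on
  -- the interval where `g ∘ t` lies in `V`; monotonicity of `t` is not needed.
  refine mem_map.2 (mem_of_superset (Ioo_mem_nhdsLT (hlt _ (hd' hmid).2)) fun y hy => ?_)
  obtain ⟨s, hs, hs'⟩ := ((ht.eventually (lt_mem_nhds hy.2)).and (Ioo_mem_nhdsLT hmid.2)).exists
  have hsub : Icc (d / 2) s ⊆ Ioo d 0 := fun r hr => ⟨hmid.1.trans_le hr.1, hr.2.trans_lt hs'.2⟩
  obtain ⟨r, hr, rfl⟩ := intermediate_value_Icc hs'.1.le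
    (hcont.mono fun r hr => (hd' (hsub hr)).2) ⟨hy.1.le, hs.le⟩
  exact (hd' (hsub hr)).1

/-- The acceleration ratio of a scale factor of the form `β w` in conformal time, where
`w' = w / ρ` with `ρ → 0` and `ρ' → -q`. -/
theorem tendsto_accelRatio_comp (F : FRWModel) {t β β₁ β₂ w ρ ρ₁ : ℝ → ℝ} {ε β₀ b₁ b₂ q : ℝ}
    (hε : 0 < ε) (hdom : ∀ s ∈ Ioo (-ε) 0, t s ∈ F.dom)
    (ht : ∀ s ∈ Ioo (-ε) 0, HasDerivAt t (w s) s)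
    (hw : ∀ s ∈ Ioo (-ε) 0, 0 < w s ∧ HasDerivAt w (w s / ρ s) s)
    (ha : ∀ s ∈ Ioo (-ε) 0, F.scale (t s) = β s * w s)
    (hβ : ∀ s ∈ Ioo (-ε) 0, HasDerivAt β (β₁ s) s ∧ HasDerivAt β₁ (β₂ s) s)
    (hρ : ∀ s ∈ Ioo (-ε) 0, 0 < ρ s ∧ HasDerivAt ρ (ρ₁ s) s)
    (hβ0 : 0 < β₀) (lβ : Tendsto β (𝓝[<] 0) (𝓝 β₀)) (lβ₁ : Tendsto β₁ (𝓝[<] 0) (𝓝 b₁))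
    (lβ₂ : Tendsto β₂ (𝓝[<] 0) (𝓝 b₂)) (lρ : Tendsto ρ (𝓝[<] 0) (𝓝 0))
    (lρ₁ : Tendsto ρ₁ (𝓝[<] 0) (𝓝 (-q))) :
    Tendsto (fun s => F.accelRatio (t s)) (𝓝[<] 0) (𝓝 q) := by
  have hC1 : ContDiffOn ℝ 1 (deriv F.scale) F.dom :=
    ((contDiffOn_succ_iff_deriv_of_isOpen (n := 1) F.dom_open).1 F.scale_contDiffOn).2.2
  -- Since `dt/ds = w`, differentiating `a = β w` gives `ȧ w = β' w + β w / ρ`, and `w` cancels.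
  have d1 : ∀ s ∈ Ioo (-ε) 0, deriv F.scale (t s) = β₁ s + β s / ρ s := by
    intro s hs
    have e1 : HasDerivAt (fun s => F.scale (t s)) (deriv F.scale (t s) * w s) s :=
      ((F.scale_contDiffOn.differentiableOn (by simp)).differentiableAt
        (F.dom_open.mem_nhds (hdom s hs))).hasDerivAt.comp s (ht s hs)
    have e2 : HasDerivAt (fun s => F.scale (t s)) (β₁ s * w s + β s * (w s / ρ s)) s := by
      refine ((hβ s hs).1.mul (hw s hs).2).congr_of_eventuallyEq ?_
      filter_upwards [isOpen_Ioo.mem_nhds hs] with r hr using ha r hr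
    have e3 := e1.unique e2
    have h1 := (hw s hs).1.ne'
    have h2 := (hρ s hs).1.ne'
    refine mul_right_cancel₀ h1 (e3.trans ?_)
    field_simp
  have d2 : ∀ s ∈ Ioo (-ε) 0, deriv (deriv F.scale) (t s) * w s =
      β₂ s + (β₁ s * ρ s - β s * ρ₁ s) / ρ s ^ 2 := by
    intro s hs
    have e1 : HasDerivAt (fun s => deriv F.scale (t s)) (deriv (deriv F.scale) (t s) * w s) s :=
      ((hC1.differentiableOn (by simp)).differentiableAt
        (F.dom_open.mem_nhds (hdom s hs))).hasDerivAt.comp s (ht s hs)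
    have e2 : HasDerivAt (fun s => deriv F.scale (t s))
        (β₂ s + (β₁ s * ρ s - β s * ρ₁ s) / ρ s ^ 2) s := by
      refine ((hβ s hs).2.add ((hβ s hs).1.div (hρ s hs).2
        (hρ s hs).1.ne')).congr_of_eventuallyEq ?_
      filter_upwards [isOpen_Ioo.mem_nhds hs] with r hr using d1 r hr
    exact e1.unique e2
  -- This quotient is `ä a / ȧ²` after multiplying numerator and denominator by `ρ²`. As `ρ → 0`,
  -- all terms with derivatives of `β` drop out and `β₀² q / β₀²` remains.
  have hlim : Tendsto (fun s => β s * (β₂ s * ρ s ^ 2 + β₁ s * ρ s - β s * ρ₁ s) /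
      (β₁ s * ρ s + β s) ^ 2) (𝓝[<] 0)
      (𝓝 (β₀ * (b₂ * 0 ^ 2 + b₁ * 0 - β₀ * (-q)) / (b₁ * 0 + β₀) ^ 2)) := by
    refine (lβ.mul (((lβ₂.mul (lρ.pow 2)).add (lβ₁.mul lρ)).sub (lβ.mul lρ₁))).div
      (((lβ₁.mul lρ).add lβ).pow 2) ?_
    rw [mul_zero, zero_add]
    positivity
  have e : β₀ * (b₂ * 0 ^ 2 + b₁ * 0 - β₀ * (-q)) / (b₁ * 0 + β₀) ^ 2 = q := by
    simp only [mul_zero, zero_add, ne_eq, OfNat.ofNat_ne_zero, not_false_eq_true, zero_pow]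
    field_simp
    ring
  rw [e] at hlim
  refine hlim.congr' ?_
  filter_upwards [Ioo_mem_nhdsLT (neg_lt_zero.2 hε)] with s hs
  have h1 := (hw s hs).1.ne'
  have h2 := (hρ s hs).1.ne'
  have h3 : deriv (deriv F.scale) (t s) * F.scale (t s) =
      β s * (β₂ s + (β₁ s * ρ s - β s * ρ₁ s) / ρ s ^ 2) := by
    rw [ha s hs, ← d2 s hs]; ring
  have h4 : (β₁ s + β s / ρ s) = (β₁ s * ρ s + β s) / ρ s := by field_simp
  rw [FRWModel.accelRatio, h3, d1 s hs, h4, div_pow, div_div_eq_mul_div]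
  congr 1
  field_simp
  ring

end Asymptotics

/-! ### The scale factor along a flow line, for finite and for infinite order of the cosmic time -/

section CurveData

/-- The limits of the scale factor along a flow line, given the order of vanishing `n` of the cosmic
time on it. -/
theorem FRWModel.tendsto_of_flow_line (F : FRWModel) {t₀ : ℝ} {Ω : ℝ → ℝ} {l : ℝ} (hl : 1 < l)
    (hΩ : IsFIUFactor Ω (l : EReal)) {ε : ℝ} (hε : 0 < ε) {t f f₁ f₂ β β₁ β₂ : ℝ → ℝ}
    {n : ℕ} (hn : 0 < n) {c β₀ b₁ b₂ : ℝ} (hc : c ≠ 0)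
    (hdom : ∀ s ∈ Ioo (-ε) 0, t s ∈ F.dom) (hlt : ∀ s ∈ Ioo (-ε) 0, t s < t₀)
    (ht : ∀ s ∈ Ioo (-ε) 0, HasDerivAt t (Ω (f s)) s) (lt : Tendsto t (𝓝[<] 0) (𝓝 t₀))
    (ha : ∀ s ∈ Ioo (-ε) 0, F.scale (t s) = β s * Ω (f s))
    (hβ : ∀ s ∈ Ioo (-ε) 0, HasDerivAt β (β₁ s) s ∧ HasDerivAt β₁ (β₂ s) s)
    (hβ0 : 0 < β₀) (lβ : Tendsto β (𝓝[<] 0) (𝓝 β₀)) (lβ₁ : Tendsto β₁ (𝓝[<] 0) (𝓝 b₁))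
    (lβ₂ : Tendsto β₂ (𝓝[<] 0) (𝓝 b₂))
    (hf : ∀ s ∈ Ioo (-ε) 0, f s < 0 ∧ HasDerivAt f (f₁ s) s ∧ HasDerivAt f₁ (f₂ s) s)
    (lf : Tendsto (fun s => f s / s ^ n) (𝓝[<] 0) (𝓝 c))
    (lf₁ : Tendsto (fun s => f₁ s / s ^ (n - 1)) (𝓝[<] 0) (𝓝 (n * c)))
    (lf₂ : Tendsto (fun s => s * f₂ s / s ^ (n - 1)) (𝓝[<] 0) (𝓝 (n * (n - 1) * c))) :
    (∃ q : ℝ, 0 < q ∧ Tendsto F.accelRatio (𝓝[<] t₀) (𝓝 q)) ∧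
      Tendsto F.scale (𝓝[<] t₀) atTop := by
  obtain ⟨d, hd, Ω₁, Ω₂, hD, hL⟩ := hΩ.exists_derivs
  obtain ⟨μ, rfl⟩ : ∃ μ, l = 1 + μ := ⟨l - 1, by ring⟩
  have hμ : 0 < μ := by linarith
  have hR := tendsto_div_deriv_div hd hμ hD hL hΩ.1
  have hn' : (0 : ℝ) < n := by exact_mod_cast hn
  have hs0 : Tendsto (fun s : ℝ => s) (𝓝[<] 0) (𝓝 0) := tendsto_id.mono_left nhdsWithin_le_nhds
  have hεmem : ∀ᶠ s in 𝓝[<] (0 : ℝ), s ∈ Ioo (-ε) 0 := Ioo_mem_nhdsLT (neg_lt_zero.2 hε)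
  have hpow : ∀ s : ℝ, s ^ n = s * s ^ (n - 1) := fun s => by
    rw [← pow_succ', Nat.sub_add_cancel hn]
  have hf0 : Tendsto f (𝓝[<] 0) (𝓝[<] 0) := by
    rw [tendsto_nhdsWithin_iff]
    refine ⟨?_, hεmem.mono fun s hs => (hf s hs).1⟩
    have : Tendsto (fun s : ℝ => s ^ n) (𝓝[<] 0) (𝓝 0) := by
      simpa [hn.ne'] using hs0.pow n
    have := lf.mul this
    rw [mul_zero] at this
    refine this.congr' ?_
    filter_upwards [self_mem_nhdsWithin] with s (hs : s < 0)
    exact div_mul_cancel₀ _ (pow_ne_zero _ hs.ne)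
  -- ratios
  have r1 : Tendsto (fun s => f s / (s * f₁ s)) (𝓝[<] 0) (𝓝 (1 / n)) := by
    have := lf.div lf₁ (mul_ne_zero hn'.ne' hc)
    have e : c / (n * c) = 1 / n := by field_simp
    rw [e] at this
    refine this.congr' ?_
    filter_upwards [self_mem_nhdsWithin] with s (hs : s < 0)
    simp only [Pi.div_apply]
    rw [hpow, div_div_div_eq, mul_assoc, mul_comm (s ^ (n - 1)), ← mul_assoc,
      mul_div_mul_right _ _ (pow_ne_zero _ hs.ne)]
  have r2 : Tendsto (fun s => f s * f₂ s / f₁ s ^ 2) (𝓝[<] 0) (𝓝 ((n - 1) / n)) := by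
    have := (lf.mul lf₂).div (lf₁.pow 2) (pow_ne_zero 2 (mul_ne_zero hn'.ne' hc))
    have e : c * (n * (n - 1) * c) / (n * c) ^ 2 = (n - 1) / n := by field_simp
    rw [e] at this
    refine this.congr' ?_
    filter_upwards [self_mem_nhdsWithin] with s (hs : s < 0)
    have h1 : s ^ (n - 1) ≠ 0 := pow_ne_zero _ hs.ne
    have h2 : s ≠ 0 := hs.ne
    simp only [Pi.div_apply]
    rw [hpow, div_mul_div_comm, div_pow, div_div_div_eq,
      show f s * (s * f₂ s) * (s ^ (n - 1)) ^ 2 = f s * f₂ s * (s * s ^ (n - 1) * s ^ (n - 1)) by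
        ring, mul_comm (s * s ^ (n - 1) * s ^ (n - 1)) (f₁ s ^ 2), mul_div_mul_right]
    exact mul_ne_zero (mul_ne_zero h2 h1) h1
  have hgood : ∀ᶠ s in 𝓝[<] (0 : ℝ), s ∈ Ioo (-ε) 0 ∧ f s ∈ Ioo (-d) 0 ∧ 0 < f₁ s := by
    filter_upwards [hεmem, hf0 (Ioo_mem_nhdsLT (neg_lt_zero.2 hd)),
      r1.eventually (lt_mem_nhds (one_div_pos.2 hn'))] with s hs h1 h2
    refine ⟨hs, h1, ?_⟩
    -- `f / (s f')` is close to `1 / n > 0` while `f < 0`, so `s f' < 0`, that is, `f' > 0`.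
    have h3 : s * f₁ s < 0 := by
      by_contra! h
      exact absurd h2 (not_lt.2 (div_nonpos_of_nonpos_of_nonneg h1.2.le h))
    exact (neg_iff_pos_of_mul_neg h3).1 hs.2
  obtain ⟨ε', hε', hsub⟩ := (mem_nhdsLT_iff_exists_Ioo_subset' (neg_lt_zero.2 hε)).1 hgood
  obtain ⟨η, rfl⟩ : ∃ η, ε' = -η := ⟨-ε', by ring⟩
  have hη : 0 < η := neg_lt_zero.1 hε'
  have hRf : Tendsto (fun s => Ω (f s) / Ω₁ (f s) / (-(f s))) (𝓝[<] 0) (𝓝 μ) := hR.comp hf0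
  have hLf : Tendsto (fun s => Ω₂ (f s) * Ω (f s) / Ω₁ (f s) ^ 2) (𝓝[<] 0) (𝓝 (1 + μ)) :=
    hL.comp hf0
  have hΩf : Tendsto (fun s => Ω (f s)) (𝓝[<] 0) atTop := hΩ.1.comp hf0
  have lρ : Tendsto (fun s => Ω (f s) / Ω₁ (f s) / f₁ s) (𝓝[<] 0) (𝓝 0) := by
    have := (hRf.mul (hs0.mul r1)).neg
    simp only [zero_mul, mul_zero, neg_zero] at this
    refine this.congr' ?_
    filter_upwards [hgood] with s hs
    have h1 := hs.1.2.ne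
    have h2 := hs.2.1.2.ne
    have h3 := hs.2.2.ne'
    have h4 := (hD _ hs.2.1).2.1.ne'
    field_simp
  -- With `w = Ω ∘ f` and `ρ = w / w'`, the derivative `ρ'` is `1 - L` plus a correction from `f''`
  -- that tends to `μ (n - 1) / n`. The sum is `-μ / n`: the order of vanishing divides `λ - 1`.
  have lρ₁ : Tendsto (fun s => (1 - Ω₂ (f s) * Ω (f s) / Ω₁ (f s) ^ 2) -
      Ω (f s) / Ω₁ (f s) * f₂ s / f₁ s ^ 2) (𝓝[<] 0) (𝓝 (-(μ / n))) := by
    have := (hLf.const_sub 1).add (hRf.mul r2)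
    have e : 1 - (1 + μ) + μ * ((n - 1) / n) = -(μ / n) := by field_simp; ring
    rw [e] at this
    refine this.congr' ?_
    filter_upwards [hgood] with s hs
    have h2 := hs.2.1.2.ne
    have h3 := hs.2.2.ne'
    have h4 := (hD _ hs.2.1).2.1.ne'
    field_simp
    ring
  have hcont : ContinuousOn t (Ioo (-ε) 0) := fun s hs => (ht s hs).continuousAt.continuousWithinAt
  refine ⟨⟨μ / n, by positivity, tendsto_of_tendsto_comp_left hε hcont lt hlt ?_⟩,
    tendsto_of_tendsto_comp_left hε hcont lt hlt ?_⟩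
  · refine tendsto_accelRatio_comp F hη (fun s hs => hdom s (hsub hs).1)
      (fun s hs => ht s (hsub hs).1) (ρ := fun s => Ω (f s) / Ω₁ (f s) / f₁ s) (fun s hs => ?_)
      (fun s hs => ha s (hsub hs).1) (fun s hs => hβ s (hsub hs).1) (fun s hs => ?_)
      hβ0 lβ lβ₁ lβ₂ lρ lρ₁
    · obtain ⟨h0, h1, d0, -⟩ := hD _ (hsub hs).2.1
      refine ⟨h0, (d0.comp s (hf s (hsub hs).1).2.1).congr_deriv ?_⟩
      have := (hsub hs).2.2.ne'
      field_simp
    · obtain ⟨h0, h1, d0, d1⟩ := hD _ (hsub hs).2.1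
      have h3 := (hsub hs).2.2
      obtain ⟨-, e1, e2⟩ := hf s (hsub hs).1
      refine ⟨by positivity, (((d0.comp s e1).div (d1.comp s e1) h1.ne').div e2
        h3.ne').congr_deriv ?_⟩
      simp only [Function.comp, Pi.div_apply]
      have := h1.ne'
      have := h3.ne'
      field_simp
  · have := (lβ.pos_mul_atTop hβ0 hΩf)
    exact this.congr' (hεmem.mono fun s hs => (ha s hs).symm)

/-- A flow line along which the cosmic time is flat takes an infinite time to reach the event. -/
theorem IsFIUFactor.not_flat {t₀ : ℝ} {Ω : ℝ → ℝ} {l : ℝ} (hl : 1 < l)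
    (hΩ : IsFIUFactor Ω (l : EReal)) {ε : ℝ} (hε : 0 < ε) {t f : ℝ → ℝ}
    (hlt : ∀ s ∈ Ioo (-ε) 0, t s < t₀) (ht : ∀ s ∈ Ioo (-ε) 0, HasDerivAt t (Ω (f s)) s)
    (hf : ∀ s ∈ Ioo (-ε) 0, f s < 0)
    (lf : ∀ n : ℕ, Tendsto (fun s => f s / s ^ n) (𝓝[<] 0) (𝓝 0)) : False := by
  obtain ⟨d, hd, Ω₁, Ω₂, hD, hL⟩ := hΩ.exists_derivs
  obtain ⟨μ, rfl⟩ : ∃ μ, l = 1 + μ := ⟨l - 1, by ring⟩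
  have hR := tendsto_div_deriv_div hd (by linarith) hD hL hΩ.1
  obtain ⟨N, hN, κ, hκ, hlow⟩ := exists_pow_lower_bound hd
    (fun T hT => ⟨(hD T hT).1, (hD T hT).2.1, (hD T hT).2.2.1⟩) hR
  have hεmem : ∀ᶠ s in 𝓝[<] (0 : ℝ), s ∈ Ioo (-ε) 0 := Ioo_mem_nhdsLT (neg_lt_zero.2 hε)
  have hf0 : Tendsto f (𝓝[<] 0) (𝓝[<] 0) := by
    rw [tendsto_nhdsWithin_iff]
    refine ⟨?_, hεmem.mono fun s hs => hf s hs⟩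
    simpa using lf 0
  have hN0 : N ≠ 0 := hN.ne'
  -- Flatness gives `|f| ≤ |s| ^ N`, so `κ ≤ Ω(f) ^ N (-f)` yields `κ ≤ (Ω(f) |s|) ^ N`. Passing to
  -- `min κ 1` makes an `N`-th root unnecessary, since `(min κ 1) ^ N ≤ κ`.
  have hb : ∀ᶠ s in 𝓝[<] (0 : ℝ), s ∈ Ioo (-ε) 0 ∧ min κ 1 / (-s) ≤ Ω (f s) := by
    have h1 : ∀ᶠ s in 𝓝[<] (0 : ℝ), |f s / s ^ N| < 1 := by
      have := (lf N).abs
      rw [abs_zero] at this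
      exact this.eventually (gt_mem_nhds one_pos)
    filter_upwards [hεmem, h1, hf0.eventually hlow,
      hf0 (Ioo_mem_nhdsLT (neg_lt_zero.2 hd))] with s hs h1 h2 h3
    refine ⟨hs, ?_⟩
    have hs' : 0 < -s := neg_pos.2 hs.2
    have h0 := (hD _ h3).1
    rw [abs_div, abs_pow, abs_of_neg hs.2, abs_of_neg h3.2, div_lt_one (by positivity)] at h1
    have hm : 0 < min κ 1 := lt_min hκ one_pos
    rw [← pow_le_pow_iff_left₀ (by positivity) h0.le hN0, div_pow, div_le_iff₀ (by positivity)]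
    calc min κ 1 ^ N ≤ min κ 1 := pow_le_of_le_one hm.le (min_le_right _ _) hN0
      _ ≤ κ := min_le_left _ _
      _ ≤ Ω (f s) ^ N * (-(f s)) := h2
      _ ≤ _ := by gcongr
  obtain ⟨e, he, hsub⟩ := (mem_nhdsLT_iff_exists_Ioo_subset' (neg_lt_zero.2 hε)).1 hb
  have hder : ∀ s ∈ Ioo e 0, HasDerivAt (fun s => t s + min κ 1 * Real.log (-s))
      (Ω (f s) + min κ 1 * (-1 / -s)) s := fun s hs =>
    (ht s (hsub hs).1).add (((hasDerivAt_id s).neg.log (neg_ne_zero.2 hs.2.ne)).const_mul _)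
  -- `dt/ds ≥ const / |s|`, so `t` grows at least like `-log |s|` and must exceed `t₀`.
  have hmono : MonotoneOn (fun s => t s + min κ 1 * Real.log (-s)) (Ioo e 0) := by
    refine monotoneOn_of_deriv_nonneg (convex_Ioo e 0)
      (fun s hs => (hder s hs).continuousAt.continuousWithinAt)
      (fun s hs => ?_) (fun s hs => ?_) <;> rw [interior_Ioo] at hs
    · exact (hder s hs).differentiableAt.differentiableWithinAt
    · rw [(hder s hs).deriv]
      have := (hsub hs).2
      have e : min κ 1 * (-1 / -s) = -(min κ 1 / (-s)) := by ring
      linarith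
  have hmid : e / 2 ∈ Ioo e 0 := by
    have : e < 0 := he
    constructor <;> linarith
  have hlog : Tendsto (fun s : ℝ => -(min κ 1 * Real.log (-s))) (𝓝[<] 0) atTop := by
    have h1 : Tendsto (fun s : ℝ => -s) (𝓝[<] 0) (𝓝[>] 0) := by
      rw [tendsto_nhdsWithin_iff]
      refine ⟨tendsto_nhdsWithin_of_tendsto_nhds (continuous_neg.tendsto' 0 0 neg_zero), ?_⟩
      filter_upwards [self_mem_nhdsWithin] with s (hs : s < 0) using neg_pos.2 hs
    have h2 := (Real.tendsto_log_nhdsGT_zero.comp h1).const_mul_atBot (lt_min hκ one_pos)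
    exact tendsto_neg_atBot_atTop.comp h2
  obtain ⟨s, h1, h2⟩ := ((hlog.eventually_gt_atTop
    (t₀ - (t (e / 2) + min κ 1 * Real.log (-(e / 2))))).and (Ioo_mem_nhdsLT hmid.2)).exists
  have hs : s ∈ Ioo e 0 := ⟨hmid.1.trans h2.1, h2.2⟩
  have h3 := hmono hmid hs h2.1.le
  have h4 := hlt s (hsub hs).1
  simp only at h3
  linarith

end CurveData

/-! ### Flow lines through a point of the event, in local coordinates -/

section LocalEvent

theorem hasDerivAt_fst_comp {A B : Type} [NormedAddCommGroup A] [NormedSpace ℝ A]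
    [NormedAddCommGroup B] [NormedSpace ℝ B] {y : ℝ → A × B} {v : A × B} {s : ℝ}
    (h : HasDerivAt y v s) : HasDerivAt (fun r => (y r).1) v.1 s :=
  (ContinuousLinearMap.fst ℝ A B).hasFDerivAt.comp_hasDerivAt s h

theorem hasDerivAt_snd_comp {A B : Type} [NormedAddCommGroup A] [NormedSpace ℝ A]
    [NormedAddCommGroup B] [NormedSpace ℝ B] {y : ℝ → A × B} {v : A × B} {s : ℝ}
    (h : HasDerivAt y v s) : HasDerivAt (fun r => (y r).2) v.2 s :=
  (ContinuousLinearMap.snd ℝ A B).hasFDerivAt.comp_hasDerivAt s h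

/-- Solutions of an autonomous differential equation are smoother than the vector field. -/
theorem contDiffOn_of_hasDerivAt_comp {E : Type} [NormedAddCommGroup E] [NormedSpace ℝ E]
    {Y : E → E} {y : ℝ → E} {W : Set E} {I : Set ℝ} (hI : IsOpen I) (n : ℕ)
    (hY : ContDiffOn ℝ n Y W) (hy : ∀ s ∈ I, y s ∈ W ∧ HasDerivAt y (Y (y s)) s) :
    ContDiffOn ℝ (n + 1 : ℕ) y I := by
  have step : ∀ m ≤ n, ContDiffOn ℝ (m : ℕ) y I → ContDiffOn ℝ (m + 1 : ℕ) y I := by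
    intro m hm h
    push_cast
    rw [contDiffOn_succ_iff_deriv_of_isOpen hI]
    refine ⟨fun s hs => (hy s hs).2.differentiableAt.differentiableWithinAt, by simp, ?_⟩
    have : ContDiffOn ℝ m (fun s => Y (y s)) I :=
      (hY.of_le (by exact_mod_cast hm)).comp h fun s hs => (hy s hs).1
    exact this.congr fun s hs => (hy s hs).2.deriv
  have h0 : ContDiffOn ℝ (0 : ℕ) y I := by
    rw [Nat.cast_zero, contDiffOn_zero]
    exact fun s hs => (hy s hs).2.continuousAt.continuousWithinAt
  have : ∀ m ≤ n + 1, ContDiffOn ℝ (m : ℕ) y I := by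
    intro m
    induction m with
    | zero => exact fun _ => h0
    | succ m ih => exact fun hm => step m (by omega) (ih (by omega))
  exact this _ le_rfl

/-- The first two derivatives of a `C²` function on an interval around the origin. -/
theorem ContDiffOn.exists_two_derivs {β : ℝ → ℝ} {ε : ℝ} (hε : 0 < ε)
    (h : ContDiffOn ℝ 2 β (Ioo (-ε) ε)) :
    ∃ β₁ β₂ : ℝ → ℝ, (∀ s ∈ Ioo (-ε) 0, HasDerivAt β (β₁ s) s ∧ HasDerivAt β₁ (β₂ s) s) ∧
      Tendsto β (𝓝[<] 0) (𝓝 (β 0)) ∧ Tendsto β₁ (𝓝[<] 0) (𝓝 (β₁ 0)) ∧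
      Tendsto β₂ (𝓝[<] 0) (𝓝 (β₂ 0)) := by
  have h1 := ((contDiffOn_succ_iff_deriv_of_isOpen (n := 1) isOpen_Ioo).1 h).2.2
  have h2 := ((contDiffOn_succ_iff_deriv_of_isOpen (n := 0) isOpen_Ioo).1 h1).2.2
  have h0 : Ioo (-ε) ε ∈ 𝓝 (0 : ℝ) := Ioo_mem_nhds (by linarith) hε
  have hlim : ∀ {g : ℝ → ℝ}, ContinuousOn g (Ioo (-ε) ε) → Tendsto g (𝓝[<] 0) (𝓝 (g 0)) :=
    fun hg => (hg.continuousAt h0).tendsto.mono_left nhdsWithin_le_nhds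
  refine ⟨deriv β, deriv (deriv β), fun s hs => ?_, hlim h.continuousOn, hlim h1.continuousOn,
    hlim h2.continuousOn⟩
  have hs' : Ioo (-ε) ε ∈ 𝓝 s := Ioo_mem_nhds hs.1 (hs.2.trans hε)
  exact ⟨((h.differentiableOn (by simp)).differentiableAt hs').hasDerivAt,
    ((h1.differentiableOn (by simp)).differentiableAt hs').hasDerivAt⟩

namespace FRWModel

/-- The metric of the unit spatial slice. -/
noncomputable def spatial (F : FRWModel) (z y : EuclideanSpace ℝ (Fin 3)) : ℝ :=
  inner ℝ y y + (F.k : ℝ) * (inner ℝ z y * inner ℝ z y) / (1 - (F.k : ℝ) * ‖z‖ ^ 2)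

/-- A conformal extension of an FRW model near a point of the event, in local coordinates:
`τ` is the cosmic time, `ψ` is the change to the physical coordinates, `G` is the unphysical metric
and `X` the unphysical unit flow. -/
structure LocalEvent (F : FRWModel) (Ω : ℝ → ℝ) (W : Set Coord) (x₀ : Coord) (τ : Coord → ℝ)
    (ψ : Coord → Coord) (G : Coord → Coord →L[ℝ] Coord →L[ℝ] ℝ) (X : Coord → Coord)
    (θ : Coord → ℝ) : Prop where
  isOpen : IsOpen W
  mem : x₀ ∈ W
  time_smooth : ContDiffOn ℝ ∞ τ W
  time_zero : τ x₀ = 0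
  metric_smooth : ContDiffOn ℝ 2 G W
  flow_smooth : ContDiffOn ℝ 2 X W
  coord_smooth : ContDiffOn ℝ ∞ ψ (W ∩ {x | τ x < 0})
  coord_mem : ∀ x ∈ W, τ x < 0 → ψ x ∈ F.domain
  factor_pos : ∀ x ∈ W, τ x < 0 → 0 < Ω (τ x)
  conformal : ∀ x ∈ W, τ x < 0 → ∀ v w,
    F.metric (ψ x) (fderiv ℝ ψ x v) (fderiv ℝ ψ x w) = Ω (τ x) ^ 2 * G x v w
  flow_eq : ∀ x ∈ W, τ x < 0 → fderiv ℝ ψ x (X x) = Ω (τ x) • F.flow (ψ x)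
  exists_spatial : ∃ w, 0 < G x₀ w w + G x₀ (X x₀) w ^ 2
  strictMono : ∃ δ > 0, ∃ η > 0, ∀ (γ : ℝ → Coord) (α β : ℝ), α < β →
    ContDiffOn ℝ 1 γ (Icc α β) → (∀ s ∈ Icc α β, γ s ∈ Metric.ball x₀ η ∧
      derivWithin γ (Icc α β) s ∈ Metric.ball (X x₀) δ) → StrictMonoOn (τ ∘ γ) (Icc α β)
  time_continuousOn : ContinuousOn θ F.domain
  time_neg : ∀ z ∈ F.domain, θ z < 0
  time_eq : ∀ x ∈ W, τ x < 0 → θ (ψ x) = τ x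

variable {F : FRWModel} {Ω : ℝ → ℝ} {W : Set Coord} {x₀ : Coord} {τ : Coord → ℝ}
    {ψ : Coord → Coord} {G : Coord → Coord →L[ℝ] Coord →L[ℝ] ℝ} {X : Coord → Coord}
    {θ : Coord → ℝ}

theorem LocalEvent.isOpen_neg (h : LocalEvent F Ω W x₀ τ ψ G X θ) :
    IsOpen (W ∩ {x | τ x < 0}) :=
  h.time_smooth.continuousOn.isOpen_inter_preimage h.isOpen isOpen_Iio

/-- The flow line through `x₀`, together with a vector field which is invariant under the flow. -/
theorem LocalEvent.exists_flow_line (h : LocalEvent F Ω W x₀ τ ψ G X θ) :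
    ∃ ε > 0, ∃ γ w : ℝ → Coord, γ 0 = x₀ ∧ (∀ s ∈ Ioo (-ε) ε, γ s ∈ W ∧
      HasDerivAt γ (X (γ s)) s ∧ HasDerivAt w (fderiv ℝ X (γ s) (w s)) s ∧
      0 < G (γ s) (w s) (w s) + G (γ s) (X (γ s)) (w s) ^ 2) ∧
      (∀ s ∈ Ioo (-ε) 0, τ (γ s) < 0) ∧
      ContDiffOn ℝ 2 (fun s => G (γ s) (w s) (w s) + G (γ s) (X (γ s)) (w s) ^ 2) (Ioo (-ε) ε) := by
  obtain ⟨w₀, hw₀⟩ := h.exists_spatial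
  have hX' : ContDiffOn ℝ 1 (fderiv ℝ X) W :=
    h.flow_smooth.fderiv_of_isOpen h.isOpen (by norm_num)
  -- The flow together with its linearization, as one autonomous system. The second component
  -- transports `w` so that it commutes with `X`. The system is `C¹` because `X` is `C²`.
  set Y : Coord × Coord → Coord × Coord := fun p => (X p.1, fderiv ℝ X p.1 p.2) with hYdef
  have hY : ContDiffOn ℝ 1 Y (W ×ˢ univ) := by
    refine ContDiffOn.prodMk ?_ ?_
    · exact (h.flow_smooth.of_le (by norm_num)).comp contDiffOn_fst fun p hp => hp.1
    · exact (hX'.comp contDiffOn_fst fun p hp => hp.1).clm_apply contDiffOn_snd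
  have hWopen : IsOpen (W ×ˢ (univ : Set Coord)) := h.isOpen.prod isOpen_univ
  obtain ⟨y, hy0, e, he, hy⟩ := (hY.contDiffAt (hWopen.mem_nhds
    (show (x₀, w₀) ∈ W ×ˢ univ from ⟨h.mem, mem_univ _⟩))).exists_forall_mem_closedBall_exists_eq_forall_mem_Ioo_hasDerivAt₀ 0
  have hB : ContDiffOn ℝ 2 (fun p : Coord × Coord => G p.1 p.2 p.2 + G p.1 (X p.1) p.2 ^ 2)
      (W ×ˢ univ) := by
    have h1 : ContDiffOn ℝ 2 (fun p : Coord × Coord => G p.1) (W ×ˢ univ) :=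
      h.metric_smooth.comp contDiffOn_fst fun p hp => hp.1
    have h2 : ContDiffOn ℝ 2 (fun p : Coord × Coord => X p.1) (W ×ˢ univ) :=
      h.flow_smooth.comp contDiffOn_fst fun p hp => hp.1
    exact ((h1.clm_apply contDiffOn_snd).clm_apply contDiffOn_snd).add
      (((h1.clm_apply h2).clm_apply contDiffOn_snd).pow 2)
  have hyc : ContinuousAt y 0 := (hy 0 (by simpa using he)).continuousAt
  have ev1 : ∀ᶠ s in 𝓝 (0 : ℝ), y s ∈ W ×ˢ (univ : Set Coord) :=
    hyc.eventually_mem (by rw [hy0]; exact hWopen.mem_nhds ⟨h.mem, mem_univ _⟩)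
  have ev2 : ∀ᶠ s in 𝓝 (0 : ℝ), 0 < G (y s).1 (y s).2 (y s).2 +
      G (y s).1 (X (y s).1) (y s).2 ^ 2 := by
    have hc : ContinuousAt (fun p : Coord × Coord => G p.1 p.2 p.2 + G p.1 (X p.1) p.2 ^ 2) (y 0) :=
      hB.continuousOn.continuousAt (by rw [hy0]; exact hWopen.mem_nhds ⟨h.mem, mem_univ _⟩)
    have : 0 < (fun p : Coord × Coord => G p.1 p.2 p.2 + G p.1 (X p.1) p.2 ^ 2) (y 0) := by
      simpa [hy0] using hw₀
    exact (hc.comp hyc).tendsto.eventually (lt_mem_nhds this)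
  obtain ⟨δ, hδ, η, hη, hmono⟩ := h.strictMono
  have ev3 : ∀ᶠ s in 𝓝 (0 : ℝ), (y s).1 ∈ Metric.ball x₀ η :=
    hyc.fst.eventually_mem (by rw [hy0]; exact Metric.ball_mem_nhds _ hη)
  have ev4 : ∀ᶠ s in 𝓝 (0 : ℝ), X (y s).1 ∈ Metric.ball (X x₀) δ := by
    have hc : ContinuousAt X (y 0).1 := by
      rw [hy0]; exact h.flow_smooth.continuousOn.continuousAt (h.isOpen.mem_nhds h.mem)
    have := (ContinuousAt.comp (f := fun s => (y s).1) hc hyc.fst)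
    exact this.eventually_mem (by
      simp only [Function.comp, hy0]; exact Metric.ball_mem_nhds _ hδ)
  have ev5 : ∀ᶠ s in 𝓝 (0 : ℝ), s ∈ Ioo (0 - e) (0 + e) := Ioo_mem_nhds (by linarith) (by linarith)
  obtain ⟨ε, hε, hall⟩ := Metric.eventually_nhds_iff_ball.1
    (ev1.and (ev2.and (ev3.and (ev4.and ev5))))
  rw [Real.ball_eq_Ioo, zero_sub, zero_add] at hall
  have hy' : ∀ s ∈ Ioo (-ε) ε, HasDerivAt y (Y (y s)) s := fun s hs => hy s (hall s hs).2.2.2.2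
  -- A solution of a `C¹` system is `C²`; this supplies the regularity of `β` required later.
  have hyC : ContDiffOn ℝ 2 y (Ioo (-ε) ε) := by
    have := contDiffOn_of_hasDerivAt_comp isOpen_Ioo 1 (by exact_mod_cast hY) fun s hs =>
      ⟨(hall s hs).1, hy' s hs⟩
    exact_mod_cast this
  have hd1 : ∀ s ∈ Ioo (-ε) ε, HasDerivAt (fun s => (y s).1) (X (y s).1) s := fun s hs =>
    hasDerivAt_fst_comp (hy' s hs)
  have hd2 : ∀ s ∈ Ioo (-ε) ε, HasDerivAt (fun s => (y s).2) (fderiv ℝ X (y s).1 (y s).2) s :=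
    fun s hs => hasDerivAt_snd_comp (hy' s hs)
  refine ⟨ε, hε, fun s => (y s).1, fun s => (y s).2, by simp [hy0], fun s hs =>
    ⟨(hall s hs).1.1, hd1 s hs, hd2 s hs, (hall s hs).2.1⟩, fun s hs => ?_,
    hB.comp hyC fun s hs => (hall s hs).1⟩
  -- The velocity of the flow line stays close to `X x₀`, so `τ` increases along it up to the value
  -- `0` at `s = 0`.
  have hsub : Icc s 0 ⊆ Ioo (-ε) ε := fun r hr => ⟨hs.1.trans_le hr.1, hr.2.trans_lt hε⟩
  have := hmono (fun s => (y s).1) s 0 hs.2 ((contDiff_fst.comp_contDiffOn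
    (hyC.of_le (by norm_num))).mono hsub) fun r hr => ⟨(hall r (hsub hr)).2.2.1, by
      rw [(hd1 r (hsub hr)).hasDerivWithinAt.derivWithin (uniqueDiffOn_Icc hs.2 r hr)]
      exact (hall r (hsub hr)).2.2.2.1⟩
  have := this (left_mem_Icc.2 hs.2.le) (right_mem_Icc.2 hs.2.le) hs.2
  simpa [hy0, h.time_zero] using this

/-- In physical coordinates the flow line is a line `x = const`, and the invariant vector field has
constant spatial components. -/
theorem LocalEvent.flow_line_eq (h : LocalEvent F Ω W x₀ τ ψ G X θ) {ε : ℝ} {γ w : ℝ → Coord}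
    (hγ : ∀ s ∈ Ioo (-ε) 0, γ s ∈ W ∧ HasDerivAt γ (X (γ s)) s ∧
      HasDerivAt w (fderiv ℝ X (γ s) (w s)) s) (hneg : ∀ s ∈ Ioo (-ε) 0, τ (γ s) < 0) :
    (∀ s ∈ Ioo (-ε) 0, HasDerivAt (fun s => (ψ (γ s)).1) (Ω (τ (γ s))) s) ∧
    (∃ x, ∀ s ∈ Ioo (-ε) 0, (ψ (γ s)).2 = x) ∧
    ∃ ζ, ∀ s ∈ Ioo (-ε) 0, (fderiv ℝ ψ (γ s) (w s)).2 = ζ := by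
  have hmem : ∀ s ∈ Ioo (-ε) 0, γ s ∈ W ∩ {x | τ x < 0} := fun s hs =>
    ⟨(hγ s hs).1, hneg s hs⟩
  have hnhds : ∀ s ∈ Ioo (-ε) 0, W ∩ {x | τ x < 0} ∈ 𝓝 (γ s) := fun s hs =>
    h.isOpen_neg.mem_nhds (hmem s hs)
  have hψ : ∀ s ∈ Ioo (-ε) 0, HasDerivAt (fun s => ψ (γ s)) (Ω (τ (γ s)), 0) s := by
    intro s hs
    have h1 := (((h.coord_smooth.contDiffAt (hnhds s hs)).differentiableAt
      (by simp)).hasFDerivAt).comp_hasDerivAt s (hγ s hs).2.1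
    rw [h.flow_eq _ (hγ s hs).1 (hneg s hs)] at h1
    refine h1.congr_deriv ?_
    simp [FRWModel.flow]
  have hconst : ∀ {g : ℝ → EuclideanSpace ℝ (Fin 3)},
      (∀ s ∈ Ioo (-ε) 0, HasDerivAt g 0 s) → ∃ x, ∀ s ∈ Ioo (-ε) 0, g s = x := by
    intro g hg
    exact isOpen_Ioo.exists_is_const_of_deriv_eq_zero isPreconnected_Ioo
      (fun s hs => (hg s hs).differentiableAt.differentiableWithinAt) fun s hs => (hg s hs).deriv
  refine ⟨fun s hs => hasDerivAt_fst_comp (hψ s hs), hconst fun s hs => hasDerivAt_snd_comp (hψ s hs),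
    hconst fun s hs => ?_⟩
  have hsm : ContDiffAt ℝ ∞ ψ (γ s) := h.coord_smooth.contDiffAt (hnhds s hs)
  have hD : HasFDerivAt (fderiv ℝ ψ) (fderiv ℝ (fderiv ℝ ψ) (γ s)) (γ s) :=
    ((contDiffAt_fderiv_infty hsm).differentiableAt (by simp)).hasFDerivAt
  have hXd : HasFDerivAt X (fderiv ℝ X (γ s)) (γ s) :=
    ((h.flow_smooth.differentiableOn (by simp)).differentiableAt
      (h.isOpen.mem_nhds (hγ s hs).1)).hasFDerivAt
  have h1 : HasDerivAt (fun s => fderiv ℝ ψ (γ s) (w s))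
      (fderiv ℝ (fderiv ℝ ψ) (γ s) (X (γ s)) (w s) + fderiv ℝ ψ (γ s) (fderiv ℝ X (γ s) (w s))) s :=
    (hD.comp_hasDerivAt s (hγ s hs).2.1).clm_apply (hγ s hs).2.2
  -- `dψ(X)` is parallel to `∂/∂t` on an open set, so its spatial part has zero differential there.
  -- In the direction `w`, and by symmetry of the second derivative of `ψ`, this differential is the
  -- rate of change of the spatial part of `dψ(w)` along `γ`.
  have h2 : HasFDerivAt (fun x => (fderiv ℝ ψ x (X x)).2) (0 : Coord →L[ℝ] _) (γ s) := by
    refine (hasFDerivAt_const (0 : EuclideanSpace ℝ (Fin 3)) (γ s)).congr_of_eventuallyEq ?_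
    filter_upwards [hnhds s hs] with x hx
    rw [h.flow_eq x hx.1 hx.2]
    simp [FRWModel.flow]
  have h3 := (hasFDerivAt_snd (𝕜 := ℝ) (p := fderiv ℝ ψ (γ s) (X (γ s)))).comp (γ s)
    (hD.clm_apply hXd)
  have h4 := DFunLike.congr_fun (h3.unique h2) (w s)
  have hsymm : fderiv ℝ (fderiv ℝ ψ) (γ s) (X (γ s)) (w s) =
      fderiv ℝ (fderiv ℝ ψ) (γ s) (w s) (X (γ s)) :=
    (hsm.isSymmSndFDerivAt (by
      rw [minSmoothness_of_isRCLikeNormedField]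
      exact WithTop.coe_le_coe.2 (le_top : (2 : ℕ∞) ≤ ⊤))).eq _ _
  refine (hasDerivAt_snd_comp h1).congr_deriv ?_
  rw [hsymm]
  simp only [ContinuousLinearMap.coe_comp, Function.comp, ContinuousLinearMap.coe_snd',
    add_apply, ContinuousLinearMap.flip_apply, Prod.snd_add, zero_apply] at h4 ⊢
  rw [add_comm] at h4
  exact h4

end FRWModel

end LocalEvent

/-! ### Limits of the scale factor at the event -/

section LocalLimits

namespace FRWModel

variable {F : FRWModel} {Ω : ℝ → ℝ} {W : Set Coord} {x₀ : Coord} {τ : Coord → ℝ}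
    {ψ : Coord → Coord} {G : Coord → Coord →L[ℝ] Coord →L[ℝ] ℝ} {X : Coord → Coord}
    {θ : Coord → ℝ}

theorem metric_eq_spatial (F : FRWModel) (z v : Coord) :
    F.metric z v v = -(v.1 * v.1) + F.scale z.1 ^ 2 * F.spatial z.2 v.2 := rfl

theorem metric_flow (F : FRWModel) (z w : Coord) (c : ℝ) :
    F.metric z (c • F.flow z) w = -(c * w.1) := by
  simp [metric, flow]

/-- The spatial part of the unphysical metric is the conformally rescaled spatial part of the
physical metric. -/
theorem LocalEvent.spatial_eq (h : LocalEvent F Ω W x₀ τ ψ G X θ) {x : Coord} (hx : x ∈ W)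
    (hneg : τ x < 0) (w : Coord) :
    Ω (τ x) ^ 2 * (G x w w + G x (X x) w ^ 2) =
      F.scale (ψ x).1 ^ 2 * F.spatial (ψ x).2 (fderiv ℝ ψ x w).2 := by
  have h1 := h.conformal x hx hneg w w
  have h2 := h.conformal x hx hneg (X x) w
  rw [metric_eq_spatial F _ _] at h1
  rw [h.flow_eq x hx hneg, metric_flow] at h2
  have h0 := (h.factor_pos x hx hneg).ne'
  have h3 : (fderiv ℝ ψ x w).1 = -(Ω (τ x) * G x (X x) w) := by
    refine mul_left_cancel₀ h0 ?_
    linear_combination -h2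
  rw [h3] at h1
  linear_combination -h1

/-- The leading term of the cosmic time at the event does not vanish in the direction of the
flow. -/
theorem LocalEvent.leadingTerm_ne_zero (h : LocalEvent F Ω W x₀ τ ψ G X θ) {n : ℕ}
    (hlow : ∀ j < n, iteratedFDeriv ℝ j (fun x => τ (x₀ + x)) 0 = 0)
    (hn : iteratedFDeriv ℝ n (fun x => τ (x₀ + x)) 0 ≠ 0) {c : ℝ}
    (hc : HasLeadingTerm n (fun x => τ (x₀ + x)) (X x₀) c) : c ≠ 0 := by
  obtain ⟨δ, hδ, η, hη, hmono⟩ := h.strictMono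
  have hsm : ContDiffAt ℝ ∞ (fun x => τ (x₀ + x)) 0 := by
    have h1 : ContDiffAt ℝ ∞ τ (x₀ + 0) := by
      rw [add_zero]; exact h.time_smooth.contDiffAt (h.isOpen.mem_nhds h.mem)
    exact h1.comp (0 : Coord) (contDiffAt_const.add contDiffAt_id)
  -- Straight segments in directions close to `X x₀` are admissible curves, so `τ` increases along
  -- them.
  refine hc.ne_zero_of_monotone hsm hlow hn (by simpa using h.time_zero) hδ hη
    fun x hx w hw r hr hxr => ?_
  rcases hr.eq_or_lt with rfl | hr
  · simp
  have hder : ∀ s : ℝ, HasDerivAt (fun s : ℝ => x₀ + (x + s • w)) w s := fun s => by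
    have := (((hasDerivAt_id s).smul_const w).const_add x).const_add x₀
    simpa using this
  have := hmono (fun s => x₀ + (x + s • w)) 0 r hr (by fun_prop) fun s hs => ⟨?_, ?_⟩
  · have := this (left_mem_Icc.2 hr.le) (right_mem_Icc.2 hr.le) hr
    simpa using this.le
  · have hmem : x + s • w ∈ Metric.ball (0 : Coord) η := by
      have hseg : x + s • w ∈ segment ℝ x (x + r • w) := by
        rw [segment_eq_image']
        refine ⟨s / r, ⟨div_nonneg hs.1 hr.le, (div_le_one hr).2 hs.2⟩, ?_⟩
        simp [smul_smul, div_mul_cancel₀ s hr.ne']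
      exact (convex_ball (0 : Coord) η).segment_subset hx hxr hseg
    simpa [Metric.mem_ball, dist_eq_norm] using hmem
  · rwa [(hder s).hasDerivWithinAt.derivWithin (uniqueDiffOn_Icc hr s hs)]

/-- Flow lines which meet the event leave every compact set of physical times. -/
theorem LocalEvent.tendsto_time (h : LocalEvent F Ω W x₀ τ ψ G X θ) {t₀ : ℝ}
    (ht₀ : IsLUB F.dom t₀) {ε : ℝ} (hε : 0 < ε) {γ : ℝ → Coord} (hγ : ∀ s ∈ Ioo (-ε) 0, γ s ∈ W)
    (hneg : ∀ s ∈ Ioo (-ε) 0, τ (γ s) < 0)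
    (hτ : Tendsto (fun s => τ (γ s)) (𝓝[<] 0) (𝓝 0))
    (ht : ∀ s ∈ Ioo (-ε) 0, HasDerivAt (fun s => (ψ (γ s)).1) (Ω (τ (γ s))) s)
    {x : EuclideanSpace ℝ (Fin 3)} (hx : ∀ s ∈ Ioo (-ε) 0, (ψ (γ s)).2 = x) :
    Tendsto (fun s => (ψ (γ s)).1) (𝓝[<] 0) (𝓝 t₀) := by
  have hεmem : ∀ᶠ s in 𝓝[<] (0 : ℝ), s ∈ Ioo (-ε) 0 := Ioo_mem_nhdsLT (neg_lt_zero.2 hε)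
  have hmem : ∀ s ∈ Ioo (-ε) 0, ψ (γ s) ∈ F.domain := fun s hs =>
    h.coord_mem _ (hγ s hs) (hneg s hs)
  have hmono : MonotoneOn (fun s => (ψ (γ s)).1) (Ioo (-ε) 0) := by
    refine monotoneOn_of_deriv_nonneg (convex_Ioo _ _)
      (fun s hs => (ht s hs).continuousAt.continuousWithinAt)
      (fun s hs => ?_) (fun s hs => ?_) <;> rw [interior_Ioo] at hs
    · exact (ht s hs).differentiableAt.differentiableWithinAt
    · rw [(ht s hs).deriv]
      exact (h.factor_pos _ (hγ s hs) (hneg s hs)).le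
  have hle : ∀ s ∈ Ioo (-ε) 0, (ψ (γ s)).1 ≤ t₀ := fun s hs => ht₀.1 (hmem s hs).1
  have hbdd : BddAbove ((fun s => (ψ (γ s)).1) '' Ioo (-ε) 0) :=
    ⟨t₀, by rintro _ ⟨s, hs, rfl⟩; exact hle s hs⟩
  have hne : (Ioo (-ε) 0).Nonempty := ⟨-ε / 2, by constructor <;> linarith⟩
  have hlim := hmono.tendsto_nhdsWithin_Ioo_left hne hbdd
  set t₁ := sSup ((fun s => (ψ (γ s)).1) '' Ioo (-ε) 0) with ht₁
  have h1 : t₁ ≤ t₀ := csSup_le (hne.image _) (by rintro _ ⟨s, hs, rfl⟩; exact hle s hs)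
  rcases h1.eq_or_lt with h1 | h1
  · rwa [h1] at hlim
  -- If the limit time were below `t₀`, the flow line would converge to a point of the physical
  -- domain. The cosmic time is continuous and negative there, yet it tends to `0` along the line.
  exfalso
  obtain ⟨s₁, hs₁⟩ := hne
  obtain ⟨y, hy, hy'⟩ := (lt_isLUB_iff ht₀).1 h1
  have hz : (t₁, x) ∈ F.domain := by
    refine ⟨F.dom_interval.out (hmem s₁ hs₁).1 hy
      ⟨le_csSup hbdd (mem_image_of_mem _ hs₁), hy'.le⟩, ?_⟩
    have := (hmem s₁ hs₁).2
    rwa [hx s₁ hs₁] at this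
  have hψ : Tendsto (fun s => ψ (γ s)) (𝓝[<] 0) (𝓝[F.domain] (t₁, x)) := by
    rw [tendsto_nhdsWithin_iff]
    refine ⟨?_, hεmem.mono hmem⟩
    have h2 : Tendsto (fun s => ((ψ (γ s)).1, x)) (𝓝[<] 0) (𝓝 (t₁, x)) :=
      hlim.prodMk_nhds tendsto_const_nhds
    refine h2.congr' (hεmem.mono fun s hs => ?_)
    rw [← hx s hs]
  have h3 : Tendsto (fun s => θ (ψ (γ s))) (𝓝[<] 0) (𝓝 (θ (t₁, x))) :=
    (h.time_continuousOn _ hz).tendsto.comp hψ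
  have h4 : Tendsto (fun s => θ (ψ (γ s))) (𝓝[<] 0) (𝓝 0) :=
    hτ.congr' (hεmem.mono fun s hs => (h.time_eq _ (hγ s hs) (hneg s hs)).symm)
  exact (h.time_neg _ hz).ne (tendsto_nhds_unique h3 h4)

/-- The behaviour of the scale factor, from local data at a point of the event. -/
theorem LocalEvent.tendsto_scale (h : LocalEvent F Ω W x₀ τ ψ G X θ) {t₀ : ℝ}
    (ht₀ : IsLUB F.dom t₀) {l : ℝ} (hl : 1 < l) (hΩ : IsFIUFactor Ω (l : EReal)) :
    (∃ q : ℝ, 0 < q ∧ Tendsto F.accelRatio (𝓝[<] t₀) (𝓝 q)) ∧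
      Tendsto F.scale (𝓝[<] t₀) atTop := by
  obtain ⟨ε, hε, γ, w, h0, hγ, hneg, hb⟩ := h.exists_flow_line
  have hsub : Ioo (-ε) 0 ⊆ Ioo (-ε) ε := Ioo_subset_Ioo_right hε.le
  have h0mem : (0 : ℝ) ∈ Ioo (-ε) ε := by simpa using hε
  obtain ⟨ht, ⟨x, hx⟩, ζ, hζ⟩ := h.flow_line_eq
    (fun s hs => ⟨(hγ s (hsub hs)).1, (hγ s (hsub hs)).2.1, (hγ s (hsub hs)).2.2.1⟩) hneg
  have hmem : ∀ s ∈ Ioo (-ε) 0, ψ (γ s) ∈ F.domain := fun s hs =>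
    h.coord_mem _ (hγ s (hsub hs)).1 (hneg s hs)
  have hlt : ∀ s ∈ Ioo (-ε) 0, (ψ (γ s)).1 < t₀ := fun s hs => by
    obtain ⟨y, hy, hy'⟩ := (mem_nhdsGT_iff_exists_Ioo_subset.1
      (mem_nhdsWithin_of_mem_nhds (F.dom_open.mem_nhds (hmem s hs).1)))
    have hm : ((ψ (γ s)).1 + y) / 2 ∈ F.dom := hy' ⟨by linarith [mem_Ioi.1 hy],
      by linarith [mem_Ioi.1 hy]⟩
    linarith [ht₀.1 hm, mem_Ioi.1 hy]
  -- the ratio of the scale factor and the conformal factor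
  set b : ℝ → ℝ := fun s => G (γ s) (w s) (w s) + G (γ s) (X (γ s)) (w s) ^ 2 with hbdef
  have hbpos : ∀ s ∈ Ioo (-ε) ε, 0 < b s := fun s hs => (hγ s hs).2.2.2
  have hbeq : ∀ s ∈ Ioo (-ε) 0, Ω (τ (γ s)) ^ 2 * b s =
      F.scale (ψ (γ s)).1 ^ 2 * F.spatial x ζ := fun s hs => by
    have := h.spatial_eq (hγ s (hsub hs)).1 (hneg s hs) (w s)
    rwa [hζ s hs, hx s hs] at this
  have hΩpos : ∀ s ∈ Ioo (-ε) 0, 0 < Ω (τ (γ s)) := fun s hs =>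
    h.factor_pos _ (hγ s (hsub hs)).1 (hneg s hs)
  have hapos : ∀ s ∈ Ioo (-ε) 0, 0 < F.scale (ψ (γ s)).1 := fun s hs =>
    F.scale_pos _ (hmem s hs).1
  -- The positivity of this constant can be read off from `Ω² b = a² C` at any one point of the
  -- line.
  have hC : 0 < F.spatial x ζ := by
    have hs : -ε / 2 ∈ Ioo (-ε) 0 := by constructor <;> linarith
    have h1 := hbeq _ hs
    have h2 : 0 < Ω (τ (γ (-ε / 2))) ^ 2 * b (-ε / 2) :=
      mul_pos (pow_pos (hΩpos _ hs) 2) (hbpos _ (hsub hs))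
    rw [h1] at h2
    exact (pos_iff_pos_of_mul_pos h2).1 (pow_pos (hapos _ hs) 2)
  have hβ : ContDiffOn ℝ 2 (fun s => √(b s / F.spatial x ζ)) (Ioo (-ε) ε) :=
    (hb.div_const _).sqrt fun s hs => (div_pos (hbpos s hs) hC).ne'
  have ha : ∀ s ∈ Ioo (-ε) 0, F.scale (ψ (γ s)).1 = √(b s / F.spatial x ζ) * Ω (τ (γ s)) := by
    intro s hs
    have h1 : b s / F.spatial x ζ = (F.scale (ψ (γ s)).1 / Ω (τ (γ s))) ^ 2 := by
      have h2 := (hΩpos s hs).ne'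
      have h3 := hbeq s hs
      rw [div_pow, div_eq_div_iff hC.ne' (by positivity)]
      linear_combination h3
    rw [h1, Real.sqrt_sq (div_pos (hapos s hs) (hΩpos s hs)).le,
      div_mul_cancel₀ _ (hΩpos s hs).ne']
  obtain ⟨β₁, β₂, hβd, l0, l1, l2⟩ := hβ.exists_two_derivs hε
  -- the cosmic time along the flow line
  have hsm : ContDiffAt ℝ ∞ (fun x => τ (x₀ + x)) 0 := by
    have h1 : ContDiffAt ℝ ∞ τ (x₀ + 0) := by
      rw [add_zero]; exact h.time_smooth.contDiffAt (h.isOpen.mem_nhds h.mem)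
    exact h1.comp (0 : Coord) (contDiffAt_const.add contDiffAt_id)
  have hτγ : ∀ s, τ (x₀ + (γ s - x₀)) = τ (γ s) := fun s => by rw [add_sub_cancel]
  have hγd : ∀ s ∈ Ioo (-ε) ε, HasDerivAt (fun s => γ s - x₀) (X (γ s)) s := fun s hs =>
    (hγ s hs).2.1.sub_const x₀
  -- Infinite order is excluded by the finiteness of `t₀`; afterwards `n` is the order of the first
  -- non-zero derivative of `τ` at `x₀`.
  by_cases hflat : ∀ j, iteratedFDeriv ℝ j (fun x => τ (x₀ + x)) 0 = 0
  · refine (hΩ.not_flat hl hε hlt ht hneg fun n => ?_).elim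
    have := tendsto_along_curve_of_flat hsm hflat (γ := fun s => γ s - x₀) (by simp [h0])
      (hγd 0 h0mem) n
    simpa only [hτγ] using this
  push Not at hflat
  classical
  set n := Nat.find hflat with hn
  have hn0 : iteratedFDeriv ℝ n (fun x => τ (x₀ + x)) 0 ≠ 0 := Nat.find_spec hflat
  have hlow : ∀ j < n, iteratedFDeriv ℝ j (fun x => τ (x₀ + x)) 0 = 0 := fun j hj =>
    not_not.1 (Nat.find_min hflat hj)
  have hnpos : 0 < n := by
    rw [Nat.pos_iff_ne_zero]
    intro h1
    rw [h1, ← norm_ne_zero_iff, norm_iteratedFDeriv_zero] at hn0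
    simp [h.time_zero] at hn0
  obtain ⟨c, hc⟩ := exists_hasLeadingTerm n hsm hlow (X x₀)
  have hc0 := h.leadingTerm_ne_zero hlow hn0 hc
  have hev : ∀ᶠ s in 𝓝 (0 : ℝ), s ∈ Ioo (-ε) ε := Ioo_mem_nhds h0mem.1 h0mem.2
  have hXd : ∀ s ∈ Ioo (-ε) ε, HasDerivAt (fun s => X (γ s)) (fderiv ℝ X (γ s) (X (γ s))) s :=
    fun s hs => ((h.flow_smooth.differentiableOn (by simp)).differentiableAt
      (h.isOpen.mem_nhds (hγ s hs).1)).hasFDerivAt.comp_hasDerivAt s (hγ s hs).2.1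
  have hX' : ContinuousOn (fderiv ℝ X) W :=
    (h.flow_smooth.fderiv_of_isOpen h.isOpen (m := 1) (by norm_num)).continuousOn
  have hγc : ContinuousAt γ 0 := (hγ 0 h0mem).2.1.continuousAt
  have hX2 : ContinuousAt (fun s => fderiv ℝ X (γ s) (X (γ s))) 0 := by
    have h1 : ContinuousAt (fun s => fderiv ℝ X (γ s)) 0 :=
      (hX'.continuousAt (h.isOpen.mem_nhds (hγ 0 h0mem).1)).comp hγc
    exact h1.clm_apply (hXd 0 h0mem).continuousAt
  obtain ⟨f₁, f₂, hf1, hf2, -, lf, lf1, lf2⟩ := tendsto_along_curve hnpos hsm hlow hc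
    (γ := fun s => γ s - x₀) (γ₁ := fun s => X (γ s)) (by simp [h0]) (by simp [h0])
    (hev.mono hγd) (hev.mono hXd) hX2
  simp only [hτγ] at hf1 lf
  obtain ⟨ε', hε', hall⟩ := Metric.eventually_nhds_iff_ball.1 (hev.and (hf1.and hf2))
  rw [Real.ball_eq_Ioo, zero_sub, zero_add] at hall
  have hall' : ∀ s ∈ Ioo (-ε') 0, s ∈ Ioo (-ε) 0 := fun s hs =>
    ⟨(hall s ⟨hs.1, hs.2.trans hε'⟩).1.1, hs.2⟩
  have hτ : Tendsto (fun s => τ (γ s)) (𝓝[<] 0) (𝓝 0) := by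
    have := hf1.self_of_nhds.continuousAt.tendsto
    simp only [h0, h.time_zero] at this
    exact this.mono_left nhdsWithin_le_nhds
  exact F.tendsto_of_flow_line hl hΩ hε' hnpos hc0 (fun s hs => (hmem s (hall' s hs)).1)
    (fun s hs => hlt s (hall' s hs)) (fun s hs => ht s (hall' s hs))
    (h.tendsto_time ht₀ hε (fun s hs => (hγ s (hsub hs)).1) hneg hτ ht hx)
    (fun s hs => ha s (hall' s hs)) (fun s hs => hβd s (hall' s hs))
    (Real.sqrt_pos.2 (div_pos (hbpos 0 h0mem) hC)) l0 l1 l2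
    (fun s hs => ⟨hneg s (hall' s hs), (hall s ⟨hs.1, hs.2.trans hε'⟩).2⟩) lf lf1 lf2

end FRWModel

end LocalLimits

/-! ### Timelike vectors are never orthogonal -/

section Lorentz

/-- Let `e` be the distinguished timelike vector. If `v ⊥ w`, then `z = B(e,w) v - B(e,v) w` is
orthogonal to `e`, while `B(z,z) = B(e,w)² B(v,v) + B(e,v)² B(w,w)` is negative: the coefficients do
not vanish, since a timelike vector cannot be orthogonal to `e`. This contradicts positivity on the
complement of `e`. -/
theorem IsLorentzian.apply_ne_zero {V : Type} [AddCommGroup V] [Module ℝ V] {B : V →ₗ[ℝ] V →ₗ[ℝ] ℝ}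
    (h : IsLorentzian fun v w => B v w) (hsymm : ∀ v w, B v w = B w v) {v w : V} (hv : B v v < 0)
    (hw : B w w < 0) : B v w ≠ 0 := by
  intro hvw
  obtain ⟨e, -, hpos⟩ := h
  have hwv : B w v = 0 := by rw [hsymm, hvw]
  have hne : ∀ {z : V}, B z z < 0 → B e z ≠ 0 := fun {z} hz h0 => by
    have := hpos z h0 (by rintro rfl; simp at hz)
    exact absurd hz (not_lt.2 this.le)
  have hz : B (B e w • v - B e v • w) (B e w • v - B e v • w) < 0 := by
    simp only [map_sub, map_smul, LinearMap.sub_apply, LinearMap.smul_apply, smul_eq_mul, hvw, hwv]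
    nlinarith [mul_pos_of_neg_of_neg hv hv, pow_pos (abs_pos.2 (hne hw)) 2, sq_abs (B e w),
      sq_nonneg (B e v), sq_nonneg (B e w), mul_neg_of_pos_of_neg
      (by rw [← sq_abs]; exact pow_pos (abs_pos.2 (hne hw)) 2 : 0 < B e w ^ 2) hv,
      mul_nonpos_of_nonneg_of_nonpos (sq_nonneg (B e v)) hw.le]
  exact hne hz (by simp [mul_comm])

end Lorentz

/-! ### Components of metrics and vector fields in a chart -/

section LocalCoordinates

theorem isOpen_chart_preimage {N : Type} [TopologicalSpace N] [ChartedSpace Coord N] (p : N)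
    {U : Set N} (hU : IsOpen U) :
    IsOpen ((chartAt Coord p).target ∩ (chartAt Coord p).symm ⁻¹' U) :=
  (chartAt Coord p).symm.isOpen_inter_preimage hU

/-- The transition maps of the tangent bundle are differentials of chart changes, which costs one
derivative. -/
theorem contMDiffVectorBundle_tangentSpace {N : Type} [TopologicalSpace N] [ChartedSpace Coord N]
    [IsManifold 𝓘(ℝ, Coord) ∞ N] {n : WithTop ℕ∞} (hn : n + 1 ≤ ∞) :
    ContMDiffVectorBundle n Coord (TangentSpace 𝓘(ℝ, Coord) : N → Type) 𝓘(ℝ, Coord) := by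
  have : IsManifold 𝓘(ℝ, Coord) (n + 1) N := IsManifold.of_le hn
  exact TangentBundle.contMDiffVectorBundle

variable {N : Type} [TopologicalSpace N] [ChartedSpace Coord N] [IsManifold 𝓘(ℝ, Coord) ∞ N]

/-- The coordinate expression of tangent vectors at `q`, in the preferred chart at `p`. -/
noncomputable def toCoord (p q : N) : TangentSpace 𝓘(ℝ, Coord) q →L[ℝ] Coord :=
  (trivializationAt Coord (TangentSpace 𝓘(ℝ, Coord)) p).continuousLinearMapAt ℝ q

/-- The tangent vector at `q` with given components in the preferred chart at `p`. -/
noncomputable def ofCoord (p q : N) : Coord →L[ℝ] TangentSpace 𝓘(ℝ, Coord) q :=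
  (trivializationAt Coord (TangentSpace 𝓘(ℝ, Coord)) p).symmL ℝ q

theorem ofCoord_toCoord {p q : N} (hq : q ∈ (chartAt Coord p).source)
    (v : TangentSpace 𝓘(ℝ, Coord) q) : ofCoord p q (toCoord p q v) = v :=
  (trivializationAt Coord (TangentSpace 𝓘(ℝ, Coord)) p).symmL_continuousLinearMapAt hq v

theorem toCoord_ofCoord {p q : N} (hq : q ∈ (chartAt Coord p).source) (v : Coord) :
    toCoord p q (ofCoord p q v) = v :=
  (trivializationAt Coord (TangentSpace 𝓘(ℝ, Coord)) p).continuousLinearMapAt_symmL hq v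

/-- The components of a vector field in the preferred chart at `p`. -/
noncomputable def localField (Y : ∀ q : N, TangentSpace 𝓘(ℝ, Coord) q) (p : N) (x : Coord) : Coord :=
  toCoord p ((chartAt Coord p).symm x) (Y ((chartAt Coord p).symm x))

/-- The components of the metric in the preferred chart at `p`. -/
noncomputable def Spacetime.localMetric (S : Spacetime N) (p : N) (x : Coord) :
    Coord →L[ℝ] Coord →L[ℝ] ℝ :=
  let B : Coord →L[ℝ] Coord →L[ℝ] ℝ := S.metric ((chartAt Coord p).symm x)
  let A : Coord →L[ℝ] Coord := ofCoord p ((chartAt Coord p).symm x)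
  B.bilinearComp A A

theorem Spacetime.localMetric_apply (S : Spacetime N) (p : N) (x v w : Coord) :
    S.localMetric p x v w = S.metric ((chartAt Coord p).symm x)
      (ofCoord p ((chartAt Coord p).symm x) v) (ofCoord p ((chartAt Coord p).symm x) w) := rfl

theorem contDiffOn_localField {n : WithTop ℕ∞} (hn : n + 1 ≤ ∞)
    {Y : ∀ q : N, TangentSpace 𝓘(ℝ, Coord) q} {U : Set N} (hU : IsOpen U) (p : N)
    (hY : ContMDiffOn 𝓘(ℝ, Coord) (𝓘(ℝ, Coord).prod 𝓘(ℝ, Coord)) n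
      (fun q => Bundle.TotalSpace.mk' Coord (E := fun q : N => TangentSpace 𝓘(ℝ, Coord) q)
        q (Y q)) U) :
    ContDiffOn ℝ n (localField Y p)
      ((chartAt Coord p).target ∩ (chartAt Coord p).symm ⁻¹' U) := by
  have := contMDiffVectorBundle_tangentSpace (N := N) hn
  have : IsManifold 𝓘(ℝ, Coord) n N := IsManifold.of_le (le_self_add.trans hn)
  have h1 := ((trivializationAt Coord (TangentSpace 𝓘(ℝ, Coord)) p).contMDiffOn_section_iff
    (IB := 𝓘(ℝ, Coord)) (a := (chartAt Coord p).source ∩ U)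
    ((chartAt Coord p).open_source.inter hU) inter_subset_left).1 (hY.mono inter_subset_right)
  have h2 : ContMDiffOn 𝓘(ℝ, Coord) 𝓘(ℝ, Coord) n (chartAt Coord p).symm
      (chartAt Coord p).target := contMDiffOn_chart_symm
  have h3 := h1.comp (h2.mono inter_subset_left) (s := (chartAt Coord p).target ∩
    (chartAt Coord p).symm ⁻¹' U) fun x hx => ⟨(chartAt Coord p).map_target hx.1, hx.2⟩
  refine (contMDiffOn_iff_contDiffOn.1 h3).congr fun x hx => ?_
  simp only [localField, toCoord, Function.comp]
  rw [Bundle.Trivialization.continuousLinearMapAt_apply,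
    Bundle.Trivialization.linearMapAt_apply]
  exact if_pos ((chartAt Coord p).map_target hx.1)

theorem contMDiffOn_ofCoord {n : WithTop ℕ∞} (hn : n + 1 ≤ ∞) (p : N) (v : Coord) :
    ContMDiffOn 𝓘(ℝ, Coord) (𝓘(ℝ, Coord).prod 𝓘(ℝ, Coord)) n
      (fun q => Bundle.TotalSpace.mk' Coord (E := fun q : N => TangentSpace 𝓘(ℝ, Coord) q)
        q (ofCoord p q v)) (chartAt Coord p).source := by
  have := contMDiffVectorBundle_tangentSpace (N := N) hn
  have : IsManifold 𝓘(ℝ, Coord) n N := IsManifold.of_le (le_self_add.trans hn)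
  refine ((trivializationAt Coord (TangentSpace 𝓘(ℝ, Coord)) p).contMDiffOn_section_iff
    (IB := 𝓘(ℝ, Coord)) (a := (chartAt Coord p).source)
    (chartAt Coord p).open_source subset_rfl).2 ?_
  refine (contMDiffOn_const (c := v)).congr fun q hq => ?_
  have := toCoord_ofCoord hq v
  rw [toCoord, Bundle.Trivialization.continuousLinearMapAt_apply,
    Bundle.Trivialization.linearMapAt_apply] at this
  exact ((if_pos hq).symm.trans this)

/-- In finite dimensions the regularity of a bilinear form can be tested on pairs of constant
vectors, which correspond to the smooth coordinate fields of `contMDiffOn_ofCoord`. -/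
theorem Spacetime.contDiffOn_localMetric {n : WithTop ℕ∞} (hn : n + 1 ≤ ∞) (S : Spacetime N)
    {U : Set N} (p : N)
    (hS : ContMDiffOn 𝓘(ℝ, Coord) (𝓘(ℝ, Coord).prod 𝓘(ℝ, Coord →L[ℝ] Coord →L[ℝ] ℝ)) n
      (fun p => Bundle.TotalSpace.mk' (Coord →L[ℝ] Coord →L[ℝ] ℝ)
        (E := fun p : N =>
          TangentSpace 𝓘(ℝ, Coord) p →L[ℝ] TangentSpace 𝓘(ℝ, Coord) p →L[ℝ] ℝ) p (S.metric p)) U) :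
    ContDiffOn ℝ n (S.localMetric p)
      ((chartAt Coord p).target ∩ (chartAt Coord p).symm ⁻¹' U) := by
  have := contMDiffVectorBundle_tangentSpace (N := N) hn
  have : IsManifold 𝓘(ℝ, Coord) n N := IsManifold.of_le (le_self_add.trans hn)
  rw [contDiffOn_clm_apply]
  intro v
  rw [contDiffOn_clm_apply]
  intro w
  have hv := (contMDiffOn_ofCoord hn p v).mono (inter_subset_left (t := U))
  have hw := (contMDiffOn_ofCoord hn p w).mono (inter_subset_left (t := U))
  have h1 : ContMDiffOn 𝓘(ℝ, Coord) 𝓘(ℝ, ℝ) n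
      (fun q => S.metric q (ofCoord p q v) (ofCoord p q w)) ((chartAt Coord p).source ∩ U) := by
    have := ContMDiffOn.clm_bundle_apply₂ (F₁ := Coord) (F₂ := Coord) (F₃ := ℝ)
      (E₃ := fun _ : N => ℝ) (hS.mono inter_subset_right) hv hw
    intro q hq
    have := this q hq
    simp only [Bundle.contMDiffWithinAt_totalSpace] at this
    simpa using this.2
  have h2 : ContMDiffOn 𝓘(ℝ, Coord) 𝓘(ℝ, Coord) n (chartAt Coord p).symm
      (chartAt Coord p).target := contMDiffOn_chart_symm
  have h3 := h1.comp (h2.mono inter_subset_left) (s := (chartAt Coord p).target ∩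
    (chartAt Coord p).symm ⁻¹' U) fun x hx => ⟨(chartAt Coord p).map_target hx.1, hx.2⟩
  exact contMDiffOn_iff_contDiffOn.1 h3

/-- This links the trivialization of the tangent bundle with the inverse chart, so velocities and
differentials can be moved between `N` and the coordinate space. -/
theorem hasMFDerivAt_chart_symm (p : N) {x : Coord} (hx : x ∈ (chartAt Coord p).target) :
    HasMFDerivAt 𝓘(ℝ, Coord) 𝓘(ℝ, Coord) (chartAt Coord p).symm x
      (ofCoord p ((chartAt Coord p).symm x)) := by
  have : IsManifold 𝓘(ℝ, Coord) 1 N := IsManifold.of_le (n := ∞) (by simp)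
  have h1 : MDifferentiableAt 𝓘(ℝ, Coord) 𝓘(ℝ, Coord) (chartAt Coord p).symm x :=
    mdifferentiableAt_atlas_symm (chart_mem_atlas Coord p) hx
  have h2 := TangentBundle.symmL_trivializationAt (I := 𝓘(ℝ, Coord))
    ((chartAt Coord p).map_target hx)
  have h3 := h1.hasMFDerivAt
  simp only [mfld_simps, mfderivWithin_univ] at h2
  rw [(chartAt Coord p).right_inv hx] at h2
  rw [ofCoord, h2]
  exact h3

end LocalCoordinates

/-! ### From a regular Future Isotropic Universe to local data at the event -/

section Extraction

variable {N : Type} [TopologicalSpace N] [ChartedSpace Coord N] [IsManifold 𝓘(ℝ, Coord) ∞ N]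

theorem Spacetime.continuousOn_localMetric (S : Spacetime N) (p : N) :
    ContinuousOn (S.localMetric p) (chartAt Coord p).target := by
  have := (S.contDiffOn_localMetric (n := 0) (U := univ) (by simp) p
    S.metric_continuous.contMDiffOn).continuousOn
  simpa using this

theorem Spacetime.continuousOn_localOrientation (S : Spacetime N) (p : N) :
    ContinuousOn (localField S.orientation p) (chartAt Coord p).target := by
  have := (contDiffOn_localField (n := 0) (by simp) isOpen_univ p
    S.orientation_continuous.contMDiffOn).continuousOn
  simpa using this

theorem Spacetime.localMetric_toCoord (S : Spacetime N) (p : N) {x : Coord}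
    (hx : x ∈ (chartAt Coord p).target)
    (v w : TangentSpace 𝓘(ℝ, Coord) ((chartAt Coord p).symm x)) :
    S.localMetric p x (toCoord p _ v) (toCoord p _ w) =
      S.metric ((chartAt Coord p).symm x) v w := by
  have hq := (chartAt Coord p).map_target hx
  rw [S.localMetric_apply, ofCoord_toCoord hq, ofCoord_toCoord hq]

/-- Curves in a chart whose velocity is close to a future-directed timelike vector are future-directed
causal curves. -/
theorem Spacetime.exists_strictMonoOn (S : Spacetime N) {T : N → ℝ} (hT : S.IsCosmicTime T) (p : N)
    {v₀ : Coord} (h1 : S.localMetric p (chartAt Coord p p) v₀ v₀ < 0)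
    (h2 : S.localMetric p (chartAt Coord p p) v₀
      (localField S.orientation p (chartAt Coord p p)) < 0) :
    ∃ δ > 0, ∃ η > 0, ∀ (γ : ℝ → Coord) (α β : ℝ), α < β →
    ContDiffOn ℝ 1 γ (Icc α β) → (∀ s ∈ Icc α β, γ s ∈ Metric.ball (chartAt Coord p p) η ∧
      derivWithin γ (Icc α β) s ∈ Metric.ball v₀ δ) →
      StrictMonoOn ((fun x => T ((chartAt Coord p).symm x)) ∘ γ) (Icc α β) := by
  set e := chartAt Coord p with he
  have hx₀ : e p ∈ e.target := e.map_source (mem_chart_source Coord p)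
  have hnhds : e.target ∈ 𝓝 (e p) := e.open_target.mem_nhds hx₀
  have hG : ContinuousAt (fun y : Coord × Coord => S.localMetric p y.1) (e p, v₀) :=
    ContinuousAt.comp (f := Prod.fst) (x := (e p, v₀))
      ((S.continuousOn_localMetric p).continuousAt hnhds) continuousAt_fst
  have hO : ContinuousAt (fun y : Coord × Coord => localField S.orientation p y.1) (e p, v₀) :=
    ContinuousAt.comp (f := Prod.fst) (x := (e p, v₀))
      ((S.continuousOn_localOrientation p).continuousAt hnhds) continuousAt_fst
  have hv : ContinuousAt (fun y : Coord × Coord => y.2) (e p, v₀) := continuousAt_snd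
  -- Being timelike and future-directed are open conditions on the pair (point, velocity), as the
  -- metric and the orientation are continuous.
  have ev1 := ((hG.clm_apply hv).clm_apply hv).tendsto.eventually (gt_mem_nhds h1)
  have ev2 := ((hG.clm_apply hv).clm_apply hO).tendsto.eventually (gt_mem_nhds h2)
  have ev3 : ∀ᶠ y : Coord × Coord in 𝓝 (e p, v₀), y.1 ∈ e.target :=
    (continuousAt_fst (p := (e p, v₀))).eventually_mem hnhds
  have hall := (ev1.and (ev2.and ev3))
  rw [nhds_prod_eq, eventually_prod_iff] at hall
  obtain ⟨p1, hp1, p2, hp2, hp⟩ := hall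
  obtain ⟨η, hη, hη'⟩ := Metric.eventually_nhds_iff_ball.1 hp1
  obtain ⟨δ, hδ, hδ'⟩ := Metric.eventually_nhds_iff_ball.1 hp2
  refine ⟨δ, hδ, η, hη, fun γ α β hαβ hγ hs => ?_⟩
  have hgood : ∀ s ∈ Icc α β, _ := fun s hs' => hp (hη' _ (hs s hs').1) (hδ' _ (hs s hs').2)
  have h3 : ContMDiffOn 𝓘(ℝ, Coord) 𝓘(ℝ, Coord) 1 e.symm e.target :=
    (contMDiffOn_chart_symm (n := ∞)).of_le (by simp)
  refine hT (e.symm ∘ γ) α β hαβ ⟨h3.comp (contMDiffOn_iff_contDiffOn.2 hγ) fun s hs' =>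
    (hgood s hs').2.2, fun s hs' => ?_⟩
  obtain ⟨g1, g2, g3⟩ := hgood s hs'
  have hd : HasMFDerivWithinAt 𝓘(ℝ, ℝ) 𝓘(ℝ, Coord) γ (Icc α β) s
      (ContinuousLinearMap.toSpanSingleton ℝ (derivWithin γ (Icc α β) s)) :=
    (((hγ.differentiableOn (by simp)) s hs').hasDerivWithinAt).hasFDerivWithinAt.hasMFDerivWithinAt
  have hd2 := (hasMFDerivAt_chart_symm p g3).comp_hasMFDerivWithinAt s hd
  have hu : UniqueMDiffWithinAt 𝓘(ℝ, ℝ) (Icc α β) s :=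
    (uniqueDiffOn_Icc hαβ s hs').uniqueMDiffWithinAt
  have hder : mfderivWithin 𝓘(ℝ, ℝ) 𝓘(ℝ, Coord) (e.symm ∘ γ) (Icc α β) s (1 : ℝ) =
      ofCoord p (e.symm (γ s)) (derivWithin γ (Icc α β) s) := by
    rw [hd2.mfderivWithin hu]
    change ofCoord p (e.symm (γ s)) ((1 : ℝ) • derivWithin γ (Icc α β) s) = _
    rw [one_smul]
  have hq := e.map_target g3
  refine hder ▸ ⟨?_, g1.le, ?_⟩
  · intro h0
    rw [S.localMetric_apply, h0] at g1
    simp at g1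
  · change S.localMetric p (γ s) (derivWithin γ (Icc α β) s)
      (localField S.orientation p (γ s)) < 0 at g2
    rw [S.localMetric_apply, localField, ofCoord_toCoord hq] at g2
    exact g2

variable {D : Set Coord} {g : Coord → Coord → Coord → ℝ} {u : Coord → Coord} {S : Spacetime N}
  {T : N → ℝ} {Ω : ℝ → ℝ} {φ : OpenPartialHomeomorph N Coord}

/-- The flow is future-directed at the event. -/
theorem IsConformalExtension.flow_future (h : IsConformalExtension D g u S T Ω {p | T p < 0} φ)
    {ubar : ∀ p : N, TangentSpace 𝓘(ℝ, Coord) p} (hunit : ∀ p, S.metric p (ubar p) (ubar p) = -1)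
    (hu : ∀ p ∈ {p | T p < 0},
      mfderiv 𝓘(ℝ, Coord) 𝓘(ℝ, Coord) φ p (ubar p) = Ω (T p) • u (φ p))
    {V : Set N} (hV : IsOpen V) (hC : VectorFieldC2On ubar V) {p : N} (hp : T p = 0) (hpV : p ∈ V) :
    S.metric p (ubar p) (S.orientation p) < 0 := by
  set e := chartAt Coord p with he
  have hx₀ : e p ∈ e.target := e.map_source (mem_chart_source Coord p)
  have hnhds : e.target ∈ 𝓝 (e p) := e.open_target.mem_nhds hx₀
  have hep : e.symm (e p) = p := e.left_inv (mem_chart_source Coord p)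
  have hO0 : S.localMetric p (e p) (localField S.orientation p (e p))
      (localField S.orientation p (e p)) < 0 := by
    rw [localField, S.localMetric_toCoord p hx₀]
    exact S.orientation_timelike _
  -- The coordinate line in the direction of the time orientation itself enters `{T < 0}` towards
  -- the past of `p`. The orientation of the flow is known there and can be carried to `p` by
  -- continuity.
  obtain ⟨δ, hδ, η, hη, hmono⟩ := S.exists_strictMonoOn h.cosmicTime p hO0 hO0
  set O := localField S.orientation p (e p) with hOdef
  have hder : ∀ s : ℝ, HasDerivAt (fun s : ℝ => e p + s • O) O s := fun s => by
    simpa using ((hasDerivAt_id s).smul_const O).const_add (e p)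
  have hlim : Tendsto (fun s : ℝ => e p + s • O) (𝓝 0) (𝓝 (e p)) := by
    simpa using (hder 0).continuousAt.tendsto
  obtain ⟨ε, hε, hball⟩ := Metric.eventually_nhds_iff_ball.1
    (hlim.eventually_mem (Metric.ball_mem_nhds _ hη))
  rw [Real.ball_eq_Ioo, zero_sub, zero_add] at hball
  have hneg : ∀ s ∈ Ioo (-ε) 0, T (e.symm (e p + s • O)) < 0 := by
    intro s hs
    have := hmono (fun s => e p + s • O) s 0 hs.2 (by fun_prop) fun r hr =>
      ⟨hball r ⟨hs.1.trans_le hr.1, hr.2.trans_lt hε⟩, by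
        rw [(hder r).hasDerivWithinAt.derivWithin (uniqueDiffOn_Icc hs.2 r hr)]
        exact Metric.mem_ball_self hδ⟩
    have := this (left_mem_Icc.2 hs.2.le) (right_mem_Icc.2 hs.2.le) hs.2
    simp only [Function.comp, zero_smul, add_zero] at this
    rwa [← he, hep, hp] at this
  have hX : ContinuousAt (localField ubar p) (e p) :=
    (contDiffOn_localField (n := 2) (by exact WithTop.coe_le_coe.2 (le_top : (3 : ℕ∞) ≤ ⊤))
      hV p hC).continuousOn.continuousAt
      ((isOpen_chart_preimage p hV).mem_nhds ⟨hx₀, show e.symm (e p) ∈ V by rwa [hep]⟩)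
  have hG := (S.continuousOn_localMetric p).continuousAt hnhds
  have hOc := (S.continuousOn_localOrientation p).continuousAt hnhds
  have hlim2 := ((hG.clm_apply hX).clm_apply hOc).tendsto.comp
    (hlim.mono_left (nhdsWithin_le_nhds (s := Iio 0)))
  have key : ∀ᶠ s : ℝ in 𝓝[<] 0, S.localMetric p (e p + s • O) (localField ubar p (e p + s • O))
      (localField S.orientation p (e p + s • O)) ≤ 0 := by
    filter_upwards [Ioo_mem_nhdsLT (neg_lt_zero.2 hε),
      (hlim.mono_left nhdsWithin_le_nhds).eventually_mem hnhds] with s hs hs'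
    rw [localField, localField, S.localMetric_toCoord p hs']
    have hM := hneg s hs
    have hpos := h.factor_pos _ hM
    have := h.orientation_compat _ hM ((Ω (T (e.symm (e p + s • O))))⁻¹ • ubar _) (by
      rw [map_smul, hu _ hM]
      exact inv_smul_smul₀ hpos.ne' (u (φ (e.symm (e p + s • O)))))
    rw [map_smul, smul_apply, smul_eq_mul] at this
    exact (pos_iff_neg_of_mul_neg this).1 (inv_pos.2 hpos) |>.le
  have hle : S.metric (e.symm (e p)) (ubar _) (S.orientation _) ≤ 0 := by
    have := le_of_tendsto hlim2 key
    rwa [localField, localField, S.localMetric_toCoord p hx₀] at this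
  rw [hep] at hle
  -- The limit only gives `≤`; equality is impossible because two timelike vectors are not
  -- orthogonal.
  refine lt_of_le_of_ne hle ?_
  let B : TangentSpace 𝓘(ℝ, Coord) p →ₗ[ℝ] TangentSpace 𝓘(ℝ, Coord) p →ₗ[ℝ] ℝ :=
    LinearMap.mk₂ ℝ (fun v w => S.metric p v w) (by simp) (by simp) (by simp) (by simp)
  exact IsLorentzian.apply_ne_zero (B := B) (S.metric_lorentzian p) (S.metric_symm p)
    (show S.metric p _ _ < 0 by rw [hunit p]; norm_num) (S.orientation_timelike p)

/-- The orthogonal complement of the distinguished timelike vector is the kernel of a functional on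
a four-dimensional space, hence non-trivial, and the metric is positive there. -/
theorem Spacetime.exists_spacelike (S : Spacetime N) (p : N) :
    ∃ w, 0 < S.metric p w w := by
  obtain ⟨v, -, hv⟩ := S.metric_lorentzian p
  have : LinearMap.ker (S.metric p v).toLinearMap ≠ ⊥ := by
    have : FiniteDimensional ℝ (TangentSpace 𝓘(ℝ, Coord) p) :=
      inferInstanceAs (FiniteDimensional ℝ Coord)
    have hfin : Module.finrank ℝ ℝ < Module.finrank ℝ Coord := by simp
    exact LinearMap.ker_ne_bot_of_finrank_lt hfin
  obtain ⟨w, hw, hw0⟩ := (Submodule.ne_bot_iff _).1 this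
  exact ⟨w, hv w hw hw0⟩

/-- An FRW model with a regular Future Isotropic Universe, in local coordinates at the event. -/
theorem IsConformalExtension.exists_localEvent {F : FRWModel}
    (h : IsConformalExtension F.domain F.metric F.flow S T Ω {p | T p < 0} φ)
    (hreg : IsFlowRegular F.flow S T Ω {p | T p < 0} φ) :
    ∃ W x₀ τ ψ G X θ, FRWModel.LocalEvent F Ω W x₀ τ ψ G X θ := by
  obtain ⟨ubar, hunit, hu, V, hV, hV0, hC⟩ := hreg
  obtain ⟨p, hp⟩ := h.event_nonempty
  obtain ⟨U, hU, hU0, hS⟩ := h.metric_regular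
  have hfut := h.flow_future hunit hu hV hC hp (hV0 hp)
  set e := chartAt Coord p with he
  have hx₀ : e p ∈ e.target := e.map_source (mem_chart_source Coord p)
  have hep : e.symm (e p) = p := e.left_inv (mem_chart_source Coord p)
  have h3 : (2 : WithTop ℕ∞) + 1 ≤ ∞ := WithTop.coe_le_coe.2 (le_top : (3 : ℕ∞) ≤ ⊤)
  have hopen : IsOpen (e.target ∩ e.symm ⁻¹' (U ∩ V)) := isOpen_chart_preimage p (hU.inter hV)
  have hunit' : ∀ x ∈ e.target,
      S.localMetric p x (localField ubar p x) (localField ubar p x) = -1 := fun x hx => by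
    rw [localField, S.localMetric_toCoord p hx, hunit]
  have hcs : ContMDiffOn 𝓘(ℝ, Coord) 𝓘(ℝ, Coord) ∞ e.symm e.target := contMDiffOn_chart_symm
  have : IsManifold 𝓘(ℝ, Coord) 1 N := IsManifold.of_le (n := ∞) (by simp)
  have hφ : ∀ q, T q < 0 → MDifferentiableAt 𝓘(ℝ, Coord) 𝓘(ℝ, Coord) φ q := fun q hq =>
    mdifferentiableAt_of_mem_maximalAtlas
      (IsManifold.maximalAtlas_subset_of_le (by simp) h.chart_mem) (h.chart_source ▸ hq)
  have hψ : ∀ x ∈ e.target, T (e.symm x) < 0 → ∀ v,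
      fderiv ℝ (φ ∘ e.symm) x v =
        mfderiv 𝓘(ℝ, Coord) 𝓘(ℝ, Coord) φ (e.symm x) (ofCoord p (e.symm x) v) := by
    intro x hx hT v
    have := (hφ _ hT).hasMFDerivAt.comp x (hasMFDerivAt_chart_symm p hx)
    rw [← mfderiv_eq_fderiv, this.mfderiv]
    rfl
  refine ⟨e.target ∩ e.symm ⁻¹' (U ∩ V), e p, fun x => T (e.symm x), φ ∘ e.symm,
    S.localMetric p, localField ubar p, fun z => T (φ.symm z), ?_⟩
  constructor
  · exact hopen
  · exact ⟨hx₀, by simpa [hep] using ⟨hU0 hp, hV0 hp⟩⟩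
  · exact contMDiffOn_iff_contDiffOn.1
      (h.time_smooth.comp_contMDiffOn (hcs.mono inter_subset_left))
  · rw [hep]; exact hp
  · exact (S.contDiffOn_localMetric h3 p hS).mono fun x hx => ⟨hx.1, hx.2.1⟩
  · exact (contDiffOn_localField h3 hV p hC).mono fun x hx => ⟨hx.1, hx.2.2⟩
  · refine contMDiffOn_iff_contDiffOn.1 ((contMDiffOn_of_mem_maximalAtlas h.chart_mem).comp
      (hcs.mono (inter_subset_left.trans inter_subset_left)) fun x hx => ?_)
    rw [mem_preimage, h.chart_source]
    exact hx.2
  · intro x hx hT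
    rw [← h.chart_target]
    exact φ.map_source (h.chart_source ▸ hT)
  · exact fun x hx hT => h.factor_pos _ hT
  · intro x hx hT v w
    rw [hψ x hx.1 hT, hψ x hx.1 hT, S.localMetric_apply]
    exact h.conformal _ hT _ _
  · intro x hx hT
    rw [hψ x hx.1 hT, localField, ofCoord_toCoord (e.map_target hx.1)]
    exact hu _ hT
  -- For spacelike `w` the spatial length `G(w,w) + G(X,w)²` is positive whatever the flow is.
  · obtain ⟨w, hw⟩ := S.exists_spacelike (e.symm (e p))
    refine ⟨toCoord p _ w, ?_⟩
    rw [S.localMetric_toCoord p hx₀]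
    positivity
  · refine S.exists_strictMonoOn h.cosmicTime p (by rw [hunit' _ hx₀]; norm_num) ?_
    rw [localField, localField, S.localMetric_toCoord p hx₀]
    rw [← hep] at hfut
    exact hfut
  · have := φ.continuousOn_symm
    rw [h.chart_target] at this
    exact h.time_smooth.continuous.comp_continuousOn this
  · intro z hz
    have : φ.symm z ∈ φ.source := φ.map_target (h.chart_target ▸ hz)
    rw [h.chart_source] at this
    exact this
  · intro x hx hT
    simp only [Function.comp]
    rw [φ.left_inv (h.chart_source ▸ hT)]

/-- The necessary condition for a regular Future Isotropic Universe. -/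
theorem FRWModel.tendsto_of_admitsRegularFIU (F : FRWModel) {t₀ : ℝ} (ht₀ : IsLUB F.dom t₀)
    {lam : EReal} (h1 : 1 < lam) (h2 : lam < ⊤)
    (h : AdmitsRegularFIU F.domain F.metric F.flow lam) :
    (∃ q : ℝ, 0 < q ∧ Tendsto F.accelRatio (𝓝[<] t₀) (𝓝 q)) ∧
      Tendsto F.scale (𝓝[<] t₀) atTop := by
  obtain ⟨N, _, _, _, -, -, -, S, T, Ω, φ, hext, hΩ, hreg⟩ := h
  obtain ⟨W, x₀, τ, ψ, G, X, θ, hloc⟩ := hext.exists_localEvent hreg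
  lift lam to ℝ using ⟨h2.ne, (bot_lt_iff_ne_bot.1 (bot_le.trans_lt h1))⟩
  exact hloc.tendsto_scale ht₀ (by exact_mod_cast h1) hΩ

end Extraction

/-! ### Smooth approximation of a `C²` function with prescribed decay of the error -/

section Smoothing

/-- A continuous function which decays exponentially, with a decreasing further factor, has a
primitive with the same bound. -/
theorem exists_primitive_le {e M : ℝ → ℝ} (he : Continuous e) (hM : Monotone M) (h0 : ∀ x, 0 ≤ M x)
    (hle : ∀ x, |e x| ≤ Real.exp (-x) / (1 + M x)) :
    ∃ r : ℝ → ℝ, ∀ x, HasDerivAt r (e x) x ∧ |r x| ≤ Real.exp (-x) / (1 + M x) := by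
  have hint : MeasureTheory.IntegrableOn e (Ioi 0) := by
    refine MeasureTheory.Integrable.mono' (exp_neg_integrableOn_Ioi 0 one_pos)
      he.aestronglyMeasurable (Eventually.of_forall fun x => ?_)
    rw [Real.norm_eq_abs, neg_one_mul]
    refine (hle x).trans (div_le_self (Real.exp_pos _).le ?_)
    linarith [h0 x]
  have hlim := MeasureTheory.intervalIntegral_tendsto_integral_Ioi 0 hint tendsto_id
  set ℓ := ∫ x in Ioi (0 : ℝ), e x
  have hder : ∀ x, HasDerivAt (fun x => (∫ u in (0 : ℝ)..x, e u) - ℓ) (e x) x := fun x =>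
    (intervalIntegral.integral_hasDerivAt_right (he.intervalIntegrable _ _)
      he.stronglyMeasurable.stronglyMeasurableAtFilter he.continuousAt).sub_const _
  -- The primitive that vanishes at infinity, minus the integral of `e` over `(x, ∞)`. As `1 / (1 +
  -- M)` decreases it can be frozen at `x`, and the integral of `exp (-u)` over `(x, ∞)` reproduces
  -- `exp (-x)`; the bound can therefore be iterated.
  refine ⟨fun x => (∫ u in (0 : ℝ)..x, e u) - ℓ, fun x => ⟨hder x, ?_⟩⟩
  have hl2 : Tendsto (fun y => |(∫ u in (0 : ℝ)..x, e u) - ∫ u in (0 : ℝ)..y, e u|) atTop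
      (𝓝 |(∫ u in (0 : ℝ)..x, e u) - ℓ|) := (hlim.const_sub _).abs
  refine le_of_tendsto hl2 ?_
  filter_upwards [eventually_ge_atTop x] with y hy
  have hpos : 0 < 1 + M x := by linarith [h0 x]
  rw [abs_sub_comm, intervalIntegral.integral_interval_sub_left (he.intervalIntegrable _ _)
    (he.intervalIntegrable _ _)]
  have hi : IntervalIntegrable (fun u => Real.exp (-u) / (1 + M x)) MeasureTheory.volume x y :=
    Continuous.intervalIntegrable (by fun_prop) _ _
  have h1 : |∫ u in x..y, e u| ≤ ∫ u in x..y, Real.exp (-u) / (1 + M x) := by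
    rw [← Real.norm_eq_abs]
    refine intervalIntegral.norm_integral_le_of_norm_le (f := e) hy
      (Eventually.of_forall fun u hu => ?_) hi
    refine (hle u).trans ?_
    have := hM hu.1.le
    gcongr
  refine h1.trans ?_
  rw [intervalIntegral.integral_div]
  gcongr
  rw [intervalIntegral.integral_comp_neg (fun u => Real.exp u), integral_exp]
  linarith [Real.exp_pos (-y)]

/-- Whitney's approximation theorem on the line: a `C²` function differs from a smooth one by a
function which decays quickly at infinity, with its first two derivatives. -/
theorem exists_smooth_approx {p K : ℝ → ℝ} (hp : ContDiff ℝ 2 p) (hK : Continuous K) :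
    ∃ r r₁ r₂ : ℝ → ℝ, ContDiff ℝ ∞ (fun x => p x + r x) ∧ (∀ x, HasDerivAt r (r₁ x) x) ∧
      (∀ x, HasDerivAt r₁ (r₂ x) x) ∧ Continuous r₂ ∧ Tendsto (fun x => K x * r x) atTop (𝓝 0) ∧
      Tendsto (fun x => K x * r₁ x) atTop (𝓝 0) ∧ Tendsto (fun x => K x * r₂ x) atTop (𝓝 0) := by
  -- A monotone majorant of `|K|` on the half line `x ≥ 0`. For `x < 0` the interval is empty and
  -- `sSup ∅ = 0`, which keeps `M` monotone and non-negative.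
  set M : ℝ → ℝ := fun x => sSup ((fun y => |K y|) '' Icc 0 x) with hMdef
  have hbdd : ∀ x, BddAbove ((fun y => |K y|) '' Icc 0 x) := fun x =>
    (isCompact_Icc.image hK.abs).bddAbove
  have hM0 : ∀ x, 0 ≤ M x := fun x => Real.sSup_nonneg (by rintro _ ⟨y, -, rfl⟩; positivity)
  have hM : Monotone M := by
    intro x y hxy
    rcases lt_or_ge x 0 with hx | hx
    · simpa [hMdef, Icc_eq_empty (not_le.2 hx)] using hM0 y
    · exact csSup_le_csSup (hbdd y) ((nonempty_Icc.2 hx).image _)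
        (image_mono (Icc_subset_Icc_right hxy))
  have hKM : ∀ x, 0 ≤ x → |K x| ≤ M x := fun x hx =>
    le_csSup (hbdd x) (mem_image_of_mem _ (right_mem_Icc.2 hx))
  have hanti : ∀ x y, x ≤ y → Real.exp (-y) / (1 + M y) ≤ Real.exp (-x) / (1 + M x) := by
    intro x y hxy
    have := hM hxy
    have := hM0 x
    gcongr
  have hp1 : ContDiff ℝ 1 (deriv p) := ((contDiff_succ_iff_deriv (n := 1)).1 hp).2.2
  have hp2 : Continuous (deriv (deriv p)) :=
    ((contDiff_succ_iff_deriv (n := 0)).1 hp1).2.2.continuous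
  have hε : ∀ x, 0 < Real.exp (-x) / (1 + M x) := fun x =>
    div_pos (Real.exp_pos _) (by linarith [hM0 x])
  -- The second derivative is approximated by a smooth `w`, using a partition of unity; integrating
  -- the error twice from infinity gives `r₁` and `r`.
  obtain ⟨w, hw⟩ := exists_contMDiffMap_forall_mem_convex_of_local_const (n := (⊤ : ℕ∞)) 𝓘(ℝ, ℝ)
    (t := fun x => Metric.closedBall (deriv (deriv p) x) (Real.exp (-x) / (1 + M x)))
    (fun x => convex_closedBall _ _) fun x => by
      refine ⟨deriv (deriv p) x, ?_⟩
      -- The tolerance is decreasing, so its value at `x + 1` is a valid lower bound for it at all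
      -- `y < x + 1`; its continuity is not needed.
      have h1 : ∀ᶠ y in 𝓝 x, deriv (deriv p) y ∈ Metric.ball (deriv (deriv p) x)
          (Real.exp (-(x + 1)) / (1 + M (x + 1))) :=
        hp2.continuousAt.eventually_mem (Metric.ball_mem_nhds _ (hε _))
      filter_upwards [h1, gt_mem_nhds (lt_add_one x)] with y hy hy'
      rw [Metric.mem_closedBall, dist_comm]
      exact (Metric.mem_ball.1 hy).le.trans (hanti _ _ hy'.le)
  have hwc : ContDiff ℝ ∞ w := contMDiff_iff_contDiff.1 w.contMDiff
  have he : Continuous fun x => w x - deriv (deriv p) x := hwc.continuous.sub hp2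
  have hle : ∀ x, |w x - deriv (deriv p) x| ≤ Real.exp (-x) / (1 + M x) := fun x => by
    simpa [Real.dist_eq] using hw x
  obtain ⟨r₁, hr₁⟩ := exists_primitive_le he hM hM0 hle
  have hr₁c : Continuous r₁ := continuous_iff_continuousAt.2 fun x => (hr₁ x).1.continuousAt
  obtain ⟨r, hr⟩ := exists_primitive_le hr₁c hM hM0 fun x => (hr₁ x).2
  have hdecay : ∀ {f : ℝ → ℝ}, (∀ x, |f x| ≤ Real.exp (-x) / (1 + M x)) →
      Tendsto (fun x => K x * f x) atTop (𝓝 0) := by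
    intro f hf
    refine squeeze_zero_norm' ?_ (Real.tendsto_exp_neg_atTop_nhds_zero)
    filter_upwards [eventually_ge_atTop 0] with x hx
    have hpos : 0 < 1 + M x := by linarith [hM0 x]
    rw [norm_mul, Real.norm_eq_abs, Real.norm_eq_abs]
    calc |K x| * |f x| ≤ (1 + M x) * (Real.exp (-x) / (1 + M x)) := by
          gcongr
          · linarith [hKM x hx]
          · exact hf x
      _ = _ := mul_div_cancel₀ _ hpos.ne'
  refine ⟨r, r₁, fun x => w x - deriv (deriv p) x, ?_, fun x => (hr x).1, fun x => (hr₁ x).1, he,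
    hdecay fun x => (hr x).2, hdecay fun x => (hr₁ x).2, hdecay hle⟩
  have d0 : ∀ x, HasDerivAt (fun x => p x + r x) (deriv p x + r₁ x) x := fun x =>
    ((hp.differentiable (by simp)) x).hasDerivAt.add (hr x).1
  have d1 : ∀ x, HasDerivAt (fun x => deriv p x + r₁ x) (w x) x := fun x => by
    refine (((hp1.differentiable (by simp)) x).hasDerivAt.add (hr₁ x).1).congr_deriv ?_
    ring
  rw [contDiff_infty_iff_deriv]
  refine ⟨fun x => (d0 x).differentiableAt, ?_⟩
  rw [show deriv (fun x => p x + r x) = fun x => deriv p x + r₁ x from funext fun x => (d0 x).deriv,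
    contDiff_infty_iff_deriv]
  refine ⟨fun x => (d1 x).differentiableAt, ?_⟩
  rwa [show deriv (fun x => deriv p x + r₁ x) = w from funext fun x => (d1 x).deriv]

end Smoothing

/-! ### Smooth parametrizations of intervals, and `C²` extension by a constant -/

section SmoothTime

/-- A smooth function on the line with positive derivative is a diffeomorphism onto its range. -/
theorem exists_openPartialHomeomorph_of_deriv_pos {f : ℝ → ℝ} {U : Set ℝ} (hf : ContDiff ℝ ∞ f)
    (hpos : ∀ x, 0 < deriv f x) (hr : range f = U) (hU : IsOpen U) (hc : U.OrdConnected) :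
    ∃ e : OpenPartialHomeomorph ℝ ℝ, e.source = univ ∧ e.target = U ∧ (∀ x, e x = f x) ∧
      (∀ y ∈ U, HasDerivAt e.symm (deriv f (e.symm y))⁻¹ y) ∧ ContDiffOn ℝ ∞ e.symm U := by
  subst hr
  have hmono : StrictMono f := strictMono_of_deriv_pos hpos
  have hemb : IsOpenEmbedding f := ⟨hmono.isEmbedding_of_ordConnected hc, hU⟩
  have hder : ∀ x, HasDerivAt f (deriv f x) x := fun x =>
    (hf.differentiable (by simp) x).hasDerivAt
  refine ⟨hemb.toOpenPartialHomeomorph f, by simp, by simp, fun x => by simp, fun y hy => ?_,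
    fun y hy => ?_⟩
  · exact (hemb.toOpenPartialHomeomorph f).hasDerivAt_symm (by simpa using hy) (hpos _).ne' (hder _)
  · exact ((hemb.toOpenPartialHomeomorph f).contDiffAt_symm_deriv (hpos _).ne' (by simpa using hy)
      (hder _) hf.contDiffAt).contDiffWithinAt

/-- A smooth parametrization of an open interval bounded above. -/
theorem exists_smooth_parametrization {U : Set ℝ} (hU : IsOpen U) (hc : U.OrdConnected)
    (hne : U.Nonempty) {t₀ : ℝ} (ht₀ : IsLUB U t₀) :
    ∃ θ : ℝ → ℝ, ContDiff ℝ ∞ θ ∧ (∀ x, 0 < deriv θ x) ∧ range θ = U ∧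
      Tendsto θ atTop (𝓝 t₀) := by
  have hlt : ∀ t ∈ U, t < t₀ := fun t ht => by
    refine lt_of_le_of_ne (ht₀.1 ht) ?_
    rintro rfl
    obtain ⟨y, hy, hyU⟩ := (hU.mem_nhds ht |> fun h => (mem_nhds_iff_exists_Ioo_subset.1 h)).imp
      fun l ⟨u, h, hs⟩ => (show l < t ∧ ∃ y ∈ U, t < y from ⟨h.1, by
        obtain ⟨y, hy⟩ := exists_between h.2
        exact ⟨y, hs ⟨h.1.trans hy.1, hy.2⟩, hy.1⟩⟩)
    obtain ⟨y, hy, h⟩ := hyU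
    exact (ht₀.1 hy).not_gt h
  have hmem : ∀ {t}, (∃ y ∈ U, y ≤ t) → t < t₀ → t ∈ U := by
    rintro t ⟨y, hy, hyt⟩ ht
    obtain ⟨z, hz, htz, -⟩ := ht₀.exists_between ht
    exact hc.out hy hz ⟨hyt, htz.le⟩
  by_cases hb : BddBelow U
  · have hα : IsGLB U (sInf U) := isGLB_csInf hne hb
    set α := sInf U
    have hgt : ∀ t ∈ U, α < t := fun t ht => by
      refine lt_of_le_of_ne (hα.1 ht) ?_
      intro hh
      obtain ⟨l, u, h, hs⟩ := mem_nhds_iff_exists_Ioo_subset.1 (hU.mem_nhds ht)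
      obtain ⟨y, hy⟩ := exists_between h.1
      exact (hα.1 (hs ⟨hy.1, hy.2.trans h.2⟩)).not_gt (hh ▸ hy.2)
    obtain ⟨t₁, ht₁⟩ := hne
    have hαt : 0 < t₀ - α := by linarith [hgt _ ht₁, hlt _ ht₁]
    -- A rescaled logistic function maps the line onto `(α, t₀)`. In the case unbounded below, `t₀ -
    -- exp (-x)` is used instead.
    have hd : ∀ x, HasDerivAt (fun x => t₀ - (t₀ - α) / (1 + Real.exp x))
        ((t₀ - α) * Real.exp x / (1 + Real.exp x) ^ 2) x := fun x => by
      have h1 : (1 + Real.exp x) ≠ 0 := by positivity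
      refine (((((Real.hasDerivAt_exp x).const_add 1).fun_inv h1).const_mul
        (t₀ - α)).const_sub t₀).congr_deriv ?_
      field_simp
    refine ⟨fun x => t₀ - (t₀ - α) / (1 + Real.exp x), ?_, fun x => ?_, ?_, ?_⟩
    · refine contDiff_const.sub (contDiff_const.div (contDiff_const.add Real.contDiff_exp) fun x => ?_)
      positivity
    · rw [(hd x).deriv]
      positivity
    · ext t
      constructor
      · rintro ⟨x, rfl⟩
        have he := Real.exp_pos x
        have h2 : (t₀ - α) / (1 + Real.exp x) < t₀ - α := div_lt_self hαt (by linarith)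
        have h3 : 0 < (t₀ - α) / (1 + Real.exp x) := by positivity
        refine hmem ?_ (by simpa using h3)
        obtain ⟨y, hy, -, hy2⟩ := hα.exists_between
          (show α < t₀ - (t₀ - α) / (1 + Real.exp x) by linarith)
        exact ⟨y, hy, hy2.le⟩
      · intro ht
        have h1 := hgt t ht
        have h2 := hlt t ht
        refine ⟨Real.log ((t - α) / (t₀ - t)), ?_⟩
        have h3 : 0 < t₀ - t := by linarith
        simp only
        rw [Real.exp_log (div_pos (by linarith) h3)]
        field_simp
        rw [show t₀ - t + (t - α) = t₀ - α by ring]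
        field_simp
        ring
    · have : Tendsto (fun x => (t₀ - α) / (1 + Real.exp x)) atTop (𝓝 0) :=
        tendsto_const_nhds.div_atTop (tendsto_atTop_add_const_left _ _ Real.tendsto_exp_atTop)
      simpa using this.const_sub t₀
  · have hd : ∀ x, HasDerivAt (fun x => t₀ - Real.exp (-x)) (Real.exp (-x)) x := fun x => by
      refine (((hasDerivAt_neg x).exp).const_sub t₀).congr_deriv ?_
      ring
    refine ⟨fun x => t₀ - Real.exp (-x), ?_, fun x => ?_, ?_, ?_⟩
    · exact contDiff_const.sub (Real.contDiff_exp.comp contDiff_neg)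
    · rw [(hd x).deriv]
      positivity
    · ext t
      constructor
      · rintro ⟨x, rfl⟩
        have he := Real.exp_pos (-x)
        refine hmem ?_ (by simpa using he)
        obtain ⟨y, hy, hy2⟩ := not_bddBelow_iff.1 hb (t₀ - Real.exp (-x))
        exact ⟨y, hy, hy2.le⟩
      · intro ht
        refine ⟨-Real.log (t₀ - t), ?_⟩
        simp only [neg_neg]
        rw [Real.exp_log (by linarith [hlt t ht])]
        ring
    · simpa using Real.tendsto_exp_neg_atTop_nhds_zero.const_sub t₀

/-- A positive `C²` function is closely approximated at infinity by a positive smooth function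
which is constant near minus infinity. -/
theorem exists_smooth_pos_approx {p K : ℝ → ℝ} (hp : ContDiff ℝ 2 p) (hp0 : ∀ x, 0 < p x)
    (hK : Continuous K) (hpK : ∀ x, (p x)⁻¹ ≤ |K x|) :
    ∃ q : ℝ → ℝ, ContDiff ℝ ∞ q ∧ (∀ x, 0 < q x) ∧ (∃ x₀, ∀ x ≤ x₀, q x = 1) ∧
      Tendsto (fun x => K x * (q x - p x)) atTop (𝓝 0) ∧
      Tendsto (fun x => K x * deriv (fun x => q x - p x) x) atTop (𝓝 0) ∧
      Tendsto (fun x => K x * deriv (deriv fun x => q x - p x) x) atTop (𝓝 0) := by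
  obtain ⟨r, r₁, r₂, hpr, hr, hr₁, -, l0, l1, l2⟩ := exists_smooth_approx hp hK
  -- Since `1 / p ≤ |K|` and `K r → 0`, eventually `|r| < p`.
  have hev : ∀ᶠ x in atTop, 0 < p x + r x := by
    filter_upwards [l0.norm.eventually_lt_const (by simpa using one_pos)] with x hx
    rw [norm_mul, Real.norm_eq_abs, Real.norm_eq_abs] at hx
    have h1 : (p x)⁻¹ * |r x| < 1 := (mul_le_mul_of_nonneg_right (hpK x) (abs_nonneg _)).trans_lt hx
    rw [inv_mul_lt_iff₀ (hp0 x), mul_one] at h1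
    linarith [neg_abs_le (r x)]
  obtain ⟨x₁, hx₁⟩ := eventually_atTop.1 hev
  -- Interpolation between the constant `1` for `x ≤ x₁`, where `p + r` may fail to be positive, and
  -- `p + r` for `x ≥ x₁ + 1`.
  set χ : ℝ → ℝ := fun x => Real.smoothTransition (x - x₁) with hχ
  have hχc : ContDiff ℝ ∞ χ := Real.smoothTransition.contDiff.comp (contDiff_id.sub contDiff_const)
  set q : ℝ → ℝ := fun x => χ x * (p x + r x) + (1 - χ x) with hq
  have hqr : ∀ x, x₁ + 1 ≤ x → q x - p x = r x := fun x hx => by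
    have : χ x = 1 := Real.smoothTransition.one_of_one_le (by linarith)
    simp [hq, this]
  have hnhds : ∀ x, x₁ + 1 < x → (fun x => q x - p x) =ᶠ[𝓝 x] r := fun x hx => by
    filter_upwards [lt_mem_nhds hx] with y hy using hqr y hy.le
  have hnhds1 : ∀ x, x₁ + 1 < x → deriv (fun x => q x - p x) =ᶠ[𝓝 x] r₁ := fun x hx => by
    filter_upwards [lt_mem_nhds hx] with y hy
    rw [(hnhds y hy).deriv_eq, (hr y).deriv]
  refine ⟨q, (hχc.mul hpr).add (contDiff_const.sub hχc), fun x => ?_, ⟨x₁, fun x hx => ?_⟩, ?_, ?_,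
    ?_⟩
  · have h0 : 0 ≤ χ x := Real.smoothTransition.nonneg _
    have h1 : χ x ≤ 1 := Real.smoothTransition.le_one _
    rcases le_or_gt x x₁ with hx | hx
    · have : χ x = 0 := Real.smoothTransition.zero_of_nonpos (by linarith)
      simp [hq, this]
    · have h2 := hx₁ x hx.le
      rcases h0.eq_or_lt with h | h
      · simp [hq, ← h]
      · have := mul_pos h h2
        simp only [hq]
        linarith
  · have : χ x = 0 := Real.smoothTransition.zero_of_nonpos (by linarith)
    simp [hq, this]
  · refine l0.congr' ?_
    filter_upwards [eventually_gt_atTop (x₁ + 1)] with x hx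
    rw [hqr x hx.le]
  · refine l1.congr' ?_
    filter_upwards [eventually_gt_atTop (x₁ + 1)] with x hx
    rw [(hnhds1 x hx).eq_of_nhds]
  · refine l2.congr' ?_
    filter_upwards [eventually_gt_atTop (x₁ + 1)] with x hx
    rw [(hnhds1 x hx).deriv_eq, (hr₁ x).deriv]

/-- A smooth function which is constant near minus infinity, positive, and integrable near infinity
is the derivative of a diffeomorphism onto the negative half line. -/
theorem exists_primitive_range_Iio {q Θ Θ' : ℝ → ℝ} (hq : ContDiff ℝ ∞ q) (hq0 : ∀ x, 0 < q x)
    (hq1 : ∃ x₀, ∀ x ≤ x₀, q x = 1) (hΘ : ∀ x, HasDerivAt Θ (Θ' x) x)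
    (hle : ∀ᶠ x in atTop, q x ≤ Θ' x) {B : ℝ} (hB : ∀ x, Θ x ≤ B) :
    ∃ S : ℝ → ℝ, ContDiff ℝ ∞ S ∧ (∀ x, HasDerivAt S (q x) x) ∧ range S = Iio 0 ∧
      Tendsto S atTop (𝓝 0) := by
  have hder : ∀ x, HasDerivAt (fun x => ∫ u in (0 : ℝ)..x, q u) (q x) x := fun x =>
    intervalIntegral.integral_hasDerivAt_right (hq.continuous.intervalIntegrable _ _)
      hq.continuous.stronglyMeasurable.stronglyMeasurableAtFilter hq.continuous.continuousAt
  set P : ℝ → ℝ := fun x => ∫ u in (0 : ℝ)..x, q u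
  have hmono : StrictMono P := strictMono_of_deriv_pos fun x => by
    rw [(hder x).deriv]; exact hq0 x
  -- From some point on `Θ - P` is non-decreasing, and `Θ` is bounded above.
  have hbdd : BddAbove (range P) := by
    obtain ⟨x₂, hx₂⟩ := eventually_atTop.1 hle
    have hm : MonotoneOn (fun x => Θ x - P x) (Ici x₂) := by
      refine monotoneOn_of_deriv_nonneg (convex_Ici _)
        (fun x _ => ((hΘ x).sub (hder x)).continuousAt.continuousWithinAt)
        (fun x _ => ((hΘ x).sub (hder x)).differentiableAt.differentiableWithinAt) fun x hx => ?_
      rw [interior_Ici] at hx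
      change 0 ≤ deriv (Θ - P) x
      rw [((hΘ x).sub (hder x)).deriv]
      linarith [hx₂ x (le_of_lt hx)]
    refine ⟨B - (Θ x₂ - P x₂), ?_⟩
    rintro _ ⟨x, rfl⟩
    have h1 := hm (mem_Ici.2 le_rfl) (mem_Ici.2 (le_max_right x x₂)) (le_max_right x x₂)
    simp only at h1
    have h2 := hmono.monotone (le_max_left x x₂)
    linarith [hB (max x x₂)]
  set ℓ := ⨆ x, P x
  have hlim : Tendsto P atTop (𝓝 ℓ) := tendsto_atTop_ciSup hmono.monotone hbdd
  have hPℓ : ∀ x, P x < ℓ := fun x => (hmono (lt_add_one x)).trans_le (le_ciSup hbdd _)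
  -- Near minus infinity `q = 1`, so the primitive is affine there and unbounded below.
  have hbot : ∀ c, ∃ x, P x ≤ c := by
    obtain ⟨x₀, hx₀⟩ := hq1
    intro c
    have hx : min x₀ (x₀ + c - P x₀) ≤ x₀ := min_le_left _ _
    have := Convex.mul_sub_le_image_sub_of_le_deriv (convex_Iic x₀)
      (fun x _ => (hder x).continuousAt.continuousWithinAt)
      (fun x _ => (hder x).differentiableAt.differentiableWithinAt) (C := 1)
      (fun x hx => by
        have hx' : x ∈ Iic x₀ := interior_subset hx
        rw [(hder x).deriv, hx₀ x hx'])
      _ (mem_Iic.2 hx) _ (mem_Iic.2 le_rfl) hx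
    exact ⟨_, by linarith [min_le_right x₀ (x₀ + c - P x₀)]⟩
  have hd : ∀ x, HasDerivAt (fun x => P x - ℓ) (q x) x := fun x => (hder x).sub_const _
  refine ⟨fun x => P x - ℓ, ?_, hd, ?_, by simpa using hlim.sub_const ℓ⟩
  · rw [contDiff_infty_iff_deriv]
    refine ⟨fun x => (hd x).differentiableAt, ?_⟩
    rwa [show deriv (fun x => P x - ℓ) = q from funext fun x => (hd x).deriv]
  · ext y
    constructor
    · rintro ⟨x, rfl⟩
      simpa using hPℓ x
    · intro hy
      have hcont : Continuous fun x => P x - ℓ :=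
        continuous_iff_continuousAt.2 fun x => (hd x).continuousAt
      obtain ⟨x, hx⟩ := hbot (y + ℓ)
      obtain ⟨x', hx'⟩ := (hlim.eventually_const_lt (show y + ℓ < ℓ by simpa using hy)).exists
      exact mem_range_of_exists_le_of_exists_ge hcont ⟨x, by linarith⟩ ⟨x', by linarith⟩

/-- Extending a function on the negative half line by a constant, at the level of derivatives. -/
theorem hasDerivAt_ite_lt {f f' : ℝ → ℝ} {c : ℝ} (hf : ∀ s < 0, HasDerivAt f (f' s) s)
    (h0 : Tendsto f (𝓝[<] 0) (𝓝 c)) (h1 : Tendsto f' (𝓝[<] 0) (𝓝 0)) (s : ℝ) :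
    HasDerivAt (fun s => if s < 0 then f s else c) (if s < 0 then f' s else 0) s := by
  rcases lt_trichotomy s 0 with hs | rfl | hs
  · rw [if_pos hs]
    refine (hf s hs).congr_of_eventuallyEq ?_
    filter_upwards [gt_mem_nhds hs] with y hy using if_pos hy
  · rw [if_neg (lt_irrefl _)]
    set G : ℝ → ℝ := fun s => if s < 0 then f s else c
    have hG : ∀ s < 0, HasDerivAt G (f' s) s := fun s hs => by
      refine (hf s hs).congr_of_eventuallyEq ?_
      filter_upwards [gt_mem_nhds hs] with y hy using if_pos hy
    -- The left derivative at `0` exists because `G` is continuous from the left and its derivatives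
    -- converge.
    have hl : HasDerivWithinAt G 0 (Iic 0) 0 := by
      refine hasDerivWithinAt_Iic_of_tendsto_deriv (s := Iio 0)
        (fun s hs => (hG s hs).differentiableAt.differentiableWithinAt) ?_ self_mem_nhdsWithin ?_
      · have : G 0 = c := if_neg (lt_irrefl _)
        rw [ContinuousWithinAt, this]
        refine h0.congr' ?_
        filter_upwards [self_mem_nhdsWithin] with y hy using (if_pos hy).symm
      · refine h1.congr' ?_
        filter_upwards [self_mem_nhdsWithin] with y hy using (hG y hy).deriv.symm
    have hr : HasDerivWithinAt G 0 (Ici 0) 0 :=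
      (hasDerivWithinAt_const (0 : ℝ) (Ici 0) c).congr (fun y hy => if_neg (not_lt.2 hy))
        (if_neg (lt_irrefl _))
    have := hl.union hr
    rwa [Iic_union_Ici, hasDerivWithinAt_univ] at this
  · rw [if_neg hs.not_gt]
    refine (hasDerivAt_const s c).congr_of_eventuallyEq ?_
    filter_upwards [lt_mem_nhds hs] with y hy using if_neg hy.not_gt

/-- A function on the negative half line whose first two derivatives tend to zero at the origin has
a `C²` extension by a constant. -/
theorem contDiff_two_ite_lt {f f₁ f₂ : ℝ → ℝ} {c : ℝ} (h : ∀ s < 0, HasDerivAt f (f₁ s) s)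
    (h' : ∀ s < 0, HasDerivAt f₁ (f₂ s) s) (hc : ContinuousOn f₂ (Iio 0))
    (l0 : Tendsto f (𝓝[<] 0) (𝓝 c)) (l1 : Tendsto f₁ (𝓝[<] 0) (𝓝 0))
    (l2 : Tendsto f₂ (𝓝[<] 0) (𝓝 0)) : ContDiff ℝ 2 fun s => if s < 0 then f s else c := by
  have d0 := hasDerivAt_ite_lt h l0 l1
  have d1 := hasDerivAt_ite_lt h' l1 l2
  have hcont : Continuous fun s => if s < 0 then f₂ s else (0 : ℝ) := by
    rw [continuous_iff_continuousAt]
    intro s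
    rcases lt_trichotomy s 0 with hs | rfl | hs
    · refine (hc.continuousAt (Iio_mem_nhds hs)).congr ?_
      filter_upwards [gt_mem_nhds hs] with y hy using (if_pos hy).symm
    · rw [continuousAt_iff_continuous_left'_right']
      simp only [ContinuousWithinAt, lt_irrefl, if_false]
      refine ⟨l2.congr' ?_, tendsto_const_nhds.congr' ?_⟩
      · filter_upwards [self_mem_nhdsWithin] with y hy using (if_pos hy).symm
      · filter_upwards [self_mem_nhdsWithin] with y hy using (if_neg (not_lt.2 (le_of_lt hy))).symm
    · refine continuousAt_const.congr (f := fun _ => (0 : ℝ)) ?_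
      filter_upwards [lt_mem_nhds hs] with y hy using (if_neg hy.not_gt).symm
  rw [show (2 : WithTop ℕ∞) = 1 + 1 from rfl, contDiff_succ_iff_deriv]
  refine ⟨fun s => (d0 s).differentiableAt, by simp, ?_⟩
  rw [show deriv (fun s => if s < 0 then f s else c) = _ from funext fun s => (d0 s).deriv,
    contDiff_one_iff_deriv]
  refine ⟨fun s => (d1 s).differentiableAt, ?_⟩
  rwa [show deriv (fun s => if s < 0 then f₁ s else (0 : ℝ)) = _ from
    funext fun s => (d1 s).deriv]

end SmoothTime

/-! ### A smooth time parameter close to conformal time -/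

section ConformalTime

/-- A positive `C²` density which is integrable at infinity is, up to a factor tending to one with
its first two derivatives in the new variable, the derivative of a smooth diffeomorphism onto the
negative half line. -/
theorem exists_smooth_primitive_close {p Θ Θ' : ℝ → ℝ} (hp : ContDiff ℝ 2 p) (hp0 : ∀ x, 0 < p x)
    (hΘ : ∀ x, HasDerivAt Θ (Θ' x) x) (hle : ∀ᶠ x in atTop, 2 * p x ≤ Θ' x) {B : ℝ}
    (hB : ∀ x, Θ x ≤ B) :
    ∃ S g₀ g₁ g₂ : ℝ → ℝ, ContDiff ℝ ∞ S ∧ (∀ x, 0 < deriv S x) ∧ range S = Iio 0 ∧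
      (∀ x, deriv S x = g₀ x * p x) ∧
      (∀ x, HasDerivAt g₀ (g₁ x * deriv S x) x) ∧ (∀ x, HasDerivAt g₁ (g₂ x * deriv S x) x) ∧
      Continuous g₂ ∧ Tendsto g₀ atTop (𝓝 1) ∧ Tendsto g₁ atTop (𝓝 0) ∧
      Tendsto g₂ atTop (𝓝 0) := by
  set c₀ : ℝ → ℝ := fun x => (p x)⁻¹ with hc₀def
  have hc₀ : ContDiff ℝ 2 c₀ := hp.inv fun x => (hp0 x).ne'
  have hc₁ : ContDiff ℝ 1 (deriv c₀) := ((contDiff_succ_iff_deriv (n := 1)).1 hc₀).2.2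
  have hc₂ : Continuous (deriv (deriv c₀)) :=
    ((contDiff_succ_iff_deriv (n := 0)).1 hc₁).2.2.continuous
  have dc₀ : ∀ x, HasDerivAt c₀ (deriv c₀ x) x := fun x =>
    (hc₀.differentiable (by simp) x).hasDerivAt
  have dc₁ : ∀ x, HasDerivAt (deriv c₀) (deriv (deriv c₀) x) x := fun x =>
    (hc₁.differentiable (by simp) x).hasDerivAt
  set c₁ := deriv c₀
  set c₂ := deriv c₁
  have kc₀ : Continuous c₀ := hc₀.continuous
  have kc₁ : Continuous c₁ := hc₁.continuous
  -- With `c₀ = 1 / p` and `r₀ = q - p`, the weight `K` dominates every monomial in `c₀` and its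
  -- derivatives that multiplies `r₀`, `r₁` or `r₂` in the terms whose limits are taken below.
  set K : ℝ → ℝ := fun x => |c₀ x| + |c₀ x ^ 2| + |c₀ x * c₁ x| + |c₀ x ^ 3| + |c₀ x ^ 2 * c₁ x| +
    |c₀ x ^ 2 * c₂ x| + |c₀ x * c₁ x ^ 2| with hKdef
  have hK : Continuous K := by fun_prop
  have hKb : ∀ x, |c₀ x| ≤ |K x| ∧ |c₀ x ^ 2| ≤ |K x| ∧ |c₀ x * c₁ x| ≤ |K x| ∧
      |c₀ x ^ 3| ≤ |K x| ∧ |c₀ x ^ 2 * c₁ x| ≤ |K x| ∧ |c₀ x ^ 2 * c₂ x| ≤ |K x| ∧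
      |c₀ x * c₁ x ^ 2| ≤ |K x| := fun x => by
    have hk : 0 ≤ K x := by positivity
    rw [abs_of_nonneg hk]
    have h1 := abs_nonneg (c₀ x)
    have h2 := abs_nonneg (c₀ x ^ 2)
    have h3 := abs_nonneg (c₀ x * c₁ x)
    have h4 := abs_nonneg (c₀ x ^ 3)
    have h5 := abs_nonneg (c₀ x ^ 2 * c₁ x)
    have h6 := abs_nonneg (c₀ x ^ 2 * c₂ x)
    have h7 := abs_nonneg (c₀ x * c₁ x ^ 2)
    refine ⟨?_, ?_, ?_, ?_, ?_, ?_, ?_⟩ <;> simp only [hKdef] <;> linarith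
  obtain ⟨q, hq, hq0, hq1, l0, l1, l2⟩ := exists_smooth_pos_approx hp hp0 hK fun x =>
    (le_abs_self _).trans (hKb x).1
  have hr₀ : ContDiff ℝ 2 fun x => q x - p x := (contDiff_infty.1 hq 2).sub hp
  have hr₁ : ContDiff ℝ 1 (deriv fun x => q x - p x) :=
    ((contDiff_succ_iff_deriv (n := 1)).1 hr₀).2.2
  have hr₂ : Continuous (deriv (deriv fun x => q x - p x)) :=
    ((contDiff_succ_iff_deriv (n := 0)).1 hr₁).2.2.continuous
  have dr₀ : ∀ x, HasDerivAt (fun x => q x - p x) (deriv (fun x => q x - p x) x) x := fun x =>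
    (hr₀.differentiable (by simp) x).hasDerivAt
  have dr₁ : ∀ x, HasDerivAt (deriv fun x => q x - p x)
      (deriv (deriv fun x => q x - p x) x) x := fun x =>
    (hr₁.differentiable (by simp) x).hasDerivAt
  have hqp : ∀ x, q x = p x + (q x - p x) := fun x => by ring
  set r₀ : ℝ → ℝ := fun x => q x - p x
  set r₁ := deriv r₀
  set r₂ := deriv r₁
  have kr₀ : Continuous r₀ := hr₀.continuous
  have kr₁ : Continuous r₁ := hr₁.continuous
  have hlim : ∀ {b r : ℝ → ℝ}, Tendsto (fun x => K x * r x) atTop (𝓝 0) → (∀ x, |b x| ≤ |K x|) →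
      Tendsto (fun x => b x * r x) atTop (𝓝 0) := by
    intro b r hr hb
    refine squeeze_zero_norm (fun x => ?_) (by simpa only [norm_mul, norm_zero] using hr.norm)
    rw [norm_mul (b x)]
    exact mul_le_mul_of_nonneg_right (hb x) (norm_nonneg _)
  have t0 := hlim l0 fun x => (hKb x).1
  -- `(q - p) / p → 0` gives `q < 2 p` eventually; this is why the hypothesis carries the factor
  -- `2`.
  have hle' : ∀ᶠ x in atTop, q x ≤ Θ' x := by
    filter_upwards [hle, t0.eventually_lt_const one_pos] with x hx hx'
    have h1 : c₀ x * r₀ x = r₀ x / p x := by rw [hc₀def]; field_simp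
    rw [h1, div_lt_one (hp0 x)] at hx'
    linarith [hqp x]
  obtain ⟨S, hS, dS, hrange, -⟩ := exists_primitive_range_Iio hq hq0 hq1 hΘ hle' hB
  have hS' : ∀ x, deriv S x = q x := fun x => (dS x).deriv
  have hg0 : ∀ x, 1 + r₀ x * c₀ x = q x * c₀ x := fun x => by
    rw [hqp x, add_mul, hc₀def]
    simp only
    rw [mul_inv_cancel₀ (hp0 x).ne']
  have hc0 : ∀ x, 0 < c₀ x := fun x => inv_pos.2 (hp0 x)
  have hg0pos : ∀ x, 0 < 1 + r₀ x * c₀ x := fun x => by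
    rw [hg0]; exact mul_pos (hq0 x) (hc0 x)
  have hqg : ∀ x, q x = (1 + r₀ x * c₀ x) / c₀ x := fun x => by
    rw [hg0, mul_div_cancel_right₀ _ (hc0 x).ne']
  have tg0 : Tendsto (fun x => 1 + r₀ x * c₀ x) atTop (𝓝 1) := by
    simpa [mul_comm] using t0.const_add 1
  have tm : Tendsto (fun x => c₀ x * (r₁ x * c₀ x + r₀ x * c₁ x)) atTop (𝓝 0) := by
    have := (hlim l1 fun x => (hKb x).2.1).add (hlim l0 fun x => (hKb x).2.2.1)
    rw [add_zero] at this
    exact this.congr fun x => by ring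
  -- Here `g₀ = q / p`, and `g₁`, `g₂` are its successive derivatives with respect to `S`, i.e.
  -- images under `(1 / q) d/dx` with `1 / q = c₀ / g₀`.
  refine ⟨S, fun x => 1 + r₀ x * c₀ x,
    fun x => c₀ x * (r₁ x * c₀ x + r₀ x * c₁ x) / (1 + r₀ x * c₀ x),
    fun x => ((r₂ x * c₀ x + 2 * (r₁ x * c₁ x) + r₀ x * c₂ x) * (1 + r₀ x * c₀ x) * c₀ x ^ 2 -
      (c₀ x * (r₁ x * c₀ x + r₀ x * c₁ x)) ^ 2 +
      (r₁ x * c₀ x + r₀ x * c₁ x) * (1 + r₀ x * c₀ x) * c₁ x * c₀ x) / (1 + r₀ x * c₀ x) ^ 3,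
    hS, fun x => by rw [hS']; exact hq0 x, hrange, fun x => ?_, fun x => ?_, fun x => ?_, ?_, tg0,
    ?_, ?_⟩
  · simp only
    rw [hS', hg0, mul_assoc, hc₀def]
    simp only
    rw [inv_mul_cancel₀ (hp0 x).ne', mul_one]
  · refine (((dr₀ x).mul (dc₀ x)).const_add 1).congr_deriv ?_
    have h1 := (hg0pos x).ne'
    have h2 := (hc0 x).ne'
    rw [hS', hqg, div_mul_div_comm]
    refine ((div_eq_iff (mul_ne_zero h1 h2)).2 ?_).symm
    ring
  · have h1 := (hg0pos x).ne'
    have h2 := (hc0 x).ne'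
    refine (((dc₀ x).mul (((dr₁ x).mul (dc₀ x)).add ((dr₀ x).mul (dc₁ x)))).div
      (((dr₀ x).mul (dc₀ x)).const_add 1) h1).congr_deriv ?_
    rw [hS', hqg]
    simp only [Pi.mul_apply, Pi.add_apply]
    change _ / (1 + r₀ x * c₀ x) ^ 2 = _
    field_simp
    ring
  · refine Continuous.div (by fun_prop) (by fun_prop) fun x => pow_ne_zero _ (hg0pos x).ne'
  · have := tm.div tg0 one_ne_zero
    rw [zero_div] at this
    exact this
  · have ta : Tendsto (fun x => c₀ x ^ 2 * (r₂ x * c₀ x + 2 * (r₁ x * c₁ x) + r₀ x * c₂ x)) atTop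
        (𝓝 0) := by
      have := ((hlim l2 fun x => (hKb x).2.2.2.1).add
        ((hlim l1 fun x => (hKb x).2.2.2.2.1).const_mul 2)).add
        (hlim l0 fun x => (hKb x).2.2.2.2.2.1)
      rw [mul_zero, add_zero, add_zero] at this
      exact this.congr fun x => by ring
    have tb : Tendsto (fun x => c₀ x * c₁ x * (r₁ x * c₀ x + r₀ x * c₁ x)) atTop (𝓝 0) := by
      have := (hlim l1 fun x => (hKb x).2.2.2.2.1).add (hlim l0 fun x => (hKb x).2.2.2.2.2.2)
      rw [add_zero] at this
      exact this.congr fun x => by ring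
    have := (((ta.mul tg0).sub (tm.pow 2)).add (tb.mul tg0)).div (tg0.pow 3) (by simp)
    simp only [zero_mul, ne_eq, OfNat.ofNat_ne_zero, not_false_eq_true, zero_pow, sub_zero,
      add_zero, one_pow, div_one] at this
    refine this.congr fun x => ?_
    simp only [Pi.div_apply]
    congr 1
    ring

/-- Let the scale factor `a` tend to infinity at the end point `t₀` of an interval. There is a smooth
time parameter `s < 0` with `dt / ds = a β`, where `β` has a `C²` extension across `s = 0`. -/
theorem exists_smooth_conformal_time {U : Set ℝ} (hU : IsOpen U) (hc : U.OrdConnected)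
    (hne : U.Nonempty) {t₀ : ℝ} (ht₀ : IsLUB U t₀) {a : ℝ → ℝ} (ha : ContDiffOn ℝ 2 a U)
    (hpos : ∀ t ∈ U, 0 < a t) (hlim : Tendsto a (𝓝[<] t₀) atTop) :
    ∃ (e : OpenPartialHomeomorph ℝ ℝ) (β : ℝ → ℝ), e.source = Iio 0 ∧ e.target = U ∧
      ContDiffOn ℝ ∞ e (Iio 0) ∧ ContDiffOn ℝ ∞ e.symm U ∧ ContDiff ℝ 2 β ∧ (∀ s, 0 < β s) ∧
      β 0 = 1 ∧ deriv β 0 = 0 ∧ (∀ s < 0, HasDerivAt e (a (e s) * β s) s) ∧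
      Tendsto e (𝓝[<] 0) (𝓝[<] t₀) := by
  obtain ⟨θ, hθ, hθ', hr, hθl⟩ := exists_smooth_parametrization hU hc hne ht₀
  have hθU : ∀ x, θ x ∈ U := fun x => hr ▸ mem_range_self x
  have hmono : StrictMono θ := strictMono_of_deriv_pos hθ'
  have hθlt : ∀ x, θ x < t₀ := fun x => (hmono (lt_add_one x)).trans_le (ht₀.1 (hθU _))
  have hθl' : Tendsto θ atTop (𝓝[<] t₀) :=
    tendsto_nhdsWithin_iff.2 ⟨hθl, Eventually.of_forall hθlt⟩
  have hθd : ContDiff ℝ ∞ (deriv θ) := (contDiff_infty_iff_deriv.1 hθ).2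
  have haθ : ContDiff ℝ 2 (a ∘ θ) :=
    ha.comp_contDiff (contDiff_infty.1 hθ 2) hθU
  -- In the parameter `x` with `t = θ x`, the density of conformal time `dt / a` is `θ' / (a ∘ θ)`.
  -- It is integrable at infinity since `a ≥ 2` eventually and `θ` is bounded above.
  obtain ⟨S, g₀, g₁, g₂, hS, hS', hSr, hSp, dg₀, dg₁, cg₂, tg₀, tg₁, tg₂⟩ :=
    exists_smooth_primitive_close (p := fun x => deriv θ x / a (θ x)) (Θ := θ) (Θ' := deriv θ)
      ((contDiff_infty.1 hθd 2).div haθ fun x => (hpos _ (hθU x)).ne')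
      (fun x => div_pos (hθ' x) (hpos _ (hθU x)))
      (fun x => (hθ.differentiable (by simp) x).hasDerivAt)
      (by
        filter_upwards [(hlim.comp hθl').eventually_ge_atTop 2] with x hx
        rw [Function.comp_apply] at hx
        rw [← mul_div_assoc, div_le_iff₀ (hpos _ (hθU x)), mul_comm]
        exact mul_le_mul_of_nonneg_left hx (hθ' x).le)
      (fun x => (hθlt x).le)
  obtain ⟨eθ, eθs, eθt, eθf, -, eθi⟩ := exists_openPartialHomeomorph_of_deriv_pos hθ hθ' hr hU hc
  obtain ⟨eS, eSs, eSt, eSf, eSd, eSi⟩ :=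
    exists_openPartialHomeomorph_of_deriv_pos hS hS' hSr isOpen_Iio ordConnected_Iio
  set σ : ℝ → ℝ := fun s => eS.symm s with hσ
  have hSmono : StrictMono S := strictMono_of_deriv_pos hS'
  have hSσ : ∀ s < 0, S (σ s) = s := fun s hs => by
    rw [← eSf, hσ]; simp only; rw [eS.right_inv (by rw [eSt]; exact hs)]
  have hσl : Tendsto σ (𝓝[<] 0) atTop := by
    rw [tendsto_atTop]
    intro x
    have hx : S x < 0 := by
      have : S x ∈ Iio (0 : ℝ) := hSr ▸ mem_range_self x
      exact this
    filter_upwards [self_mem_nhdsWithin, nhdsWithin_le_nhds (lt_mem_nhds hx)] with s hs hs'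
    rw [← hSmono.le_iff_le, hSσ s hs]
    exact hs'.le
  have hcomp : ∀ {f f' : ℝ → ℝ}, (∀ x, HasDerivAt f (f' x * deriv S x) x) → ∀ s < 0,
      HasDerivAt (f ∘ σ) (f' (σ s)) s := by
    intro f f' hf s hs
    refine ((hf (σ s)).comp s (eSd s hs)).congr_deriv ?_
    rw [mul_assoc, mul_inv_cancel₀ (hS' _).ne', mul_one]
  have hg₀ : ∀ x, 0 < g₀ x := fun x => by
    have := hS' x
    rw [hSp] at this
    exact pos_of_mul_pos_left this (div_pos (hθ' x) (hpos _ (hθU x))).le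
  have hγ := contDiff_two_ite_lt (hcomp dg₀) (hcomp dg₁)
    (cg₂.comp_continuousOn (eSi.continuousOn)) (tg₀.comp hσl) (tg₁.comp hσl) (tg₂.comp hσl)
  have hγd := hasDerivAt_ite_lt (hcomp dg₀) (tg₀.comp hσl) (tg₁.comp hσl) 0
  -- `dt/ds = θ' / S' = a / g₀`, so `β = 1 / γ`, where `γ` extends `g₀` by its limit `1`.
  set γ : ℝ → ℝ := fun s => if s < 0 then (g₀ ∘ σ) s else 1 with hγdef
  have hγpos : ∀ s, 0 < γ s := fun s => by
    rw [hγdef]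
    dsimp only
    split_ifs
    exacts [hg₀ _, one_pos]
  have hγ0 : γ 0 = 1 := if_neg (lt_irrefl _)
  have he : ∀ s, (eS.symm.trans eθ) s = θ (σ s) := fun s => eθf _
  refine ⟨eS.symm.trans eθ, fun s => (γ s)⁻¹, ?_, ?_, ?_, ?_, hγ.inv fun s => (hγpos s).ne',
    fun s => inv_pos.2 (hγpos s), by simp [hγ0], ?_, fun s hs => ?_, ?_⟩
  · rw [OpenPartialHomeomorph.trans_source, eθs]
    simp [eSt]
  · rw [OpenPartialHomeomorph.trans_target, eθt]
    simp [eSs]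
  · exact (hθ.comp_contDiffOn eSi).congr fun s _ => he s
  · exact (hS.comp_contDiffOn eθi).congr fun t _ => eSf _
  · have := (hγd.fun_inv (hγpos 0).ne').deriv
    rwa [if_neg (lt_irrefl _), neg_zero, zero_div] at this
  · have h1 := ((hθ.differentiable (by simp) (σ s)).hasDerivAt.comp s (eSd s hs))
    refine (h1.congr_of_eventuallyEq (Eventually.of_forall he)).congr_deriv ?_
    have h2 : γ s = g₀ (σ s) := if_pos hs
    have h3 := (hg₀ (σ s)).ne'
    have h4 := (hpos _ (hθU (σ s))).ne'
    have h5 := (hθ' (σ s)).ne'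
    simp only
    rw [he, h2]
    change deriv θ (σ s) * (deriv S (σ s))⁻¹ = _
    rw [hSp]
    field_simp
  · exact (hθl'.comp hσl).congr fun s => (he s).symm

end ConformalTime

/-! ### The scale factor as a conformal factor -/

section ConformalFactor

/-- A criterion for the factor conditions in terms of ordinary derivatives. -/
theorem isFIUFactor_of_hasDerivAt {Ω Ω₁ Ω₂ : ℝ → ℝ} {lam : ℝ}
    (h₁ : ∀ T < 0, HasDerivAt Ω (Ω₁ T) T) (h₂ : ∀ T < 0, HasDerivAt Ω₁ (Ω₂ T) T)
    (hc : ContinuousOn Ω₂ (Iio 0)) (hpos : ∀ T < 0, 0 < Ω T) (hpos₁ : ∀ᶠ T in 𝓝[<] 0, 0 < Ω₁ T)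
    (hlim : Tendsto Ω (𝓝[<] 0) atTop)
    (hL : Tendsto (fun T => Ω₂ T / Ω T * (Ω T / Ω₁ T) ^ 2) (𝓝[<] 0) (𝓝 lam)) (hl1 : lam ≠ 1)
    (hl2 : lam ≠ 2) : IsFIUFactor Ω (lam : EReal) := by
  obtain ⟨b, hb, hb1⟩ := (nhdsLT_basis (0 : ℝ)).eventually_iff.1 hpos₁
  have hcpos : 0 < -b / 2 := by linarith
  -- Halving `b` keeps the closed end point `-c` inside `(b, 0)`, where ordinary derivatives exist
  -- and agree with the one-sided ones.
  set c := -b / 2 with hcdef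
  set I := Ico (-c) 0
  have hneg : ∀ T ∈ I, T < 0 := fun T hT => hT.2
  have hp1 : ∀ T ∈ I, 0 < Ω₁ T := fun T hT => hb1 ⟨by linarith [hT.1], hT.2⟩
  have hu : UniqueDiffOn ℝ I := uniqueDiffOn_Ico _ _
  have hsub : I ⊆ Iio 0 := fun T hT => hT.2
  have hd1 : ∀ T ∈ I, derivWithin Ω I T = Ω₁ T := fun T hT =>
    (h₁ T hT.2).hasDerivWithinAt.derivWithin (hu T hT)
  have hd2 : ∀ T ∈ I, iteratedDerivWithin 2 Ω I T = Ω₂ T := fun T hT => by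
    have : iteratedDerivWithin 2 Ω I T = derivWithin (derivWithin Ω I) I T := by
      rw [iteratedDerivWithin_succ, iteratedDerivWithin_one]
    rw [this, derivWithin_congr hd1 (hd1 T hT)]
    exact (h₂ T hT.2).hasDerivWithinAt.derivWithin (hu T hT)
  have hLI : ∀ T ∈ I, conformalL Ω I T = Ω₂ T / Ω T * (Ω T / Ω₁ T) ^ 2 := fun T hT => by
    rw [conformalL, hd1 T hT, hd2 T hT]
  have hΩc : ContinuousOn Ω (Iio 0) := fun T hT => (h₁ T hT).continuousAt.continuousWithinAt
  have hΩ₁c : ContinuousOn Ω₁ (Iio 0) := fun T hT => (h₂ T hT).continuousAt.continuousWithinAt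
  refine ⟨hlim, c, hcpos, ?_, ?_, fun T hT => hpos T hT.2, fun T hT => ?_, ?_, ?_, ?_, ?_⟩
  · refine ContDiffOn.mono ?_ hsub
    rw [show (2 : WithTop ℕ∞) = 1 + 1 from rfl, contDiffOn_succ_iff_deriv_of_isOpen isOpen_Iio]
    refine ⟨fun T hT => (h₁ T hT).differentiableAt.differentiableWithinAt, by simp, ?_⟩
    refine ContDiffOn.congr (f := Ω₁) ?_ fun T hT => (h₁ T hT).deriv
    rw [show (1 : WithTop ℕ∞) = 0 + 1 from rfl, contDiffOn_succ_iff_deriv_of_isOpen isOpen_Iio]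
    refine ⟨fun T hT => (h₂ T hT).differentiableAt.differentiableWithinAt, by simp, ?_⟩
    exact contDiffOn_zero.2 (hc.congr fun T hT => (h₂ T hT).deriv)
  · refine strictMonoOn_of_deriv_pos (convex_Ico _ _) (hΩc.mono hsub) fun T hT => ?_
    have hT' : T ∈ I := interior_subset hT
    rw [(h₁ T hT'.2).deriv]
    exact hp1 T hT'
  · rw [hd1 T hT]
    exact (hp1 T hT).ne'
  · refine ContinuousOn.congr ?_ hLI
    exact ((hc.mono hsub).div (hΩc.mono hsub) fun T hT => (hpos T hT.2).ne').mul
      (((hΩc.mono hsub).div (hΩ₁c.mono hsub) fun T hT => (hp1 T hT).ne').pow 2)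
  · refine (continuous_coe_real_ereal.tendsto lam).comp (hL.congr' ?_)
    filter_upwards [Ico_mem_nhdsLT (show -c < 0 by linarith)] with T hT using (hLI T hT).symm
  · exact_mod_cast hl1
  · exact fun h => hl2 (EReal.coe_injective (h : (lam : EReal) = ((2 : ℝ) : EReal)))

/-- The inverse on the negative half line of an odd power. -/
noncomputable def negRoot (n : ℕ) (T : ℝ) : ℝ := -(-T) ^ (n : ℝ)⁻¹

theorem negRoot_neg {n : ℕ} {T : ℝ} (hT : T < 0) : negRoot n T < 0 :=
  neg_lt_zero.2 (Real.rpow_pos_of_pos (neg_pos.2 hT) _)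

theorem negRoot_pow {n : ℕ} (hn : Odd n) {T : ℝ} (hT : T < 0) : negRoot n T ^ n = T := by
  rw [negRoot, hn.neg_pow, Real.rpow_inv_natCast_pow (by linarith) hn.pos.ne', neg_neg]

theorem negRoot_pow_self {n : ℕ} (hn : Odd n) {s : ℝ} (hs : s < 0) : negRoot n (s ^ n) = s :=
  hn.strictMono_pow.injective (negRoot_pow hn (hn.pow_neg hs))

theorem continuous_negRoot (n : ℕ) : Continuous (negRoot n) :=
  (continuous_neg.rpow_const fun _ => Or.inr (by positivity)).neg

theorem hasDerivAt_negRoot {n : ℕ} (hn : Odd n) {T : ℝ} (hT : T < 0) :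
    HasDerivAt (negRoot n) (n * negRoot n T ^ (n - 1))⁻¹ T := by
  refine HasDerivAt.of_local_left_inverse (continuous_negRoot n).continuousAt
    (hasDerivAt_pow n (negRoot n T)) ?_ ?_
  · exact mul_ne_zero (Nat.cast_ne_zero.2 hn.pos.ne') (pow_ne_zero _ (negRoot_neg hT).ne)
  · filter_upwards [gt_mem_nhds hT] with y hy using negRoot_pow hn hy

theorem tendsto_negRoot {n : ℕ} (hn : Odd n) : Tendsto (negRoot n) (𝓝[<] 0) (𝓝[<] 0) := by
  refine tendsto_nhdsWithin_iff.2 ⟨?_, ?_⟩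
  · have := (continuous_negRoot n).tendsto 0
    have h0 : negRoot n 0 = 0 := by
      rw [negRoot, neg_zero, Real.zero_rpow (inv_ne_zero (Nat.cast_ne_zero.2 hn.pos.ne')), neg_zero]
    rw [h0] at this
    exact this.mono_left nhdsWithin_le_nhds
  · filter_upwards [self_mem_nhdsWithin] with T hT using negRoot_neg hT

/-- Reparametrizing a conformal factor by an odd power. -/
theorem isFIUFactor_comp_negRoot {A A₁ A₂ : ℝ → ℝ} {q : ℝ} {n : ℕ} (hn : Odd n)
    (h₁ : ∀ s < 0, HasDerivAt A (A₁ s) s) (h₂ : ∀ s < 0, HasDerivAt A₁ (A₂ s) s)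
    (hc : ContinuousOn A₂ (Iio 0)) (hpos : ∀ s < 0, 0 < A s) (hpos₁ : ∀ᶠ s in 𝓝[<] 0, 0 < A₁ s)
    (hlim : Tendsto A (𝓝[<] 0) atTop) (hρ : Tendsto (fun s => A s / A₁ s) (𝓝[<] 0) (𝓝 0))
    (hL : Tendsto (fun s => A s * A₂ s / A₁ s ^ 2) (𝓝[<] 0) (𝓝 (1 + q))) (hq : 0 < q)
    (hnq : 1 + n * q ≠ 2) : IsFIUFactor (A ∘ negRoot n) ((1 + n * q : ℝ) : EReal) := by
  have hn0 : (n : ℝ) ≠ 0 := Nat.cast_ne_zero.2 hn.pos.ne'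
  have hnpos : (0 : ℝ) < n := Nat.cast_pos.2 hn.pos
  -- L'Hôpital's rule again: `(A / A')' = 1 - A A'' / A'²` tends to `-q`.
  have hρs : Tendsto (fun s => A s / A₁ s / s) (𝓝[<] 0) (𝓝 (-q)) := by
    refine HasDerivAt.lhopital_zero_nhdsLT (f' := fun s => 1 - A s * A₂ s / A₁ s ^ 2)
      (g' := fun _ => 1) ?_ (Eventually.of_forall fun s => hasDerivAt_id s) (by simp) hρ
      (tendsto_id.mono_left nhdsWithin_le_nhds) ?_
    · filter_upwards [self_mem_nhdsWithin, hpos₁] with s hs hs1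
      refine ((h₁ s hs).div (h₂ s hs) hs1.ne').congr_deriv ?_
      have := hs1.ne'
      field_simp
    · simpa using hL.const_sub 1
  have hpow : ∀ s < 0, HasDerivAt (fun s => A₁ s * ((n : ℝ) * s ^ (n - 1))⁻¹)
      ((A₂ s - (n - 1) * A₁ s / s) * ((n : ℝ) * s ^ (n - 1))⁻¹) s := by
    intro s hs
    have hs0 : s ≠ 0 := hs.ne
    have h3 := ((hasDerivAt_pow (n - 1) s).const_mul (n : ℝ)).fun_inv
      (mul_ne_zero hn0 (pow_ne_zero _ hs0))
    refine ((h₂ s hs).mul h3).congr_deriv ?_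
    obtain ⟨m, rfl⟩ : ∃ m, n = m + 1 := ⟨n - 1, (Nat.sub_add_cancel hn.pos).symm⟩
    simp only [Nat.add_sub_cancel]
    rcases m with _ | m
    · simp
    · simp only [Nat.add_sub_cancel]
      push_cast
      field_simp
      ring
  have hevp : ∀ᶠ s in 𝓝[<] (0 : ℝ), 0 < A₁ s * ((n : ℝ) * s ^ (n - 1))⁻¹ := by
    filter_upwards [hpos₁, self_mem_nhdsWithin] with s hs hs0
    -- Oddness of `n` makes the derivative `n s ^ (n - 1)` of `sⁿ` positive also for `s < 0`.
    have he : Even (n - 1) := Nat.Odd.sub_odd hn odd_one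
    exact mul_pos hs (inv_pos.2 (mul_pos hnpos (he.pow_pos (ne_of_lt hs0))))
  refine isFIUFactor_of_hasDerivAt
    (Ω₁ := (fun s => A₁ s * ((n : ℝ) * s ^ (n - 1))⁻¹) ∘ negRoot n)
    (Ω₂ := fun T => (A₂ (negRoot n T) - (n - 1) * A₁ (negRoot n T) / negRoot n T) *
      ((n : ℝ) * negRoot n T ^ (n - 1))⁻¹ * ((n : ℝ) * negRoot n T ^ (n - 1))⁻¹)
    (fun T hT => (h₁ _ (negRoot_neg hT)).comp T (hasDerivAt_negRoot hn hT))
    (fun T hT => (hpow _ (negRoot_neg hT)).comp T (hasDerivAt_negRoot hn hT)) ?_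
    (fun T hT => hpos _ (negRoot_neg hT)) ((tendsto_negRoot hn).eventually hevp)
    (hlim.comp (tendsto_negRoot hn)) ?_ ?_ hnq
  · have hr := (continuous_negRoot n).continuousOn (s := Iio 0)
    have hm : MapsTo (negRoot n) (Iio 0) (Iio 0) := fun T hT => negRoot_neg hT
    have hA₁ : ContinuousOn A₁ (Iio 0) := fun s hs => (h₂ s hs).continuousAt.continuousWithinAt
    have hi : ContinuousOn (fun T => ((n : ℝ) * negRoot n T ^ (n - 1))⁻¹) (Iio 0) :=
      ((continuous_const.mul ((continuous_negRoot n).pow _)).continuousOn).inv₀ fun T hT =>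
        mul_ne_zero hn0 (pow_ne_zero _ (negRoot_neg hT).ne)
    exact ((((hc.comp hr hm).sub ((continuousOn_const.mul (hA₁.comp hr hm)).div hr
      fun T hT => (negRoot_neg hT).ne)).mul hi).mul hi)
  -- In terms of `s`, the new `L` is the old one minus `(n - 1) A / (A' s)`; its limit is `1 + q +
  -- (n - 1) q`.
  · have h3 : Tendsto (fun s => A s * A₂ s / A₁ s ^ 2 - (n - 1) * (A s / A₁ s / s)) (𝓝[<] 0)
        (𝓝 (1 + n * q)) := by
      have := hL.sub (hρs.const_mul ((n : ℝ) - 1))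
      rwa [show 1 + q - ((n : ℝ) - 1) * -q = 1 + n * q by ring] at this
    refine (h3.comp (tendsto_negRoot hn)).congr' ?_
    filter_upwards [(tendsto_negRoot hn).eventually hpos₁, self_mem_nhdsWithin] with T h4 hT
    have h5 := (negRoot_neg (n := n) hT)
    have h6 := (hpos _ h5).ne'
    have h7 := pow_ne_zero (n - 1) h5.ne
    simp only [Function.comp_apply]
    set s := negRoot n T
    have h8 := h5.ne
    have h9 := h4.ne'
    field_simp
  · have := mul_pos hnpos hq
    linarith

/-- If `ä a / ȧ²` has a positive limit and `a` blows up in finite time, so does `ȧ`. -/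
theorem FRWModel.tendsto_deriv_scale (F : FRWModel) {t₀ q : ℝ} (ht₀ : IsLUB F.dom t₀) (hq : 0 < q)
    (hr : Tendsto F.accelRatio (𝓝[<] t₀) (𝓝 q)) (ha : Tendsto F.scale (𝓝[<] t₀) atTop) :
    Tendsto (deriv F.scale) (𝓝[<] t₀) atTop := by
  have hd1 := ((contDiffOn_succ_iff_deriv_of_isOpen (n := 1) F.dom_open).1 F.scale_contDiffOn).2.2
  have hlt : ∃ t ∈ F.dom, t < t₀ := by
    obtain ⟨t, ht⟩ := F.dom_nonempty
    obtain ⟨l, u, h, hs⟩ := mem_nhds_iff_exists_Ioo_subset.1 (F.dom_open.mem_nhds ht)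
    obtain ⟨y, hy⟩ := exists_between h.1
    exact ⟨y, hs ⟨hy.1, hy.2.trans h.2⟩, hy.2.trans_le (ht₀.1 ht)⟩
  obtain ⟨b, hb, hb1⟩ := (nhdsLT_basis t₀).eventually_iff.1 (hr.eventually_const_lt hq)
  obtain ⟨t₂, ht₂, ht₂lt⟩ := hlt
  set t₁ := max t₂ ((b + t₀) / 2) with ht₁
  have ht₁lt : t₁ < t₀ := max_lt ht₂lt (by linarith)
  have hmem : ∀ t, t₁ ≤ t → t < t₀ → t ∈ F.dom ∧ b < t := fun t h1 h2 => by
    obtain ⟨z, hz, htz, -⟩ := ht₀.exists_between h2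
    exact ⟨F.dom_interval.out ht₂ hz ⟨(le_max_left _ _).trans h1, htz.le⟩, by
      linarith [le_max_right t₂ ((b + t₀) / 2)]⟩
  have hdiff : ∀ t, t₁ ≤ t → t < t₀ → DifferentiableAt ℝ F.scale t ∧
      DifferentiableAt ℝ (deriv F.scale) t := fun t h1 h2 =>
    ⟨(F.scale_contDiffOn.differentiableOn (by simp)).differentiableAt
      (F.dom_open.mem_nhds (hmem t h1 h2).1),
      (hd1.differentiableOn (by simp)).differentiableAt (F.dom_open.mem_nhds (hmem t h1 h2).1)⟩
  -- A positive acceleration ratio forces `ä > 0`, so `ȧ` increases near `t₀`.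
  have hmono : MonotoneOn (deriv F.scale) (Ico t₁ t₀) := by
    refine monotoneOn_of_deriv_nonneg (convex_Ico _ _)
      (fun t ht => (hdiff t ht.1 ht.2).2.continuousAt.continuousWithinAt)
      (fun t ht => (hdiff t (interior_subset ht).1 (interior_subset ht).2).2.differentiableWithinAt)
      fun t ht => ?_
    have ht' : t ∈ Ico t₁ t₀ := interior_subset ht
    have h3 := hmem t ht'.1 ht'.2
    have h4 := hb1 ⟨h3.2, ht'.2⟩
    have h5 := F.scale_pos t h3.1
    by_contra h6
    refine h4.not_ge (div_nonpos_of_nonpos_of_nonneg ?_ (sq_nonneg _))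
    exact mul_nonpos_of_nonpos_of_nonneg (not_le.1 h6).le h5.le
  -- By convexity `a t - a t₁ ≤ ȧ t (t - t₁)`, and `t - t₁ ≤ t₀ - t₁`. The maximum with `0` covers
  -- `ȧ t < 0`, where the second estimate would change direction.
  have hbound : ∀ t ∈ Ioo t₁ t₀, (F.scale t - F.scale t₁) / (t₀ - t₁) ≤
      max (deriv F.scale t) 0 := by
    intro t ht
    have h3 := Convex.image_sub_le_mul_sub_of_deriv_le (convex_Icc t₁ t)
      (fun x hx => (hdiff x hx.1 (hx.2.trans_lt ht.2)).1.continuousAt.continuousWithinAt)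
      (fun x hx => (hdiff x (interior_subset hx).1
        ((interior_subset hx).2.trans_lt ht.2)).1.differentiableWithinAt)
      (C := deriv F.scale t) (fun x hx => by
        have hx' : x ∈ Icc t₁ t := interior_subset hx
        exact hmono ⟨hx'.1, hx'.2.trans_lt ht.2⟩ ⟨ht.1.le, ht.2⟩ hx'.2)
      t₁ (left_mem_Icc.2 ht.1.le) t (right_mem_Icc.2 ht.1.le) ht.1.le
    rw [div_le_iff₀ (by linarith)]
    refine h3.trans ((mul_le_mul_of_nonneg_right (le_max_left _ 0) (by linarith [ht.1])).trans ?_)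
    exact mul_le_mul_of_nonneg_left (by linarith [ht.2]) (le_max_right _ _)
  have h6 : Tendsto (fun t => (F.scale t - F.scale t₁) / (t₀ - t₁)) (𝓝[<] t₀) atTop :=
    (tendsto_atTop_add_const_right _ (-F.scale t₁) ha).atTop_div_const (by linarith)
  have h7 : Tendsto (fun t => max (deriv F.scale t) 0) (𝓝[<] t₀) atTop := by
    refine tendsto_atTop_mono' _ ?_ h6
    filter_upwards [Ioo_mem_nhdsLT ht₁lt] with t ht using hbound t ht
  refine h7.congr' ?_
  filter_upwards [h7.eventually_gt_atTop 0] with t ht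
  rcases le_total (deriv F.scale t) 0 with h | h
  · rw [max_eq_right h] at ht
    exact absurd ht (lt_irrefl _)
  · exact max_eq_left h

/-- The conformal factor of an FRW model in a conformal time. -/
theorem FRWModel.isFIUFactor (F : FRWModel) {t₀ q : ℝ} (ht₀ : IsLUB F.dom t₀) (hq : 0 < q)
    (hr : Tendsto F.accelRatio (𝓝[<] t₀) (𝓝 q)) (ha : Tendsto F.scale (𝓝[<] t₀) atTop)
    {e β : ℝ → ℝ} (hβ : ContDiff ℝ 2 β) (hβpos : ∀ s, 0 < β s) (hβ1 : deriv β 0 = 0)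
    (hmem : ∀ s < 0, e s ∈ F.dom)
    (he : ∀ s < 0, HasDerivAt e (F.scale (e s) * β s) s) (hel : Tendsto e (𝓝[<] 0) (𝓝[<] t₀))
    {n : ℕ} (hn : Odd n) (hnq : 1 + n * q ≠ 2) :
    IsFIUFactor (F.scale ∘ e ∘ negRoot n) ((1 + n * q : ℝ) : EReal) := by
  have hd1 := ((contDiffOn_succ_iff_deriv_of_isOpen (n := 1) F.dom_open).1 F.scale_contDiffOn).2.2
  have hd2 := ((contDiffOn_succ_iff_deriv_of_isOpen (n := 0) F.dom_open).1 hd1).2.2.continuousOn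
  have hβd : ContDiff ℝ 1 (deriv β) := ((contDiff_succ_iff_deriv (n := 1)).1 hβ).2.2
  have ha1 : ∀ t ∈ F.dom, HasDerivAt F.scale (deriv F.scale t) t := fun t ht =>
    ((F.scale_contDiffOn.differentiableOn (by simp)).differentiableAt
      (F.dom_open.mem_nhds ht)).hasDerivAt
  have ha2 : ∀ t ∈ F.dom, HasDerivAt (deriv F.scale) (deriv (deriv F.scale) t) t := fun t ht =>
    ((hd1.differentiableOn (by simp)).differentiableAt (F.dom_open.mem_nhds ht)).hasDerivAt
  have hecont : ContinuousOn e (Iio 0) := fun s hs => (he s hs).continuousAt.continuousWithinAt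
  have hscont : ContinuousOn (F.scale ∘ e) (Iio 0) :=
    F.scale_contDiffOn.continuousOn.comp hecont hmem
  have hdcont : ContinuousOn (fun s => deriv F.scale (e s)) (Iio 0) :=
    hd1.continuousOn.comp hecont hmem
  have hddcont : ContinuousOn (fun s => deriv (deriv F.scale) (e s)) (Iio 0) :=
    hd2.comp hecont hmem
  have hβ0 : Tendsto β (𝓝[<] 0) (𝓝 (β 0)) := hβ.continuous.continuousAt.mono_left nhdsWithin_le_nhds
  have hβ1' : Tendsto (deriv β) (𝓝[<] 0) (𝓝 0) := by
    have := hβd.continuous.tendsto 0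
    rw [hβ1] at this
    exact this.mono_left nhdsWithin_le_nhds
  have hda := (F.tendsto_deriv_scale ht₀ hq hr ha).comp hel
  have hβne := (hβpos 0).ne'
  have hinv : Tendsto (fun s => (deriv F.scale (e s))⁻¹) (𝓝[<] 0) (𝓝 0) := hda.inv_tendsto_atTop
  refine isFIUFactor_comp_negRoot (A := F.scale ∘ e)
    (A₁ := fun s => deriv F.scale (e s) * (F.scale (e s) * β s))
    (A₂ := fun s => deriv (deriv F.scale) (e s) * (F.scale (e s) * β s) * (F.scale (e s) * β s) +
      deriv F.scale (e s) * (deriv F.scale (e s) * (F.scale (e s) * β s) * β s +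
        F.scale (e s) * deriv β s)) hn ?_ ?_ ?_ ?_ ?_ ?_ ?_ ?_ hq hnq
  · exact fun s hs => (ha1 _ (hmem s hs)).comp s (he s hs)
  · exact fun s hs => ((ha2 _ (hmem s hs)).comp s (he s hs)).mul
      (((ha1 _ (hmem s hs)).comp s (he s hs)).mul (hβ.differentiable (by simp) s).hasDerivAt)
  · have h1 := hβ.continuous.continuousOn (s := Iio 0)
    have h2 := hβd.continuous.continuousOn (s := Iio 0)
    have h3 : ContinuousOn (fun s => F.scale (e s)) (Iio 0) := hscont
    exact ((hddcont.mul (h3.mul h1)).mul (h3.mul h1)).add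
      (hdcont.mul (((hdcont.mul (h3.mul h1)).mul h1).add (h3.mul h2)))
  · exact fun s hs => F.scale_pos _ (hmem s hs)
  · filter_upwards [hda.eventually_gt_atTop 0, self_mem_nhdsWithin] with s h1 hs
    exact mul_pos h1 (mul_pos (F.scale_pos _ (hmem s hs)) (hβpos s))
  · exact ha.comp hel
  · have := hinv.mul (hβ0.inv₀ hβne)
    rw [zero_mul] at this
    refine this.congr' ?_
    filter_upwards [hda.eventually_gt_atTop 0, self_mem_nhdsWithin] with s h1 hs
    have h2 := (F.scale_pos _ (hmem s hs)).ne'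
    have h3 := (hβpos s).ne'
    have h4 : deriv F.scale (e s) ≠ 0 := h1.ne'
    simp only [Function.comp_apply]
    field_simp
  -- For `A = a ∘ e`, with `A' = ȧ a β`, one finds `A A'' / A'² = ä a / ȧ² + 1 + β' / (ȧ β²)`. The
  -- last term vanishes in the limit because `ȧ → ∞`.
  · have h5 := ((hr.comp hel).add_const 1).add
      ((hinv.mul hβ1').mul ((hβ0.pow 2).inv₀ (pow_ne_zero 2 hβne)))
    rw [zero_mul, zero_mul, add_zero, add_comm q 1] at h5
    refine h5.congr' ?_
    filter_upwards [hda.eventually_gt_atTop 0, self_mem_nhdsWithin] with s h1 hs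
    have h2 := (F.scale_pos _ (hmem s hs)).ne'
    have h3 := (hβpos s).ne'
    have h4 : deriv F.scale (e s) ≠ 0 := h1.ne'
    simp only [Function.comp_apply, FRWModel.accelRatio]
    field_simp
    ring

end ConformalFactor

/-! ### Tensor fields and charts on the coordinate space -/

section ModelSpace

/-- On the model space all tangent trivializations are the identity. Hence regularity of a metric as
a bundle section is ordinary regularity of a map into bilinear forms. -/
theorem inCoordinates_model (x₀ x : Coord)
    (B : TangentSpace 𝓘(ℝ, Coord) x →L[ℝ] TangentSpace 𝓘(ℝ, Coord) x →L[ℝ] ℝ) :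
    ContinuousLinearMap.inCoordinates Coord (TangentSpace 𝓘(ℝ, Coord) : Coord → Type) (Coord →L[ℝ] ℝ)
      (fun p : Coord => TangentSpace 𝓘(ℝ, Coord) p →L[ℝ] ℝ) x₀ x x₀ x B =
      (B : Coord →L[ℝ] Coord →L[ℝ] ℝ) := by
  refine ContinuousLinearMap.ext fun v => ContinuousLinearMap.ext fun w => ?_
  have hs : ∀ v : Coord, (trivializationAt Coord (TangentSpace 𝓘(ℝ, Coord)) x₀).symm x v = v :=
    fun v => ((trivializationAt Coord (TangentSpace 𝓘(ℝ, Coord)) x₀).symmL_apply (R := ℝ)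
      (mem_univ x) v).symm.trans
      (congrArg (fun L : Coord →L[ℝ] Coord => L v) (TangentBundle.symmL_model_space x₀ x))
  refine (inCoordinates_apply_eq₂ (E₃ := fun _ : Coord => ℝ) (F₃ := ℝ) (ϕ := B) (v := v) (w := w)
    (x₀ := x₀) ?_ ?_ ?_).trans ?_
  · exact mem_univ x
  · exact mem_univ x
  · exact mem_univ x
  · rw [hs, hs]
    simp
    rfl

theorem contMDiff_bilinear {n : WithTop ℕ∞} {G : Coord → Coord →L[ℝ] Coord →L[ℝ] ℝ}
    (hG : ContDiff ℝ n G) :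
    ContMDiff 𝓘(ℝ, Coord) (𝓘(ℝ, Coord).prod 𝓘(ℝ, Coord →L[ℝ] Coord →L[ℝ] ℝ)) n
      (fun p => Bundle.TotalSpace.mk' (Coord →L[ℝ] Coord →L[ℝ] ℝ)
        (E := fun p : Coord =>
          TangentSpace 𝓘(ℝ, Coord) p →L[ℝ] TangentSpace 𝓘(ℝ, Coord) p →L[ℝ] ℝ) p (G p)) := by
  intro x
  rw [contMDiffAt_hom_bundle]
  refine ⟨contMDiffAt_id, ?_⟩
  refine (hG.contMDiff x).congr_of_eventuallyEq (Eventually.of_forall fun y => ?_)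
  exact inCoordinates_model x y (G y)

/-- A smooth change of coordinates belongs to the maximal atlas of the coordinate space. -/
theorem mem_maximalAtlas_of_contDiffOn {φ : OpenPartialHomeomorph Coord Coord}
    (h : ContDiffOn ℝ ∞ φ φ.source) (h' : ContDiffOn ℝ ∞ φ.symm φ.target) :
    φ ∈ IsManifold.maximalAtlas 𝓘(ℝ, Coord) ∞ Coord := by
  refine StructureGroupoid.mem_maximalAtlas_of_mem_groupoid _ ?_
  rw [contDiffGroupoid, mem_groupoid_of_pregroupoid]
  constructor
  · simpa [contDiffPregroupoid] using h
  · simpa [contDiffPregroupoid] using h'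

end ModelSpace

/-! ### The unphysical metric -/

section ModelExtension

/-- Global coordinates on the unit spatial slice. -/
theorem FRWModel.exists_spatial_chart (F : FRWModel) :
    ∃ j : OpenPartialHomeomorph (EuclideanSpace ℝ (Fin 3)) (EuclideanSpace ℝ (Fin 3)),
      j.source = univ ∧ j.target = {x | 0 < 1 - (F.k : ℝ) * ‖x‖ ^ 2} ∧ ContDiff ℝ ∞ j ∧
        ContDiffOn ℝ ∞ j.symm j.target := by
  rcases F.k_mem with hk | hk | hk
  · refine ⟨OpenPartialHomeomorph.refl _, rfl, ?_, contDiff_id, contDiffOn_id⟩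
    ext x
    simp only [OpenPartialHomeomorph.refl_target, mem_univ, mem_ofPred_eq, true_iff, hk]
    push_cast
    nlinarith [sq_nonneg ‖x‖]
  · refine ⟨OpenPartialHomeomorph.refl _, rfl, ?_, contDiff_id, contDiffOn_id⟩
    ext x
    simp [hk]
  -- For `k = 1` the slice is the unit ball, which is diffeomorphic to the whole space; the
  -- extension can then live on all of `Coord` for every `k`.
  · refine ⟨OpenPartialHomeomorph.univUnitBall, rfl, ?_,
      OpenPartialHomeomorph.contDiff_univUnitBall, OpenPartialHomeomorph.contDiffOn_univUnitBall_symm⟩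
    ext x
    have h1 := norm_nonneg x
    simp only [OpenPartialHomeomorph.univUnitBall, Metric.mem_ball, dist_zero_right, mem_ofPred_eq, hk]
    push_cast
    constructor
    · intro h; nlinarith
    · intro h; nlinarith

/-- The bilinear form of the metric of the unit spatial slice. -/
noncomputable def FRWModel.spatialForm (F : FRWModel) (x v w : EuclideanSpace ℝ (Fin 3)) : ℝ :=
  inner ℝ v w + (F.k : ℝ) * (inner ℝ x v * inner ℝ x w) / (1 - (F.k : ℝ) * ‖x‖ ^ 2)

/-- After multiplication by `1 - k ‖x‖²` the form is `‖v‖² (1 - k ‖x‖²) + k ⟨x, v⟩²`. Only `k = -1`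
needs an argument: there the Cauchy–Schwarz inequality leaves at least `‖v‖²`. -/
theorem FRWModel.spatialForm_pos (F : FRWModel) {x v : EuclideanSpace ℝ (Fin 3)}
    (hx : 0 < 1 - (F.k : ℝ) * ‖x‖ ^ 2) (hv : v ≠ 0) : 0 < F.spatialForm x v v := by
  have hv' : 0 < ‖v‖ ^ 2 := by positivity
  have hcs : inner ℝ x v * inner ℝ x v ≤ ‖x‖ ^ 2 * ‖v‖ ^ 2 := by
    have := abs_real_inner_le_norm x v
    rw [← abs_mul_abs_self, ← mul_pow, sq]
    exact mul_self_le_mul_self (abs_nonneg _) this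
  rw [spatialForm, real_inner_self_eq_norm_sq]
  have h1 := mul_self_nonneg (inner ℝ x v : ℝ)
  rw [← sub_pos, sub_zero, ← mul_pos_iff_of_pos_right hx, add_mul, div_mul_cancel₀ _ hx.ne']
  rcases F.k_mem with hk | hk | hk <;> rw [hk] at hx ⊢ <;> push_cast at hx ⊢
  · nlinarith
  · linarith
  · have := mul_pos hv' hx
    linarith

variable (F : FRWModel) (β : ℝ → ℝ) (j : EuclideanSpace ℝ (Fin 3) → EuclideanSpace ℝ (Fin 3))

/-- The unphysical metric `-β² ds² + j^* σ`, where `σ` is the metric of the unit spatial slice. -/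
noncomputable def FRWModel.extendedMetric (z : Coord) : Coord →L[ℝ] Coord →L[ℝ] ℝ :=
  let D : Coord →L[ℝ] EuclideanSpace ℝ (Fin 3) :=
    (fderiv ℝ j z.2).comp (ContinuousLinearMap.snd ℝ ℝ (EuclideanSpace ℝ (Fin 3)))
  (-β z.1 ^ 2) • (ContinuousLinearMap.fst ℝ ℝ (EuclideanSpace ℝ (Fin 3))).smulRight
      (ContinuousLinearMap.fst ℝ ℝ (EuclideanSpace ℝ (Fin 3))) +
    ((isBoundedBilinearMap_inner (𝕜 := ℝ)
      (E := EuclideanSpace ℝ (Fin 3))).toContinuousLinearMap.bilinearComp D D +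
      ((F.k : ℝ) / (1 - (F.k : ℝ) * ‖j z.2‖ ^ 2)) •
        ((innerSL ℝ (j z.2)).comp D).smulRight ((innerSL ℝ (j z.2)).comp D))

theorem FRWModel.extendedMetric_apply (z v w : Coord) :
    F.extendedMetric β j z v w = -β z.1 ^ 2 * (v.1 * w.1) +
      F.spatialForm (j z.2) (fderiv ℝ j z.2 v.2) (fderiv ℝ j z.2 w.2) := by
  simp [extendedMetric, spatialForm]
  ring

variable {F β j}

theorem FRWModel.contDiff_extendedMetric (hβ : ContDiff ℝ 2 β) (hj : ContDiff ℝ ∞ j)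
    (hpos : ∀ x, 0 < 1 - (F.k : ℝ) * ‖j x‖ ^ 2) : ContDiff ℝ 2 (F.extendedMetric β j) := by
  have hj2 : ContDiff ℝ 2 fun z : Coord => j z.2 := (contDiff_infty.1 hj 2).comp contDiff_snd
  have hD : ∀ v : EuclideanSpace ℝ (Fin 3), ContDiff ℝ 2 fun z : Coord => fderiv ℝ j z.2 v := fun v =>
    ((contDiff_infty.1 (contDiff_infty_iff_fderiv.1 hj).2 2).comp contDiff_snd).clm_apply contDiff_const
  rw [contDiff_clm_apply_iff]
  intro v
  rw [contDiff_clm_apply_iff]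
  intro w
  simp only [extendedMetric_apply, spatialForm]
  refine (((hβ.comp contDiff_fst).pow 2).neg.mul contDiff_const).add
    (((hD v.2).inner ℝ (hD w.2)).add ((contDiff_const.mul
      ((hj2.inner ℝ (hD v.2)).mul (hj2.inner ℝ (hD w.2)))).div
      (contDiff_const.sub (contDiff_const.mul (hj2.norm_sq ℝ))) fun z => (hpos z.2).ne'))

end ModelExtension

/-! ### The extended space-time and its cosmic time -/

section ExtendedSpacetime

variable {F : FRWModel} {β : ℝ → ℝ} {j : EuclideanSpace ℝ (Fin 3) → EuclideanSpace ℝ (Fin 3)}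

theorem FRWModel.spatialForm_comm (F : FRWModel) (x v w : EuclideanSpace ℝ (Fin 3)) :
    F.spatialForm x v w = F.spatialForm x w v := by
  rw [spatialForm, spatialForm, real_inner_comm, mul_comm (inner ℝ x v : ℝ)]

theorem FRWModel.extendedMetric_time (z v : Coord) (c : ℝ) :
    F.extendedMetric β j z v (c, 0) = -β z.1 ^ 2 * (v.1 * c) := by
  simp [extendedMetric_apply, spatialForm]

/-- The space-time in which an FRW model with blowing up scale factor is conformally embedded. -/
noncomputable def FRWModel.extendedSpacetime (F : FRWModel) (hβ : ContDiff ℝ 2 β)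
    (hβpos : ∀ s, 0 < β s) (hj : ContDiff ℝ ∞ j) (hpos : ∀ x, 0 < 1 - (F.k : ℝ) * ‖j x‖ ^ 2)
    (hinj : ∀ x v, v ≠ 0 → fderiv ℝ j x v ≠ 0) : Spacetime Coord where
  metric := fun z => F.extendedMetric β j z
  metric_symm := fun z v w => by
    refine (F.extendedMetric_apply β j z v w).trans
      (Eq.trans ?_ (F.extendedMetric_apply β j z w v).symm)
    rw [mul_comm (v : Coord).1, F.spatialForm_comm]
  metric_lorentzian := fun z => by
    refine ⟨((1, 0) : Coord), ?_, fun w hw hw0 => ?_⟩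
    · refine (F.extendedMetric_time (β := β) (j := j) z (1, 0) 1).trans_lt ?_
      have := hβpos z.1
      simp only [mul_one]
      nlinarith
    · have h1 : β z.1 ^ 2 * (w : Coord).1 = 0 := by
        have := (F.extendedMetric_apply β j z (1, 0) w).symm.trans hw
        simpa [spatialForm] using this
      have h2 : (w : Coord).1 = 0 := by
        rcases mul_eq_zero.1 h1 with h | h
        · exact absurd h (pow_ne_zero 2 (hβpos _).ne')
        · exact h
      have h3 : (w : Coord).2 ≠ 0 := fun h => hw0 (Prod.ext h2 h)
      refine lt_of_lt_of_eq ?_ (F.extendedMetric_apply β j z w w).symm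
      rw [h2, mul_zero, mul_zero, zero_add]
      exact F.spatialForm_pos (hpos _) (hinj _ _ h3)
  metric_continuous := contMDiff_bilinear ((contDiff_extendedMetric hβ hj hpos).of_le (by simp))
  orientation := fun _ => ((1, 0) : Coord)
  orientation_timelike := fun z => by
    refine (F.extendedMetric_time (β := β) (j := j) z (1, 0) 1).trans_lt ?_
    have := hβpos z.1
    simp only [mul_one]
    nlinarith
  orientation_continuous := contMDiff_vectorSpace_iff_contDiff.2 contDiff_const

/-- Odd powers of the time coordinate are cosmic time functions. -/
theorem FRWModel.isCosmicTime_extendedSpacetime (hβ : ContDiff ℝ 2 β) (hβpos : ∀ s, 0 < β s)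
    (hj : ContDiff ℝ ∞ j) (hpos : ∀ x, 0 < 1 - (F.k : ℝ) * ‖j x‖ ^ 2)
    (hinj : ∀ x v, v ≠ 0 → fderiv ℝ j x v ≠ 0) {n : ℕ} (hn : Odd n) :
    (F.extendedSpacetime hβ hβpos hj hpos hinj).IsCosmicTime fun z => z.1 ^ n := by
  intro γ a b hab ⟨hγ, hcausal⟩
  have hγ' : ContDiffOn ℝ 1 γ (Icc a b) := contMDiffOn_iff_contDiffOn.1 hγ
  have hfst : StrictMonoOn (fun s => (γ s).1) (Icc a b) := by
    refine strictMonoOn_of_deriv_pos (convex_Icc a b) (continuous_fst.comp_continuousOn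
      hγ'.continuousOn) fun s hs => ?_
    have hsI : s ∈ Icc a b := interior_subset hs
    have hnhds : Icc a b ∈ 𝓝 s := mem_interior_iff_mem_nhds.1 hs
    have hd : HasDerivAt γ (fderivWithin ℝ γ (Icc a b) s 1) s := by
      have := ((hγ'.differentiableOn (by simp)) s hsI).hasFDerivWithinAt.hasFDerivAt hnhds
      exact this.hasDerivAt
    have hd1 : HasDerivAt (fun s => (γ s).1) (fderivWithin ℝ γ (Icc a b) s 1).1 s :=
      hasDerivAt_fst_comp hd
    rw [hd1.deriv]
    -- Pairing the velocity with the orientation `(1, 0)` gives `-β²` times its time component, so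
    -- future-directedness alone makes that component positive.
    have h1 := (hcausal s hsI).2.2
    rw [mfderivWithin_eq_fderivWithin] at h1
    have h2 : -β (γ s).1 ^ 2 * ((fderivWithin ℝ γ (Icc a b) s 1).1 * 1) < 0 :=
      (F.extendedMetric_time (β := β) (j := j) (γ s) _ 1).symm.trans_lt h1
    have := pow_pos (hβpos (γ s).1) 2
    rw [mul_one] at h2
    by_contra h3
    nlinarith [not_lt.1 h3]
  exact hn.strictMono_pow.comp_strictMonoOn hfst

end ExtendedSpacetime

/-! ### Existence of a regular Future Isotropic Universe -/

/-- An FRW model with a suitable conformal time has a Future Isotropic Universe. -/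
theorem FRWModel.admitsRegularFIU_of_conformalTime (F : FRWModel) {lam : EReal}
    {e : OpenPartialHomeomorph ℝ ℝ} {β : ℝ → ℝ} (hes : e.source = Iio 0) (het : e.target = F.dom)
    (hec : ContDiffOn ℝ ∞ e (Iio 0)) (hei : ContDiffOn ℝ ∞ e.symm F.dom) (hβ : ContDiff ℝ 2 β)
    (hβpos : ∀ s, 0 < β s) (hed : ∀ s < 0, HasDerivAt e (F.scale (e s) * β s) s) {n : ℕ}
    (hn : Odd n) (hfac : IsFIUFactor (F.scale ∘ e ∘ negRoot n) lam) :
    AdmitsRegularFIU F.domain F.metric F.flow lam := by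
  obtain ⟨j, hjs, hjt, hj, hji⟩ := F.exists_spatial_chart
  have hjU : ∀ x, 0 < 1 - (F.k : ℝ) * ‖j x‖ ^ 2 := fun x => by
    have : j x ∈ j.target := j.map_source (by rw [hjs]; exact mem_univ x)
    rw [hjt] at this
    exact this
  have hjd : ∀ x, DifferentiableAt ℝ j x := fun x => hj.differentiable (by simp) x
  -- Differentiate `j.symm ∘ j = id`.
  have hinj : ∀ x v, v ≠ 0 → fderiv ℝ j x v ≠ 0 := fun x v hv h0 => by
    have hx : x ∈ j.source := by rw [hjs]; exact mem_univ x
    have h1 : DifferentiableAt ℝ j.symm (j x) :=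
      (hji.differentiableOn (by simp)).differentiableAt
        (j.open_target.mem_nhds (j.map_source hx))
    have h2 := (h1.hasFDerivAt.comp x (hjd x).hasFDerivAt).congr_of_eventuallyEq
      (f := j.symm ∘ j) (f₁ := id) (Eventually.of_forall fun y => (j.left_inv (by
        rw [hjs]; exact mem_univ y)).symm)
    have h3 := congrArg (fun L => L v) (h2.unique (hasFDerivAt_id x))
    simp only [ContinuousLinearMap.comp_apply, h0, map_zero, ContinuousLinearMap.id_apply] at h3
    exact hv h3.symm
  have hmem : ∀ s < 0, e s ∈ F.dom := fun s hs => het ▸ e.map_source (by rw [hes]; exact hs)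
  set φ : OpenPartialHomeomorph Coord Coord := e.prod j with hφ
  have hsrc : φ.source = {z : Coord | z.1 < 0} := by
    ext z
    simp [hφ, hes, hjs]
  have htgt : φ.target = F.domain := by
    ext z
    simp only [hφ, OpenPartialHomeomorph.prod_target, het, hjt, mem_prod]
    rfl
  have hpow : ∀ s : ℝ, s ^ n < 0 ↔ s < 0 := fun s => by
    simpa [zero_pow hn.pos.ne'] using hn.strictMono_pow.lt_iff_lt (a := s) (b := 0)
  have hder : ∀ z : Coord, z.1 < 0 → ∀ v : Coord, mfderiv 𝓘(ℝ, Coord) 𝓘(ℝ, Coord) φ z v =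
      ((F.scale (e z.1) * β z.1 * v.1, fderiv ℝ j z.2 v.2) : Coord) := fun z hz v => by
    have h1 : HasFDerivAt (Prod.map e j) _ z :=
      (hed z.1 hz).hasFDerivAt.prodMap z (hjd z.2).hasFDerivAt
    rw [mfderiv_eq_fderiv, show (φ : Coord → Coord) = Prod.map e j from rfl, h1.fderiv]
    exact Prod.ext (mul_comm _ _) rfl
  -- The root undoes `T = sⁿ`, so `Ω(T)` is the scale factor at the physical time `e s`.
  have hΩ : ∀ z : Coord, z.1 < 0 → (F.scale ∘ e ∘ negRoot n) (z.1 ^ n) = F.scale (e z.1) :=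
    fun z hz => by
      simp only [Function.comp_apply]
      rw [negRoot_pow_self hn hz]
  set S := F.extendedSpacetime hβ hβpos hj hjU hinj with hS
  refine ⟨Coord, inferInstance, inferInstance, inferInstance, inferInstance, inferInstance,
    inferInstance, S, fun z => z.1 ^ n, F.scale ∘ e ∘ negRoot n, φ, ?_, hfac, ?_⟩
  · refine
      { time_smooth := (contDiff_fst.pow n).contMDiff
        cosmicTime := isCosmicTime_extendedSpacetime hβ hβpos hj hjU hinj hn
        chart_mem := mem_maximalAtlas_of_contDiffOn ?_ ?_
        chart_source := ?_
        chart_target := htgt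
        orientation_compat := ?_
        factor_pos := ?_
        conformal := ?_
        event_nonempty := ⟨(0, 0), by simp [hn.pos.ne']⟩
        metric_regular := ⟨univ, isOpen_univ, subset_univ _,
          (contMDiff_bilinear (contDiff_extendedMetric hβ hj hjU)).contMDiffOn⟩ }
    · rw [hsrc]
      exact (hec.comp contDiff_fst.contDiffOn fun z hz => hz).prodMk
        (hj.comp contDiff_snd).contDiffOn
    · rw [htgt]
      refine (hei.comp contDiff_fst.contDiffOn fun z hz => hz.1).prodMk
        (hji.comp contDiff_snd.contDiffOn fun z hz => ?_)
      rw [hjt]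
      exact hz.2
    · rw [hsrc]
      ext z
      exact (hpow z.1).symm
    · intro z hz v hv
      have hz' := (hpow z.1).1 hz
      rw [hder z hz' v] at hv
      have h1 : F.scale (e z.1) * β z.1 * (v : Coord).1 = 1 := congrArg Prod.fst hv
      have h2 := mul_pos (F.scale_pos _ (hmem _ hz')) (hβpos z.1)
      have h3 : 0 < (v : Coord).1 := pos_of_mul_pos_right (h1.symm ▸ one_pos) h2.le
      refine (F.extendedMetric_time (β := β) (j := j) z v 1).trans_lt ?_
      have := mul_pos (pow_pos (hβpos z.1) 2) h3
      rw [mul_one]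
      linarith
    · intro z hz
      have hz' := (hpow z.1).1 hz
      rw [hΩ z hz']
      exact F.scale_pos _ (hmem _ hz')
    · intro z hz v w
      have hz' := (hpow z.1).1 hz
      rw [hΩ z hz', hder z hz' v, hder z hz' w]
      refine Eq.trans ?_ (congrArg (F.scale (e z.1) ^ 2 * ·)
        (F.extendedMetric_apply β j z v w).symm)
      change -(F.scale (e z.1) * β z.1 * (v : Coord).1 * (F.scale (e z.1) * β z.1 * (w : Coord).1)) +
        F.scale (e z.1) ^ 2 * F.spatialForm (j z.2) _ _ = _
      ring
  -- `β⁻¹ ∂/∂s` is a unit vector for `-β² ds²`; as `dt/ds = a β`, it maps to `a ∂/∂t`. It is `C²`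
  -- everywhere because `β` is.
  · refine ⟨fun z => (((β z.1)⁻¹, 0) : Coord), fun z => ?_, fun z hz => ?_, univ, isOpen_univ,
      subset_univ _, ?_⟩
    · refine (F.extendedMetric_time (β := β) (j := j) z ((β z.1)⁻¹, 0) _).trans ?_
      have := (hβpos z.1).ne'
      simp only
      field_simp
    · have hz' := (hpow z.1).1 hz
      rw [hΩ z hz', hder z hz' _]
      have := (hβpos z.1).ne'
      simp only [flow, map_zero, Prod.smul_mk, smul_zero, smul_eq_mul, mul_one]
      rw [mul_assoc, mul_inv_cancel₀ this, mul_one]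
    · refine contMDiffOn_vectorSpace_iff_contDiffOn.2 (ContDiff.contDiffOn ?_)
      exact ((hβ.comp contDiff_fst).inv fun z => (hβpos z.1).ne').prodMk contDiff_const

/-- The existence part of the theorem on Future Isotropic Universes. -/
theorem FRWModel.exists_admitsRegularFIU (F : FRWModel) {t₀ q : ℝ} (ht₀ : IsLUB F.dom t₀)
    (hq : 0 < q) (hr : Tendsto F.accelRatio (𝓝[<] t₀) (𝓝 q))
    (ha : Tendsto F.scale (𝓝[<] t₀) atTop) :
    ∃ lam : EReal, 1 < lam ∧ lam < ⊤ ∧ AdmitsRegularFIU F.domain F.metric F.flow lam := by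
  obtain ⟨e, β, hes, het, hec, hei, hβ, hβpos, -, hβ1, hed, hel⟩ :=
    exists_smooth_conformal_time F.dom_open F.dom_interval F.dom_nonempty ht₀ F.scale_contDiffOn
      F.scale_pos ha
  have hmem : ∀ s < 0, e s ∈ F.dom := fun s hs => het ▸ e.map_source (by rw [hes]; exact hs)
  -- `T = s` gives `λ = 1 + q`, which is excluded only for `q = 1`; then `T = s³` gives `λ = 4`.
  obtain ⟨n, hn, hnq⟩ : ∃ n : ℕ, Odd n ∧ 1 + n * q ≠ 2 := by
    by_cases h : q = 1
    · exact ⟨3, by decide, by rw [h]; norm_num⟩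
    · exact ⟨1, odd_one, fun h' => h (by push_cast at h'; linarith)⟩
  have hnpos : (0 : ℝ) < n := Nat.cast_pos.2 hn.pos
  refine ⟨((1 + n * q : ℝ) : EReal), ?_, EReal.coe_lt_top _, ?_⟩
  · have := mul_pos hnpos hq
    exact_mod_cast (show (1 : ℝ) < 1 + n * q by linarith)
  · exact F.admitsRegularFIU_of_conformalTime hes het hec hei hβ hβpos hed hn
      (F.isFIUFactor ht₀ hq hr ha hβ hβpos hβ1 hmem hed hel hn hnq)

/-! ### Time reversal, exchanging future and past structures -/

section Reflection

/-- Reflection leaves the second derivative unchanged and reverses the sign of the first, which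
enters `L` only through its square. -/
theorem conformalL_comp_neg (Ω : ℝ → ℝ) (I : Set ℝ) (T : ℝ) :
    conformalL (fun T => Ω (-T)) I T = conformalL Ω (-I) (-T) := by
  have h1 : ∀ T, derivWithin (fun T => Ω (-T)) I T = -derivWithin Ω (-I) (-T) := fun T =>
    derivWithin_comp_neg Ω I T
  have h2 : iteratedDerivWithin 2 (fun T => Ω (-T)) I T = iteratedDerivWithin 2 Ω (-I) (-T) := by
    rw [iteratedDerivWithin_succ, iteratedDerivWithin_one, iteratedDerivWithin_succ,
      iteratedDerivWithin_one, funext h1, derivWithin.fun_neg,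
      derivWithin_comp_neg (f := derivWithin Ω (-I)), neg_neg]
  rw [conformalL, conformalL, h1, h2, div_neg, neg_sq]

theorem neg_Ico_neg_zero (c : ℝ) : -Ico (-c) 0 = Ioc 0 c := by simp

theorem neg_Ioc_zero (c : ℝ) : -Ioc 0 c = Ico (-c) 0 := by simp

theorem tendsto_neg_nhdsLT_zero : Tendsto (fun T : ℝ => -T) (𝓝[<] 0) (𝓝[>] 0) := by
  simpa using tendsto_neg_nhdsLT (a := (0 : ℝ))

theorem tendsto_neg_nhdsGT_zero : Tendsto (fun T : ℝ => -T) (𝓝[>] 0) (𝓝[<] 0) := by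
  simpa using tendsto_neg_nhdsGT (a := (0 : ℝ))

theorem IsFIUFactor.comp_neg {Ω : ℝ → ℝ} {lam : EReal} (h : IsFIUFactor Ω lam) :
    IsPIUFactor (fun T => Ω (-T)) lam := by
  obtain ⟨h1, c, hc, h2, h3, h4, h5, h6, h7, h8⟩ := h
  have hmem : ∀ T ∈ Ioc 0 c, -T ∈ Ico (-c) 0 := fun T hT =>
    ⟨neg_le_neg hT.2, neg_lt_zero.2 hT.1⟩
  have hL : conformalL (fun T => Ω (-T)) (Ioc 0 c) = fun T => conformalL Ω (Ico (-c) 0) (-T) :=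
    funext fun T => by rw [conformalL_comp_neg, neg_Ioc_zero]
  refine ⟨h1.comp tendsto_neg_nhdsGT_zero, c, hc, h2.comp contDiff_neg.contDiffOn hmem, ?_,
    fun T hT => h4 _ (hmem T hT), fun T hT => ?_, ?_, ?_, h8⟩
  · exact fun x hx y hy hxy => h3 (hmem y hy) (hmem x hx) (neg_lt_neg hxy)
  · rw [derivWithin_comp_neg (f := Ω), neg_Ioc_zero, neg_ne_zero]
    exact h5 _ (hmem T hT)
  · rw [hL]
    exact h6.comp continuous_neg.continuousOn hmem
  · simp only [conformalL_comp_neg, neg_Ioc_zero]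
    exact h7.comp tendsto_neg_nhdsGT_zero

theorem IsPIUFactor.comp_neg {Ω : ℝ → ℝ} {lam : EReal} (h : IsPIUFactor Ω lam) :
    IsFIUFactor (fun T => Ω (-T)) lam := by
  obtain ⟨h1, c, hc, h2, h3, h4, h5, h6, h7, h8⟩ := h
  have hmem : ∀ T ∈ Ico (-c) 0, -T ∈ Ioc 0 c := fun T hT =>
    ⟨neg_pos.2 hT.2, neg_le.1 hT.1⟩
  have hL : conformalL (fun T => Ω (-T)) (Ico (-c) 0) = fun T => conformalL Ω (Ioc 0 c) (-T) :=
    funext fun T => by rw [conformalL_comp_neg, neg_Ico_neg_zero]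
  refine ⟨h1.comp tendsto_neg_nhdsLT_zero, c, hc, h2.comp contDiff_neg.contDiffOn hmem, ?_,
    fun T hT => h4 _ (hmem T hT), fun T hT => ?_, ?_, ?_, h8⟩
  · exact fun x hx y hy hxy => h3 (hmem y hy) (hmem x hx) (neg_lt_neg hxy)
  · rw [derivWithin_comp_neg (f := Ω), neg_Ico_neg_zero, neg_ne_zero]
    exact h5 _ (hmem T hT)
  · rw [hL]
    exact h6.comp continuous_neg.continuousOn hmem
  · simp only [conformalL_comp_neg, neg_Ico_neg_zero]
    exact h7.comp tendsto_neg_nhdsLT_zero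

variable {N : Type} [TopologicalSpace N] [ChartedSpace Coord N]

/-- Reflection of the time coordinate. -/
def reflectHomeomorph : Coord ≃ₜ Coord :=
  (Homeomorph.neg ℝ).prodCongr (Homeomorph.refl _)

/-- Reflection of the time coordinate, as a linear map. -/
noncomputable def reflectL : Coord →L[ℝ] Coord :=
  (-ContinuousLinearMap.id ℝ ℝ).prodMap (ContinuousLinearMap.id ℝ (EuclideanSpace ℝ (Fin 3)))

theorem reflectL_apply (z : Coord) : reflectL z = (-z.1, z.2) := rfl

theorem contDiff_reflect : ContDiff ℝ ∞ reflectHomeomorph :=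
  contDiff_fst.neg.prodMk contDiff_snd

theorem reflect_mem_contDiffGroupoid :
    reflectHomeomorph.toOpenPartialHomeomorph ∈ contDiffGroupoid ∞ 𝓘(ℝ, Coord) := by
  rw [contDiffGroupoid, mem_groupoid_of_pregroupoid]
  constructor
  · simp [contDiffPregroupoid]
    exact contDiff_reflect.contDiffOn
  · have : ContDiff ℝ ∞ reflectHomeomorph.symm := contDiff_fst.neg.prodMk contDiff_snd
    simp [contDiffPregroupoid]
    exact this.contDiffOn

theorem trans_reflect_mem_maximalAtlas {φ : OpenPartialHomeomorph N Coord}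
    (h : φ ∈ IsManifold.maximalAtlas 𝓘(ℝ, Coord) ∞ N) :
    φ.trans reflectHomeomorph.toOpenPartialHomeomorph ∈
      IsManifold.maximalAtlas 𝓘(ℝ, Coord) ∞ N := by
  intro e' he'
  obtain ⟨h1, h2⟩ := h e' he'
  have hr := reflect_mem_contDiffGroupoid
  constructor
  · rw [OpenPartialHomeomorph.trans_symm_eq_symm_trans_symm, OpenPartialHomeomorph.trans_assoc]
    exact (contDiffGroupoid ∞ 𝓘(ℝ, Coord)).trans ((contDiffGroupoid ∞ 𝓘(ℝ, Coord)).symm hr) h1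
  · rw [← OpenPartialHomeomorph.trans_assoc]
    exact (contDiffGroupoid ∞ 𝓘(ℝ, Coord)).trans h2 hr

theorem mfderiv_trans_reflect {φ : OpenPartialHomeomorph N Coord}
    (h : φ ∈ IsManifold.maximalAtlas 𝓘(ℝ, Coord) ∞ N) {p : N} (hp : p ∈ φ.source)
    (v : TangentSpace 𝓘(ℝ, Coord) p) :
    mfderiv 𝓘(ℝ, Coord) 𝓘(ℝ, Coord) (φ.trans reflectHomeomorph.toOpenPartialHomeomorph) p v =
      reflectL (mfderiv 𝓘(ℝ, Coord) 𝓘(ℝ, Coord) φ p v) := by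
  have h1 : MDifferentiableAt 𝓘(ℝ, Coord) 𝓘(ℝ, Coord) φ p :=
    (contMDiffAt_of_mem_maximalAtlas h hp).mdifferentiableAt (by simp)
  have h2 : HasMFDerivAt 𝓘(ℝ, Coord) 𝓘(ℝ, Coord) reflectHomeomorph (φ p) reflectL :=
    reflectL.hasFDerivAt.hasMFDerivAt
  exact congrArg (fun L => L v) (h2.comp p h1.hasMFDerivAt).mfderiv

variable [IsManifold 𝓘(ℝ, Coord) ∞ N]

/-- The space-time with the opposite time orientation. -/
noncomputable def Spacetime.reverse (S : Spacetime N) : Spacetime N where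
  metric := S.metric
  metric_symm := S.metric_symm
  metric_lorentzian := S.metric_lorentzian
  metric_continuous := S.metric_continuous
  orientation := fun p => -S.orientation p
  orientation_timelike := fun p => by
    simpa using S.orientation_timelike p
  orientation_continuous := by
    have := contMDiffVectorBundle_tangentSpace (N := N) (n := 0) (by simp)
    exact S.orientation_continuous.neg_section

/-- A future-directed causal curve for the reversed orientation, run backwards as `s ↦ γ (a + b -
s)`, is one for the original orientation. The two changes of direction cancel the sign in `-T`. -/
theorem Spacetime.IsCosmicTime.reverse {S : Spacetime N} {T : N → ℝ} (h : S.IsCosmicTime T) :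
    S.reverse.IsCosmicTime fun p => -T p := by
  intro γ a b hab ⟨hγ, hcausal⟩
  set c : ℝ → ℝ := fun s => a + b - s with hc
  have hcmem : MapsTo c (Icc a b) (Icc a b) := fun s hs =>
    ⟨by simp only [hc]; linarith [hs.2], by simp only [hc]; linarith [hs.1]⟩
  have hcd : ContDiff ℝ 1 c := contDiff_const.sub contDiff_id
  have hcurve : S.IsFutureCausalCurve (γ ∘ c) a b := by
    refine ⟨hγ.comp hcd.contMDiff.contMDiffOn hcmem, fun s hs => ?_⟩
    have hu : UniqueMDiffWithinAt 𝓘(ℝ, ℝ) (Icc a b) s :=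
      (uniqueDiffOn_Icc hab s hs).uniqueMDiffWithinAt
    have h1 : mfderivWithin 𝓘(ℝ, ℝ) 𝓘(ℝ, Coord) (γ ∘ c) (Icc a b) s (1 : ℝ) =
        -mfderivWithin 𝓘(ℝ, ℝ) 𝓘(ℝ, Coord) γ (Icc a b) (c s) (1 : ℝ) := by
      rw [mfderivWithin_comp s (hγ.mdifferentiableOn (by simp) _ (hcmem hs))
        ((hcd.contMDiff.mdifferentiable (by simp)) s).mdifferentiableWithinAt hcmem hu]
      have h2 : mfderivWithin 𝓘(ℝ, ℝ) 𝓘(ℝ, ℝ) c (Icc a b) s (1 : ℝ) = (-1 : ℝ) := by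
        rw [mfderivWithin_eq_fderivWithin]
        have h3 : HasDerivAt c (-1) s := (hasDerivAt_id s).const_sub (a + b)
        exact h3.hasDerivWithinAt.derivWithin (uniqueDiffOn_Icc hab s hs)
      refine (congrArg (mfderivWithin 𝓘(ℝ, ℝ) 𝓘(ℝ, Coord) γ (Icc a b) (c s)) h2).trans ?_
      exact map_neg _ (1 : ℝ)
    obtain ⟨h4, h5, h6⟩ := hcausal (c s) (hcmem hs)
    rw [h1]
    refine ⟨neg_ne_zero.2 h4, ?_, ?_⟩
    · have h7 : S.metric (γ (c s)) _ _ ≤ 0 := h5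
      simpa using h7
    · have h7 : S.metric (γ (c s)) _ (-S.orientation (γ (c s))) < 0 := h6
      simpa using h7
  have hm := h (γ ∘ c) a b hab hcurve
  intro x hx y hy hxy
  have := hm (hcmem hy) (hcmem hx) (by simp only [hc]; linarith)
  simpa [hc] using this

namespace FRWModel

/-- The time reverse of an FRW model. -/
def reflect (F : FRWModel) : FRWModel where
  k := F.k
  k_mem := F.k_mem
  dom := Neg.neg ⁻¹' F.dom
  dom_open := F.dom_open.preimage continuous_neg
  dom_interval := ⟨fun _ hx _ hy _ hz =>
    F.dom_interval.out hy hx ⟨neg_le_neg hz.2, neg_le_neg hz.1⟩⟩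
  dom_nonempty := by
    obtain ⟨t, ht⟩ := F.dom_nonempty
    exact ⟨-t, by simpa using ht⟩
  scale := fun t => F.scale (-t)
  scale_pos := fun t ht => F.scale_pos _ ht
  scale_contDiffOn := F.scale_contDiffOn.comp contDiff_neg.contDiffOn fun _ ht => ht

theorem reflect_reflect (F : FRWModel) : F.reflect.reflect = F := by
  obtain ⟨k, hk, dom, h1, h2, h3, scale, h4, h5⟩ := F
  simp only [reflect, neg_neg, ← preimage_comp]
  congr 1
  ext t
  simp

theorem accelRatio_reflect (F : FRWModel) (t : ℝ) : F.reflect.accelRatio t = F.accelRatio (-t) := by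
  have h1 : ∀ f : ℝ → ℝ, deriv (fun t => f (-t)) = fun t => -deriv f (-t) := fun f =>
    funext fun t => deriv_comp_neg f t
  have h2 : deriv (deriv fun t => F.scale (-t)) t = deriv (deriv F.scale) (-t) := by
    rw [h1, deriv.fun_neg, h1, neg_neg]
  simp only [accelRatio, reflect]
  rw [h2, h1, neg_sq]

theorem metric_reflect (F : FRWModel) (z v w : Coord) :
    F.reflect.metric (reflectL z) (reflectL v) (reflectL w) = F.metric z v w := by
  simp [metric, reflect, reflectL_apply]

/-- The manifold and its metric are kept; the cosmic time, the orientation and the physical time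
coordinate change sign together. The region `M` is the same set, and the FRW metric is invariant by
`metric_reflect`. -/
theorem isConformalExtension_reflect {F : FRWModel} {S : Spacetime N} {T : N → ℝ} {Ω : ℝ → ℝ}
    {M : Set N} {φ : OpenPartialHomeomorph N Coord}
    (h : IsConformalExtension F.domain F.metric F.flow S T Ω M φ) :
    IsConformalExtension F.reflect.domain F.reflect.metric F.reflect.flow S.reverse (fun p => -T p)
      (fun T => Ω (-T)) M (φ.trans reflectHomeomorph.toOpenPartialHomeomorph) where
  time_smooth := h.time_smooth.neg
  cosmicTime := h.cosmicTime.reverse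
  chart_mem := trans_reflect_mem_maximalAtlas h.chart_mem
  chart_source := by simp [h.chart_source]
  chart_target := by
    ext z
    simp [h.chart_target, domain, reflect, reflectHomeomorph]
  orientation_compat := fun p hp v hv => by
    have hp' : p ∈ φ.source := h.chart_source ▸ hp
    have h0 : reflectL (mfderiv 𝓘(ℝ, Coord) 𝓘(ℝ, Coord) φ p v) = ((1, 0) : Coord) :=
      (mfderiv_trans_reflect h.chart_mem hp' v).symm.trans hv
    have h1 : mfderiv 𝓘(ℝ, Coord) 𝓘(ℝ, Coord) φ p (-v) = F.flow (φ p) := by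
      refine (map_neg _ v).trans (Prod.ext ?_ ?_)
      · have h3 := congrArg (fun z : Coord => z.1) h0
        exact h3
      · have h3 := congrArg (fun z : Coord => -z.2) h0
        exact h3.trans neg_zero
    have h2 := h.orientation_compat p hp (-v) h1
    change S.metric p v (-S.orientation p) < 0
    simpa using h2
  factor_pos := fun p hp => by simpa using h.factor_pos p hp
  conformal := fun p hp v w => by
    have hp' : p ∈ φ.source := h.chart_source ▸ hp
    rw [mfderiv_trans_reflect h.chart_mem hp', mfderiv_trans_reflect h.chart_mem hp', neg_neg]
    exact (F.metric_reflect (φ p) _ _).trans (h.conformal p hp v w)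
  event_nonempty := by
    obtain ⟨p, hp⟩ := h.event_nonempty
    exact ⟨p, by simpa using hp⟩
  metric_regular := by
    obtain ⟨U, hU, hsub, hreg⟩ := h.metric_regular
    exact ⟨U, hU, fun p hp => hsub (neg_eq_zero.1 hp), hreg⟩

/-- The reflected fluid flow is the opposite of the old one, so the regular unit field is replaced
by its negative. -/
theorem isFlowRegular_reflect {F : FRWModel} {S : Spacetime N} {T : N → ℝ} {Ω : ℝ → ℝ}
    {M : Set N} {φ : OpenPartialHomeomorph N Coord}
    (h : IsConformalExtension F.domain F.metric F.flow S T Ω M φ)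
    (hu : IsFlowRegular F.flow S T Ω M φ) :
    IsFlowRegular F.reflect.flow S.reverse (fun p => -T p) (fun T => Ω (-T)) M
      (φ.trans reflectHomeomorph.toOpenPartialHomeomorph) := by
  obtain ⟨ubar, h1, h2, V, hV, hsub, h3⟩ := hu
  refine ⟨fun p => -ubar p, fun p => ?_, fun p hp => ?_, V, hV,
    fun p hp => hsub (neg_eq_zero.1 hp), ?_⟩
  · change S.metric p (-ubar p) (-ubar p) = -1
    simpa using h1 p
  · have hp' : p ∈ φ.source := h.chart_source ▸ hp
    refine (mfderiv_trans_reflect h.chart_mem hp' _).trans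
      ((congrArg reflectL ((map_neg _ _).trans (congrArg Neg.neg (h2 p hp)))).trans ?_)
    change reflectL (-(Ω (T p) • ((1, 0) : Coord))) = Ω (- -T p) • ((1, 0) : Coord)
    simp [reflectL_apply]
  · have := contMDiffVectorBundle_tangentSpace (N := N) (n := 2)
      (WithTop.coe_le_coe.2 (le_top : (3 : ℕ∞) ≤ ⊤))
    exact ContMDiffOn.neg_section h3

theorem admitsRegularPIU_reflect {F : FRWModel} {lam : EReal}
    (h : AdmitsRegularFIU F.domain F.metric F.flow lam) :
    AdmitsRegularPIU F.reflect.domain F.reflect.metric F.reflect.flow lam := by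
  obtain ⟨N, _, _, _, _, _, _, S, T, Ω, φ, h1, h2, h3⟩ := h
  have hM : {p | T p < 0} = {p | 0 < -T p} := by ext p; simp
  exact ⟨N, _, _, ‹_›, ‹_›, ‹_›, ‹_›, S.reverse, fun p => -T p, fun T => Ω (-T),
    φ.trans reflectHomeomorph.toOpenPartialHomeomorph, hM ▸ isConformalExtension_reflect h1,
    h2.comp_neg, hM ▸ isFlowRegular_reflect h1 h3⟩

theorem admitsRegularFIU_reflect {F : FRWModel} {lam : EReal}
    (h : AdmitsRegularPIU F.domain F.metric F.flow lam) :
    AdmitsRegularFIU F.reflect.domain F.reflect.metric F.reflect.flow lam := by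
  obtain ⟨N, _, _, _, _, _, _, S, T, Ω, φ, h1, h2, h3⟩ := h
  have hM : {p | 0 < T p} = {p | -T p < 0} := by ext p; simp
  exact ⟨N, _, _, ‹_›, ‹_›, ‹_›, ‹_›, S.reverse, fun p => -T p, fun T => Ω (-T),
    φ.trans reflectHomeomorph.toOpenPartialHomeomorph, hM ▸ isConformalExtension_reflect h1,
    h2.comp_neg, hM ▸ isFlowRegular_reflect h1 h3⟩

theorem isLUB_reflect_dom {F : FRWModel} {t₀ : ℝ} (h : IsGLB F.dom t₀) :
    IsLUB F.reflect.dom (-t₀) := by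
  refine ⟨fun t ht => ?_, fun t ht => ?_⟩
  · exact le_neg.1 (h.1 ht)
  · refine neg_le.1 (h.2 fun y hy => neg_le.1 (ht ?_))
    change - -y ∈ F.dom
    rwa [neg_neg]

end FRWModel

end Reflection

/-! ### The theorem, with the past case reduced to the future case -/

theorem mainTheorem1 (F : FRWModel) (t₀ : ℝ) :
    (IsLUB F.dom t₀ →
      ((∃ lam : EReal, 1 < lam ∧ lam < ⊤ ∧ AdmitsRegularFIU F.domain F.metric F.flow lam) ↔
        (∃ q : ℝ, 0 < q ∧ Tendsto F.accelRatio (𝓝[<] t₀) (𝓝 q)) ∧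
          Tendsto F.scale (𝓝[<] t₀) atTop)) ∧
    (IsGLB F.dom t₀ →
      ((∃ lam : EReal, 1 < lam ∧ lam < ⊤ ∧ AdmitsRegularPIU F.domain F.metric F.flow lam) ↔
        (∃ q : ℝ, 0 < q ∧ Tendsto F.accelRatio (𝓝[>] t₀) (𝓝 q)) ∧
          Tendsto F.scale (𝓝[>] t₀) atTop)) := by
  have key : ∀ (F : FRWModel) (t₀ : ℝ), IsLUB F.dom t₀ →
      ((∃ lam : EReal, 1 < lam ∧ lam < ⊤ ∧ AdmitsRegularFIU F.domain F.metric F.flow lam) ↔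
        (∃ q : ℝ, 0 < q ∧ Tendsto F.accelRatio (𝓝[<] t₀) (𝓝 q)) ∧
          Tendsto F.scale (𝓝[<] t₀) atTop) := fun F t₀ ht₀ =>
    ⟨fun ⟨_, h1, h2, h⟩ => F.tendsto_of_admitsRegularFIU ht₀ h1 h2 h,
      fun ⟨⟨_, hq, hr⟩, ha⟩ => F.exists_admitsRegularFIU ht₀ hq hr ha⟩
  refine ⟨key F t₀, fun ht₀ => ?_⟩
  have hlim : ∀ {f g : ℝ → ℝ} {l : Filter ℝ}, (∀ t, g t = f (-t)) →
      (Tendsto g (𝓝[<] (-t₀)) l ↔ Tendsto f (𝓝[>] t₀) l) := fun {f g l} hfg =>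
    ⟨fun h => (h.comp tendsto_neg_nhdsGT).congr fun t => by simp [hfg],
      fun h => (h.comp tendsto_neg_nhdsLT_neg).congr fun t => (hfg t).symm⟩
  -- A past structure of `F` at `t₀` is a future structure of the reversed model at `-t₀`; the two
  -- analytic conditions are transported by `t ↦ -t`.
  have h1 := key F.reflect (-t₀) (FRWModel.isLUB_reflect_dom ht₀)
  rw [hlim (fun _ => rfl : ∀ t, F.reflect.scale t = F.scale (-t))] at h1
  simp only [hlim F.accelRatio_reflect] at h1
  rw [← h1]
  refine exists_congr fun lam => and_congr_right fun _ => and_congr_right fun _ =>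
    ⟨FRWModel.admitsRegularFIU_reflect, fun h => ?_⟩
  -- This yields a past structure on the double reflection, which is `F` itself.
  have := FRWModel.admitsRegularPIU_reflect h
  rwa [F.reflect_reflect] at this
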